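/- **Notation.** For $k\ge 1$ let $\mu_k(X_1,\dots,X_k)=\frac{\partial^k}{\partial t_1\cdots\partial t_k}\log\bigl(\exp(t_1X_1)\cdots\exp(t_kX_k)\bigr)\big|_{t=0}$ be the Magnus commutator in free noncommuting variables; it is a Lie polynomial. Let $\Theta_k^{\mathrm{Lie}}=\frac1{k!}\inf\sum_\gamma|\theta_\gamma|$, the infimum being over all presentations $\mu_k=\sum_\gamma\theta_\gamma\,\gamma$ ($\theta_\gamma\in\mathbb R$) as a linear combination of Lie (commutator) monomials $\gamma$ of $X_1,\dots,X_k$ in which each variable occurs exactly once. Let $\mathrm C^{\mathrm{Lie}}_\infty\in[0,\infty]$ be the radius of convergence of $\Theta^{\mathrm{Lie}}(x)=\sum_{k\ge1}\Theta_k^{\mathrm{Lie}}x^k$. For $n\ge 0$ and $f\in L^1([0,1]^n)$ consider the degree-$n$ element $\int f(t)\,Z(t_1)\cdots Z(t_n)$ of the free $\ell^1$ algebra over $[0,1]$ with its tautological noncommutative measure $Z$ (such elements are identified with their densities $f$). Its extended Lie norm $\|\cdot\|_{\ell^1}$ is the infimum of $\sum_j\int_{[0,1]^n}|g_j|$ over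 all finite presentations of the element as $\sum_j\int g_j(s)\,M_j(Z(s_1),\dots,Z(s_n))$, where $g_j\in L^1([0,1]^n)$ and each $M_j(X_1,\dots,X_n)$ is a (possibly empty) product of commutator monomials in which altogether each variable occurs exactly once. For a finite sequence let $\mathrm{asc}$ and $\mathrm{des}$ denote its numbers of ascents and descents. For an integer $p\ge 1$, $\lambda\in[0,1]$ and $t_0,t_p\in[0,1]$ put $$K^{(\lambda),\mathrm{Lie}}_{p-1}(t_0,t_p)=\Bigl\|\int_{(t_1,\dots,t_{p-1})\in[0,1]^{p-1}}\lambda^{\mathrm{asc}(t_0,t_1,\dots,t_p)}(\lambda-1)^{\mathrm{des}(t_0,t_1,\dots,t_p)}\,Z(t_1)\cdots Z(t_{p-1})\Bigr\|_{\ell^1}.$$ **Theorem.** Let $p\ge1$. For every $\lambda\in[0,1]$ the kernel $K^{(\lambda),\mathrm{Lie}}_{p-1}$ defines a bounded integral operator $\mathbf K^{(\lambda),\mathrm{Lie}}_{p-1}$ on the complex Hilbert space $L^2[0,1]$, written to the right: $(f\,\mathbf K^{(\lambda),\mathrm{Lie}}_{p-1})(t)=\int_0^1 f(s)K^{(\lambda),\mathrm{Lie}}_{p-1}(s,t)\,ds$.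 The maxima and the limit below exist (as real numbers), and, with the convention $1/0=\infty$, $$\mathrm C^{\mathrm{Lie}}_\infty\ \ge\ 1\Big/\lim_{n\to\infty}\max_{\lambda\in[0,1]}\bigl\langle 1_{[0,1]}\bigl(\mathbf K^{(\lambda),\mathrm{Lie}}_{p-1}\bigr)^n,1_{[0,1]}\bigr\rangle^{1/(np)} .$$ Consequently, $$\mathrm C^{\mathrm{Lie}}_\infty\ \ge\ 1\Big/\max_{\lambda\in[0,1]}\mathrm r\bigl(\mathbf K^{(\lambda),\mathrm{Lie}}_{p-1}\bigr)^{1/p},$$ where $\mathrm r$ denotes the spectral radius. -/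

import Mathlib

open MeasureTheory Filter Topology Set
open scoped ENNReal NNReal

noncomputable section

namespace MagnusLie

/-! ### Magnus commutators -/

/-- The formal exponential `exp (tᵢ Xᵢ)`, where `X₀, …, X_{k-1}` are free noncommuting variables and
`t₀, …, t_{k-1}` are central formal variables. -/
def expVar (k : ℕ) (i : Fin k) : MvPowerSeries (Fin k) (FreeAlgebra ℝ (Fin k)) :=
  fun d => if d = Finsupp.single i (d i) then
    ((d i).factorial : ℝ)⁻¹ • (FreeAlgebra.ι ℝ i) ^ (d i) else 0

/-- The formal logarithm `∑_{s ≥ 1} (-1)^{s-1} (P - 1)^s / s` of a series `P` with constant term `1`.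
The powers `(P - 1)^s` with `s > |d|` do not contribute to the coefficient at `d`. -/
def formalLog {k : ℕ} (P : MvPowerSeries (Fin k) (FreeAlgebra ℝ (Fin k))) :
    MvPowerSeries (Fin k) (FreeAlgebra ℝ (Fin k)) :=
  fun d => ∑ s ∈ Finset.Icc 1 d.degree,
    ((-1 : ℝ) ^ (s - 1) / (s : ℝ)) • MvPowerSeries.coeff d ((P - 1) ^ s)

/-- The Magnus commutator `μ_k(X₀, …, X_{k-1})`, i.e. the mixed derivative
`∂^k / ∂t₀ ⋯ ∂t_{k-1}` at `t = 0` of `log (exp (t₀ X₀) ⋯ exp (t_{k-1} X_{k-1}))`, which is the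
coefficient of `t₀ ⋯ t_{k-1}`. -/
def magnusCommutator (k : ℕ) : FreeAlgebra ℝ (Fin k) :=
  MvPowerSeries.coeff (Finsupp.equivFunOnFinite.symm fun _ : Fin k => 1)
    (formalLog (List.ofFn (expVar k)).prod)

/-! ### Commutator monomials and the Lie norm -/

/-- The multiset of the leaves of a bracketing. -/
def leaves {α : Type*} : FreeMagma α → Multiset α
  | .of x => {x}
  | .mul a b => leaves a + leaves b

/-- The commutator monomial of a bracketing.  The free Lie algebra is realized as the Lie
subalgebra of the free associative algebra that is generated by the variables. -/
def commMonomial {α : Type*} : FreeMagma α → FreeAlgebra ℝ α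
  | .of x => FreeAlgebra.ι ℝ x
  | .mul a b => ⁅commMonomial a, commMonomial b⁆

/-- The Lie monomials of `X₀, …, X_{k-1}` in which every variable has multiplicity `1`. -/
def lieMonomials (k : ℕ) : Set (FreeAlgebra ℝ (Fin k)) :=
  {M | ∃ B : FreeMagma (Fin k), leaves B = Finset.univ.val ∧ commMonomial B = M}

/-- `Θ_k^Lie`: `1 / k!` times the infimum of `∑ |θ_γ|` over all presentations
`μ_k = ∑ θ_γ γ` by Lie monomials (`∞` if there were no presentation). -/
def thetaLie (k : ℕ) : ℝ≥0∞ :=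
  (k.factorial : ℝ≥0∞)⁻¹ *
    ⨅ (θ : lieMonomials k →₀ ℝ)
      (_ : θ.sum (fun γ c => c • (γ : FreeAlgebra ℝ (Fin k))) = magnusCommutator k),
      ENNReal.ofReal (θ.sum fun _ c => |c|)

/-- `C_∞^Lie`: the convergence radius of `Θ^Lie(x) = ∑_{k ≥ 1} Θ_k^Lie x^k`, a series with
nonnegative coefficients. -/
def lieRadius : ℝ≥0∞ :=
  ⨆ (x : ℝ≥0) (_ : ∑' k : ℕ, thetaLie (k + 1) * (x : ℝ≥0∞) ^ (k + 1) < ∞), (x : ℝ≥0∞)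

/-! ### The extended Lie norm over the interval -/

/-- Products of commutator monomials (the empty product being `1`) in `X₀, …, X_{n-1}`, in which
every variable has multiplicity `1`. -/
def productMonomials (n : ℕ) : Set (FreeAlgebra ℝ (Fin n)) :=
  {M | ∃ L : List (FreeMagma (Fin n)),
    (L.map leaves).sum = Finset.univ.val ∧ (L.map commMonomial).prod = M}

/-- The coefficient of the word `X_{σ(0)} ⋯ X_{σ(n-1)}` in `M`. -/
def wordCoeff {n : ℕ} (M : FreeAlgebra ℝ (Fin n)) (σ : Equiv.Perm (Fin n)) : ℝ :=
  (FreeAlgebra.equivMonoidAlgebraFreeMonoid M : MonoidAlgebra ℝ (FreeMonoid (Fin n))).coeff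
    (FreeMonoid.ofList (List.ofFn σ))

/-- The elements of degree `n` of the free `ℓ¹` algebra over the interval with its tautological
measure `Z` are `∫ f(t) Z(t₀) ⋯ Z(t_{n-1})` with a density `f ∈ L¹([0,1]^n)`.
For `M` multilinear in `X₀, …, X_{n-1}`, this is the density of
`∫ g(s) M(Z(s₀), …, Z(s_{n-1}))`: the word `X_{σ(0)} ⋯ X_{σ(n-1)}` contributes
`∫ g(s) Z(s_{σ(0)}) ⋯ Z(s_{σ(n-1)})`, whose density at `t = s ∘ σ` is `g(s)`. -/
def substDensity {n : ℕ} (M : FreeAlgebra ℝ (Fin n)) (g : (Fin n → unitInterval) → ℝ)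
    (t : Fin n → unitInterval) : ℝ :=
  ∑ σ : Equiv.Perm (Fin n), wordCoeff M σ * g (t ∘ σ.symm)

/-- The extended Lie norm `‖∫ f(t) Z(t₀) ⋯ Z(t_{n-1})‖_{ℓ¹}`: the infimum of `∑_j ∫ |g_j|` over all
presentations of this element as `∑_j ∫ g_j(s) M_j(Z(s₀), …, Z(s_{n-1}))`, where the `M_j` are
products of commutator monomials. -/
def extNorm {n : ℕ} (f : (Fin n → unitInterval) → ℝ) : ℝ≥0∞ :=
  ⨅ (m : ℕ) (M : Fin m → productMonomials n) (g : Fin m → (Fin n → unitInterval) → ℝ)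
    (_ : ∀ j, Integrable (g j)) (_ : f =ᵐ[volume] fun t => ∑ j, substDensity (M j).1 (g j) t),
    ∑ j, ∫⁻ s, ‖g j s‖ₑ

/-! ### The kernel and its integral operator -/

/-- The number of ascents of a finite sequence. -/
def asc {m : ℕ} (t : Fin (m + 1) → unitInterval) : ℕ :=
  (Finset.univ.filter fun i : Fin m => t i.castSucc < t i.succ).card

/-- The number of descents of a finite sequence. -/
def des {m : ℕ} (t : Fin (m + 1) → unitInterval) : ℕ :=
  (Finset.univ.filter fun i : Fin m => t i.succ < t i.castSucc).card

/-- The sequence `(a, t₁, …, t_n, b)`. -/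
def enclose {n : ℕ} (a : unitInterval) (t : Fin n → unitInterval) (b : unitInterval) :
    Fin (n + 1 + 1) → unitInterval :=
  Fin.cons a (Fin.snoc t b : Fin (n + 1) → unitInterval)

/-- The kernel `K_n^{(lam),Lie}(a, b)`, the extended Lie norm of
`∫ lam^{asc(a, t, b)} (lam - 1)^{des(a, t, b)} Z(t₁) ⋯ Z(t_n)` (it is finite). -/
def kernel (n : ℕ) (lam a b : unitInterval) : ℝ :=
  (extNorm fun t : Fin n → unitInterval =>
    (lam : ℝ) ^ asc (enclose a t b) * ((lam : ℝ) - 1) ^ des (enclose a t b)).toReal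

/-- The complex Hilbert space `L²[0,1]`. -/
abbrev L2 : Type := Lp ℂ 2 (volume : Measure unitInterval)

/-- `T` is the integral operator with kernel `k`, written to the right:
`(f T)(t) = ∫ f(s) k(s, t) ds`. -/
def IsIntegralOperator (k : unitInterval → unitInterval → ℝ) (T : L2 →L[ℂ] L2) : Prop :=
  ∀ f : L2, T f =ᵐ[volume] fun t => ∫ s, f s * (k s t : ℂ)

/-- The constant function `1` in `L²[0,1]`. -/
def one : L2 := Lp.const 2 (volume : Measure unitInterval) (1 : ℂ)

/-- The pairing `⟨1 T^n, 1⟩` (it is a real number when the kernel of `T` is real). -/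
def pairing (T : L2 →L[ℂ] L2) (n : ℕ) : ℝ :=
  (inner ℂ one ((T ^ n) one)).re

end MagnusLie

end

/-!
The proof bounds `Θ_k^Lie` from above by duality, so that no presentation of the Magnus commutator
ever has to be written down.

*The Magnus commutator.* In the free algebra modulo words with a repeated letter, `exp Xᵢ` is
`1 + Xᵢ`, so `μ_k` is the multilinear part of `log ((1 + X₀) ⋯ (1 + X_{k-1}))`. Expanding the
resolvent of this product and integrating over its parameter gives the coefficient of the word of a
permutation `σ` as `∫₀¹ lam ^ asc σ * (lam - 1) ^ des σ` (`magnusCommutator_eq_sum`). Moreover `μ_k`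
satisfies the Dynkin–Specht–Wever identity (`dynkin_magnusCommutator`): the product `P` of the
`1 + Xᵢ` obeys `dynkin (Pⁿ) Pⁿ = euler (Pⁿ)` for all `n`, both sides are polynomials in `n`, and the
comparison of the linear terms gives the identity for `log P`.

*Duality.* The Dynkin operator `D` sends every product of commutator monomials of total degree `k` to
`d` times a single commutator monomial with `0 ≤ d ≤ k`. Hence if `φ` is bounded by `1` on Lie
monomials, then `k⁻¹ φ ∘ D` is bounded by `1` on all products of commutator monomials and has the
same value at `μ_k`. By the Hahn–Banach theorem, `k! Θ_k^Lie` is therefore at most the supremum of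
`Φ (μ_k)` over the functionals `Φ` that are bounded by `1` on products of commutator monomials
(`thetaLie_le_of_functional`).

*The block estimate.* Such a `Φ` is transported to the free algebra over the interval by
standardization of words, and the sum over permutations becomes `k!` times an integral over `[0,1]^k`
(`sum_perm_eq_integral`), of `lam ^ asc * (lam - 1) ^ des` against the transported functional. The
path `t₁, …, t_k` is cut at every `p`-th point. When the points outside of one block are fixed and
integrated out, what remains is again a functional that is bounded on products of commutator
monomials, and its pairing with the density of the block is at most its bound times the extended Lie
norm of that density, i.e. the kernel `K (a, b)` at the end points `a`, `b` of the block
(`IsBoundedFunctional.abs_integral_le`). By induction on the number of blocks,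
`Θ_k^Lie ≤ max_lam ⟨1 Kⁿ, 1⟩` for `n = ⌊(k - 1) / p⌋` (`abs_pathIntegral_le_iterKernel`,
`thetaLie_le`).

*The limit and the spectral radius.* The kernel is bounded by `1` and Lipschitz in `lam`, so the
maxima exist, and they are submultiplicative up to a shift of the index, so their `n`-th roots
converge (`exists_growth_rate`); the root test gives the first bound. The operators form an element
of the Banach algebra of continuous functions from `[0,1]` to the bounded operators. Its spectrum is
the union of the spectra of the values, so its spectral radius is the maximum of the spectral radii,
and Gelfand's formula for this one element shows that the limit is at most this maximum
(`ofReal_growth_rate_le`).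
-/

noncomputable section

namespace MagnusLie

/-! ### Words in the free algebra -/

/-- The word `X_{l₀} X_{l₁} ⋯` in the free algebra. -/
def word {X : Type*} (l : List X) : FreeAlgebra ℝ X := (l.map (FreeAlgebra.ι ℝ)).prod

@[simp] lemma word_nil {X : Type*} : word ([] : List X) = 1 := rfl

@[simp] lemma word_cons {X : Type*} (x : X) (l : List X) :
    word (x :: l) = FreeAlgebra.ι ℝ x * word l := by simp [word]

lemma word_append {X : Type*} (l l' : List X) : word (l ++ l') = word l * word l' := by
  simp [word]

lemma lift_word {X Y : Type*} (r : X → Y) (l : List X) :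
    FreeAlgebra.lift ℝ (fun x => FreeAlgebra.ι ℝ (r x)) (word l) = word (l.map r) := by
  induction l with
  | nil => simp
  | cons x l ih => simp [ih]

lemma equiv_word {X : Type*} (l : List X) :
    FreeAlgebra.equivMonoidAlgebraFreeMonoid (word l) =
      MonoidAlgebra.of ℝ (FreeMonoid X) (FreeMonoid.ofList l) := by
  induction l with
  | nil => simp [MonoidAlgebra.one_def]
  | cons x l ih =>
    rw [word_cons, map_mul, ih, FreeMonoid.ofList_cons, map_mul]
    simp [FreeAlgebra.equivMonoidAlgebraFreeMonoid]

lemma basisFreeMonoid_apply {X : Type*} (l : List X) :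
    FreeAlgebra.basisFreeMonoid ℝ X (FreeMonoid.ofList l) = word l := by
  apply FreeAlgebra.equivMonoidAlgebraFreeMonoid.injective
  rw [equiv_word]
  simp [FreeAlgebra.basisFreeMonoid, MonoidAlgebra.of_apply]

/-- A linear map on the free algebra is determined by its values on words. -/
lemma linearMap_ext_word {X M : Type*} [AddCommMonoid M] [Module ℝ M]
    {f g : FreeAlgebra ℝ X →ₗ[ℝ] M} (h : ∀ l, f (word l) = g (word l)) : f = g := by
  refine (FreeAlgebra.basisFreeMonoid ℝ X).ext fun m => ?_
  rw [← FreeMonoid.ofList_toList m, basisFreeMonoid_apply]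
  exact h _

/-- The linear map with prescribed values on words. -/
def wordLift {X M : Type*} [AddCommMonoid M] [Module ℝ M] (f : List X → M) :
    FreeAlgebra ℝ X →ₗ[ℝ] M :=
  (FreeAlgebra.basisFreeMonoid ℝ X).constr ℝ fun m => f m.toList

@[simp] lemma wordLift_word {X M : Type*} [AddCommMonoid M] [Module ℝ M] (f : List X → M)
    (l : List X) : wordLift f (word l) = f l := by
  rw [wordLift, ← basisFreeMonoid_apply, Module.Basis.constr_basis, FreeMonoid.toList_ofList]

/-- The coefficient of the word of `l`. -/
def listCoeff {X : Type*} (l : List X) : FreeAlgebra ℝ X →ₗ[ℝ] ℝ :=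
  wordLift fun l' => by classical exact if l' = l then 1 else 0

@[simp] lemma listCoeff_word {X : Type*} (l l' : List X) [Decidable (l' = l)] :
    listCoeff l (word l') = if l' = l then 1 else 0 := by
  rw [listCoeff, wordLift_word]; congr

lemma wordCoeff_eq_listCoeff {n : ℕ} (M : FreeAlgebra ℝ (Fin n)) (σ : Equiv.Perm (Fin n)) :
    wordCoeff M σ = listCoeff (List.ofFn σ) M := by
  let f : FreeAlgebra ℝ (Fin n) →ₗ[ℝ] ℝ :=
    { toFun := fun M => wordCoeff M σ
      map_add' := fun a b => by simp [wordCoeff]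
      map_smul' := fun a b => by simp [wordCoeff] }
  have : f = listCoeff (List.ofFn σ) := by
    refine linearMap_ext_word fun l => ?_
    classical
    rw [listCoeff_word]
    change wordCoeff _ _ = _
    rw [wordCoeff, equiv_word]
    simp [Finsupp.single_apply]
  exact congrArg (fun g => g M) this

/-- The span of the words whose letters form the multiset `c`. -/
def wordSpan {X : Type*} (c : Multiset X) : Submodule ℝ (FreeAlgebra ℝ X) :=
  Submodule.span ℝ {a | ∃ l : List X, (l : Multiset X) = c ∧ word l = a}

lemma word_mem_wordSpan {X : Type*} (l : List X) : word l ∈ wordSpan (l : Multiset X) :=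
  Submodule.subset_span ⟨l, rfl, rfl⟩

lemma ι_mem_wordSpan {X : Type*} (x : X) : FreeAlgebra.ι ℝ x ∈ wordSpan ({x} : Multiset X) := by
  simpa using word_mem_wordSpan [x]

lemma wordSpan_mul {X : Type*} {c d : Multiset X} {a b : FreeAlgebra ℝ X}
    (ha : a ∈ wordSpan c) (hb : b ∈ wordSpan d) : a * b ∈ wordSpan (c + d) := by
  have := Submodule.mul_mem_mul ha hb
  rw [wordSpan, wordSpan, Submodule.span_mul_span] at this
  refine Submodule.span_mono ?_ this
  rintro _ ⟨_, ⟨l, rfl, rfl⟩, _, ⟨l', rfl, rfl⟩, rfl⟩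
  exact ⟨l ++ l', by simp, word_append _ _⟩

lemma wordSpan_lie {X : Type*} {c d : Multiset X} {a b : FreeAlgebra ℝ X}
    (ha : a ∈ wordSpan c) (hb : b ∈ wordSpan d) : ⁅a, b⁆ ∈ wordSpan (c + d) := by
  rw [Ring.lie_def]
  exact Submodule.sub_mem _ (wordSpan_mul ha hb) (add_comm d c ▸ wordSpan_mul hb ha)

/-- Two linear maps that agree on all words with letters `c` agree on `wordSpan c`. -/
lemma eqOn_wordSpan {X M : Type*} [AddCommMonoid M] [Module ℝ M] {c : Multiset X}
    {f g : FreeAlgebra ℝ X →ₗ[ℝ] M}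
    (h : ∀ l : List X, (l : Multiset X) = c → f (word l) = g (word l)) {a : FreeAlgebra ℝ X}
    (ha : a ∈ wordSpan c) : f a = g a := by
  refine LinearMap.eqOn_span (s := {a | ∃ l : List X, (l : Multiset X) = c ∧ word l = a}) ?_ ha
  rintro _ ⟨l, hl, rfl⟩
  exact h l hl

lemma commMonomial_mem_wordSpan {X : Type*} (B : FreeMagma X) :
    commMonomial B ∈ wordSpan (leaves B) := by
  induction B with
  | ih1 x => exact ι_mem_wordSpan x
  | ih2 a b iha ihb => exact wordSpan_lie iha ihb

/-- The product of the commutator monomials of a list of bracketings. -/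
def commProd {X : Type*} (L : List (FreeMagma X)) : FreeAlgebra ℝ X := (L.map commMonomial).prod

/-- The multiset of all leaves of a list of bracketings. -/
def content {X : Type*} (L : List (FreeMagma X)) : Multiset X := (L.map leaves).sum

@[simp] lemma commProd_nil {X : Type*} : commProd ([] : List (FreeMagma X)) = 1 := rfl

@[simp] lemma commProd_cons {X : Type*} (B : FreeMagma X) (L : List (FreeMagma X)) :
    commProd (B :: L) = commMonomial B * commProd L := by simp [commProd]

@[simp] lemma content_nil {X : Type*} : content ([] : List (FreeMagma X)) = 0 := rfl

@[simp] lemma content_cons {X : Type*} (B : FreeMagma X) (L : List (FreeMagma X)) :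
    content (B :: L) = leaves B + content L := by simp [content]

lemma commProd_append {X : Type*} (L L' : List (FreeMagma X)) :
    commProd (L ++ L') = commProd L * commProd L' := by
  simp [commProd]

lemma commProd_mem_wordSpan {X : Type*} (L : List (FreeMagma X)) :
    commProd L ∈ wordSpan (content L) := by
  induction L with
  | nil => simpa using word_mem_wordSpan ([] : List X)
  | cons B L ih =>
    rw [commProd_cons, content_cons]
    exact wordSpan_mul (commMonomial_mem_wordSpan B) ih

lemma mem_productMonomials {n : ℕ} {M : FreeAlgebra ℝ (Fin n)} :
    M ∈ productMonomials n ↔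
      ∃ L : List (FreeMagma (Fin n)), content L = Finset.univ.val ∧ commProd L = M := Iff.rfl

/-- A word is the product of the one-letter commutator monomials. -/
lemma commProd_map_of {X : Type*} (l : List X) : commProd (l.map FreeMagma.of) = word l := by
  induction l with
  | nil => rfl
  | cons x l ih => simp [ih, commMonomial]

lemma content_map_of {X : Type*} (l : List X) : content (l.map FreeMagma.of) = (l : Multiset X) := by
  induction l with
  | nil => rfl
  | cons x l ih => simp [ih, leaves]

section Rename

variable {X Y : Type*} (r : X → Y)

lemma lift_commMonomial (B : FreeMagma X) :
    FreeAlgebra.lift ℝ (fun x => FreeAlgebra.ι ℝ (r x)) (commMonomial B) =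
      commMonomial (FreeMagma.map r B) := by
  induction B with
  | ih1 x => simp [commMonomial]
  | ih2 a b iha ihb =>
    change FreeAlgebra.lift ℝ _ ⁅commMonomial a, commMonomial b⁆ =
      ⁅commMonomial (FreeMagma.map r a), commMonomial (FreeMagma.map r b)⁆
    rw [← iha, ← ihb, Ring.lie_def, Ring.lie_def]
    simp

lemma leaves_map (B : FreeMagma X) : leaves (FreeMagma.map r B) = (leaves B).map r := by
  induction B with
  | ih1 x => rfl
  | ih2 a b iha ihb =>
    change leaves (FreeMagma.map r a) + leaves (FreeMagma.map r b) = (leaves a + leaves b).map r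
    rw [iha, ihb, Multiset.map_add]

lemma lift_commProd (L : List (FreeMagma X)) :
    FreeAlgebra.lift ℝ (fun x => FreeAlgebra.ι ℝ (r x)) (commProd L) =
      commProd (L.map (FreeMagma.map r)) := by
  induction L with
  | nil => simp
  | cons B L ih =>
    rw [commProd_cons, map_mul, ih, lift_commMonomial, List.map_cons, commProd_cons]

lemma content_map (L : List (FreeMagma X)) :
    content (L.map (FreeMagma.map r)) = (content L).map r := by
  induction L with
  | nil => simp
  | cons B L ih => rw [List.map_cons, content_cons, ih, leaves_map, content_cons, Multiset.map_add]

end Rename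

/-- A list that enumerates `Fin n` is given by a permutation. -/
lemma exists_perm_of_coe_eq_univ {n : ℕ} (l : List (Fin n))
    (h : (l : Multiset (Fin n)) = Finset.univ.val) :
    ∃ σ : Equiv.Perm (Fin n), l = List.ofFn σ := by
  have hlen : l.length = n := by
    have := congrArg Multiset.card h
    simpa using this
  have hnd : l.Nodup := by
    rw [← Multiset.coe_nodup, h]; exact Finset.univ.nodup
  have hinj : Function.Injective fun i : Fin n => l.get (i.cast hlen.symm) :=
    (List.nodup_iff_injective_get.1 hnd).comp (Fin.cast_injective _)
  refine ⟨Equiv.ofBijective _ (Finite.injective_iff_bijective.1 hinj), ?_⟩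
  apply List.ext_get <;> simp [hlen]

lemma coe_ofFn_perm {n : ℕ} (σ : Equiv.Perm (Fin n)) :
    (List.ofFn σ : Multiset (Fin n)) = Finset.univ.val := by
  refine (Multiset.Nodup.ext ?_ Finset.univ.nodup).2 ?_
  · exact Multiset.coe_nodup.2 (List.nodup_ofFn.2 σ.injective)
  · intro a
    simp [List.mem_ofFn, σ.surjective a]

/-- A multilinear element of the free algebra on `Fin n` is the combination of the words of the
permutations with its word coefficients. -/
lemma eq_sum_wordCoeff {n : ℕ} {M : FreeAlgebra ℝ (Fin n)}
    (hM : M ∈ wordSpan (Finset.univ.val : Multiset (Fin n))) :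
    M = ∑ σ : Equiv.Perm (Fin n), wordCoeff M σ • word (List.ofFn σ) := by
  simp only [wordCoeff_eq_listCoeff]
  let g : FreeAlgebra ℝ (Fin n) →ₗ[ℝ] FreeAlgebra ℝ (Fin n) :=
    ∑ σ : Equiv.Perm (Fin n), (listCoeff (List.ofFn σ)).smulRight (word (List.ofFn σ))
  have key := eqOn_wordSpan (f := LinearMap.id) (g := g) (c := Finset.univ.val) (fun l hl => by
    obtain ⟨σ, rfl⟩ := exists_perm_of_coe_eq_univ l hl
    simp only [LinearMap.id_apply, g, LinearMap.sum_apply, LinearMap.smulRight_apply,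
      listCoeff_word]
    rw [Finset.sum_eq_single σ]
    · simp
    · intro τ _ hτ
      rw [if_neg, zero_smul]
      intro h
      exact hτ (Equiv.coe_fn_injective (List.ofFn_injective h)).symm
    · simp) hM
  simpa [g] using key

/-! ### The Dynkin operator -/

section Dynkin

variable {X : Type*}

/-- The algebra homomorphism `FreeAlgebra → End` that extends `x ↦ [x, ·]`. -/
def adHom : FreeAlgebra ℝ X →ₐ[ℝ] Module.End ℝ (FreeAlgebra ℝ X) :=
  FreeAlgebra.lift ℝ fun x =>
    LinearMap.mulLeft ℝ (FreeAlgebra.ι ℝ x) - LinearMap.mulRight ℝ (FreeAlgebra.ι ℝ x)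

lemma adHom_ι (x : X) (z : FreeAlgebra ℝ X) :
    adHom (FreeAlgebra.ι ℝ x) z = FreeAlgebra.ι ℝ x * z - z * FreeAlgebra.ι ℝ x := by
  simp [adHom]

lemma adHom_mul (a b z : FreeAlgebra ℝ X) : adHom (a * b) z = adHom a (adHom b z) := by
  simp

/-- The augmentation, i.e. the constant term. -/
def augmentation : FreeAlgebra ℝ X →ₐ[ℝ] ℝ := FreeAlgebra.algebraMapInv

@[simp] lemma augmentation_ι (x : X) : augmentation (FreeAlgebra.ι ℝ x) = 0 := by
  simp [augmentation, FreeAlgebra.algebraMapInv]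

/-- The representation of the free algebra on `FreeAlgebra × ℝ` in which `x` sends `(z, c)` to
`([x, z] + c x, 0)`.  Its action on the vector `(0, 1)` encodes the Dynkin operator. -/
def dynkinRep : FreeAlgebra ℝ X →ₐ[ℝ] Module.End ℝ (FreeAlgebra ℝ X × ℝ) :=
  FreeAlgebra.lift ℝ fun x =>
    LinearMap.inl ℝ (FreeAlgebra ℝ X) ℝ ∘ₗ
      ((adHom (FreeAlgebra.ι ℝ x)).coprod (LinearMap.toSpanSingleton ℝ _ (FreeAlgebra.ι ℝ x)))

/-- The Dynkin operator, sending `x₁ ⋯ xₙ` to `[x₁, [x₂, …, [xₙ₋₁, xₙ]]]` and `1` to `0`. -/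
def dynkin : FreeAlgebra ℝ X →ₗ[ℝ] FreeAlgebra ℝ X :=
  LinearMap.fst ℝ _ _ ∘ₗ (LinearMap.applyₗ ((0 : FreeAlgebra ℝ X), (1 : ℝ))) ∘ₗ
    dynkinRep.toLinearMap

lemma dynkinRep_apply (a : FreeAlgebra ℝ X) (z : FreeAlgebra ℝ X) (c : ℝ) :
    dynkinRep a (z, c) = (adHom a z + c • dynkin a, c * augmentation a) := by
  have h0 : ∀ a : FreeAlgebra ℝ X, dynkin a = (dynkinRep a (0, 1)).1 := fun a => rfl
  simp only [h0]
  induction a using FreeAlgebra.induction generalizing z c with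
  | grade0 r => simp [Algebra.algebraMap_eq_smul_one, mul_comm]
  | grade1 x => simp [dynkinRep]
  | mul a b iha ihb =>
    simp only [map_mul, Module.End.mul_apply]
    rw [ihb z c, iha, ihb 0 1, iha (adHom b 0 + (1 : ℝ) • _) (1 * augmentation b)]
    ext
    · simp [smul_smul, add_assoc]
    · simp; ring
  | add a b iha ihb =>
    simp only [map_add, LinearMap.add_apply]
    rw [iha, ihb]
    ext
    · simp; abel
    · simp; ring

@[simp] lemma dynkin_ι (x : X) : dynkin (FreeAlgebra.ι ℝ x) = FreeAlgebra.ι ℝ x := by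
  simp [dynkin, dynkinRep]

@[simp] lemma dynkin_one : dynkin (1 : FreeAlgebra ℝ X) = 0 := by
  simp [dynkin]

lemma dynkin_mul (a b : FreeAlgebra ℝ X) :
    dynkin (a * b) = adHom a (dynkin b) + augmentation b • dynkin a := by
  have h : dynkinRep (a * b) (0, 1) = dynkinRep a (dynkinRep b (0, 1)) := by simp
  rw [dynkinRep_apply, dynkinRep_apply b, dynkinRep_apply a] at h
  simpa using congrArg Prod.fst h

lemma augmentation_commMonomial (B : FreeMagma X) : augmentation (commMonomial B) = 0 := by
  induction B with
  | ih1 x => simp [commMonomial]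
  | ih2 a b iha ihb =>
    change augmentation ⁅commMonomial a, commMonomial b⁆ = 0
    rw [Ring.lie_def]
    simp [iha]

/-- For a Lie element `a`, the extension `adHom a` is the bracket with `a`. -/
lemma adHom_commMonomial (B : FreeMagma X) (z : FreeAlgebra ℝ X) :
    adHom (commMonomial B) z = ⁅commMonomial B, z⁆ := by
  induction B generalizing z with
  | ih1 x => exact (adHom_ι x z).trans (Ring.lie_def _ _).symm
  | ih2 a b iha ihb =>
    change adHom ⁅commMonomial a, commMonomial b⁆ z = ⁅⁅commMonomial a, commMonomial b⁆, z⁆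
    rw [Ring.lie_def (commMonomial a) (commMonomial b), map_sub, LinearMap.sub_apply, adHom_mul,
      adHom_mul, iha, ihb, iha, ihb]
    simp only [Ring.lie_def]
    noncomm_ring

/-- Dynkin–Specht–Wever for commutator monomials. -/
lemma dynkin_commMonomial (B : FreeMagma X) :
    dynkin (commMonomial B) = ((leaves B).card : ℝ) • commMonomial B := by
  induction B with
  | ih1 x => simp [commMonomial, leaves]
  | ih2 a b iha ihb =>
    change dynkin ⁅commMonomial a, commMonomial b⁆ =
      ((leaves a + leaves b).card : ℝ) • ⁅commMonomial a, commMonomial b⁆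
    rw [Ring.lie_def, map_sub, dynkin_mul, dynkin_mul, augmentation_commMonomial,
      augmentation_commMonomial, iha, ihb, map_smul, map_smul, adHom_commMonomial,
      adHom_commMonomial, Multiset.card_add, Ring.lie_def, Ring.lie_def]
    push_cast
    module

lemma augmentation_commProd_cons (B : FreeMagma X) (L : List (FreeMagma X)) :
    augmentation (commProd (B :: L)) = 0 := by
  simp [augmentation_commMonomial]

/-- The Dynkin operator sends a product `P₁ ⋯ Pᵣ` of commutator monomials to
`deg Pᵣ • [P₁, [P₂, …, Pᵣ]]`, which is a multiple of a single commutator monomial. -/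
lemma dynkin_commProd (L : List (FreeMagma X)) (hL : L ≠ []) :
    ∃ (B : FreeMagma X) (d : ℕ), leaves B = content L ∧ d ≤ (content L).card ∧
      dynkin (commProd L) = (d : ℝ) • commMonomial B := by
  induction L with
  | nil => exact absurd rfl hL
  | cons P L ih =>
    rcases L with _ | ⟨Q, L⟩
    · exact ⟨P, (leaves P).card, by simp, by simp, by simp [dynkin_commMonomial]⟩
    · obtain ⟨B, d, hB, hd, h⟩ := ih (by simp)
      refine ⟨P * B, d, ?_, ?_, ?_⟩
      · rw [content_cons, ← hB]; rfl
      · rw [content_cons, Multiset.card_add]; omega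
      · rw [commProd_cons, dynkin_mul, h, augmentation_commProd_cons, zero_smul, add_zero,
          map_smul, adHom_commMonomial]
        rfl

lemma adHom_mem_wordSpan (x : X) {c : Multiset X} {z : FreeAlgebra ℝ X} (hz : z ∈ wordSpan c) :
    adHom (FreeAlgebra.ι ℝ x) z ∈ wordSpan ({x} + c) := by
  rw [adHom_ι, ← Ring.lie_def]
  exact wordSpan_lie (ι_mem_wordSpan x) hz

/-- The Dynkin operator preserves the letters of a word. -/
lemma dynkin_word_mem (l : List X) : dynkin (word l) ∈ wordSpan (l : Multiset X) := by
  induction l with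
  | nil => simp
  | cons x l ih =>
    rw [word_cons, dynkin_mul]
    have h := adHom_mem_wordSpan x ih
    refine Submodule.add_mem _ h ?_
    rcases l with _ | ⟨y, l⟩
    · rw [dynkin_ι]
      exact Submodule.smul_mem _ _ (ι_mem_wordSpan x)
    · rw [word_cons, map_mul, augmentation_ι, zero_mul, zero_smul]
      exact Submodule.zero_mem _

/-! ### Words with a repeated letter -/

/-- The span of the words with a repeated letter. -/
def repeatSpan (X : Type*) : Submodule ℝ (FreeAlgebra ℝ X) :=
  Submodule.span ℝ {a | ∃ l : List X, ¬ l.Nodup ∧ word l = a}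

lemma mem_repeatSpan_of_mem_wordSpan {c : Multiset X} (hc : ¬ c.Nodup) {a : FreeAlgebra ℝ X}
    (ha : a ∈ wordSpan c) : a ∈ repeatSpan X := by
  refine Submodule.span_mono ?_ ha
  rintro _ ⟨l, rfl, rfl⟩
  exact ⟨l, by simpa using hc, rfl⟩

lemma span_words_eq_top : Submodule.span ℝ {a : FreeAlgebra ℝ X | ∃ l : List X, word l = a} = ⊤ := by
  rw [eq_top_iff, ← (FreeAlgebra.basisFreeMonoid ℝ X).span_eq]
  refine Submodule.span_mono ?_
  rintro _ ⟨m, rfl⟩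
  exact ⟨m.toList, (basisFreeMonoid_apply _).symm⟩

lemma word_induction {p : FreeAlgebra ℝ X → Prop} (a : FreeAlgebra ℝ X)
    (word : ∀ l, p (word l)) (zero : p 0) (add : ∀ a b, p a → p b → p (a + b))
    (smul : ∀ (r : ℝ) a, p a → p (r • a)) : p a := by
  have ha : a ∈ Submodule.span ℝ {a : FreeAlgebra ℝ X | ∃ l : List X, MagnusLie.word l = a} := by
    rw [span_words_eq_top]; trivial
  induction ha using Submodule.span_induction with
  | mem x h => obtain ⟨l, rfl⟩ := h; exact word l
  | zero => exact zero
  | add x y _ _ hx hy => exact add x y hx hy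
  | smul r x _ hx => exact smul r x hx

lemma repeatSpan_mul_left (b : FreeAlgebra ℝ X) {a : FreeAlgebra ℝ X} (ha : a ∈ repeatSpan X) :
    b * a ∈ repeatSpan X := by
  induction b using word_induction with
  | word l =>
    have h : repeatSpan X ≤ (repeatSpan X).comap (LinearMap.mulLeft ℝ (word l)) := by
      refine Submodule.span_le.2 ?_
      rintro _ ⟨l', hl', rfl⟩
      exact Submodule.subset_span ⟨l ++ l', fun h => hl' h.of_append_right, word_append _ _⟩
    exact h ha
  | zero => simp
  | add b c hb hc => rw [add_mul]; exact add_mem hb hc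
  | smul r b hb => rw [smul_mul_assoc]; exact Submodule.smul_mem _ _ hb

lemma repeatSpan_mul_right (b : FreeAlgebra ℝ X) {a : FreeAlgebra ℝ X} (ha : a ∈ repeatSpan X) :
    a * b ∈ repeatSpan X := by
  induction b using word_induction with
  | word l =>
    have h : repeatSpan X ≤ (repeatSpan X).comap (LinearMap.mulRight ℝ (word l)) := by
      refine Submodule.span_le.2 ?_
      rintro _ ⟨l', hl', rfl⟩
      exact Submodule.subset_span ⟨l' ++ l, fun h => hl' h.of_append_left, word_append _ _⟩
    exact h ha
  | zero => simp
  | add b c hb hc => rw [mul_add]; exact add_mem hb hc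
  | smul r b hb => rw [mul_smul_comm]; exact Submodule.smul_mem _ _ hb

/-- A product in which the letter `x` occurs twice lies in the span of the words with a repeated
letter. -/
lemma ι_mul_mul_ι_mem_repeatSpan (x : X) (a : FreeAlgebra ℝ X) :
    FreeAlgebra.ι ℝ x * a * FreeAlgebra.ι ℝ x ∈ repeatSpan X := by
  induction a using word_induction with
  | word l =>
    refine Submodule.subset_span ⟨x :: (l ++ [x]), by simp, ?_⟩
    rw [word_cons, word_append, word_cons, word_nil, mul_one, mul_assoc]
  | zero => simp
  | add b c hb hc =>
    have h := Submodule.add_mem _ hb hc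
    rwa [← add_mul, ← mul_add] at h
  | smul r b hb =>
    rw [mul_smul_comm, smul_mul_assoc]; exact Submodule.smul_mem _ _ hb

lemma dynkin_mem_repeatSpan {a : FreeAlgebra ℝ X} (ha : a ∈ repeatSpan X) :
    dynkin a ∈ repeatSpan X := by
  have h : repeatSpan X ≤ (repeatSpan X).comap dynkin := by
    refine Submodule.span_le.2 ?_
    rintro _ ⟨l, hl, rfl⟩
    exact mem_repeatSpan_of_mem_wordSpan (by simpa using hl) (dynkin_word_mem l)
  exact h ha

/-! ### Group-like elements modulo repeated letters -/

/-- The Euler derivation, multiplying a word by its length. -/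
def euler : FreeAlgebra ℝ X →ₗ[ℝ] FreeAlgebra ℝ X := wordLift fun l => (l.length : ℝ) • word l

lemma euler_word (l : List X) : euler (word l) = (l.length : ℝ) • word l := by simp [euler]

lemma euler_mul (a b : FreeAlgebra ℝ X) : euler (a * b) = euler a * b + a * euler b := by
  induction a using word_induction with
  | word l =>
    induction b using word_induction with
    | word l' =>
      rw [← word_append, euler_word, euler_word, euler_word, word_append, List.length_append]
      simp [add_smul]
    | zero => simp
    | add b c hb hc => simp only [mul_add, map_add, hb, hc]; abel
    | smul r b hb => simp only [mul_smul_comm, map_smul, hb, smul_add]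
  | zero => simp
  | add a c ha hc => simp only [add_mul, map_add, ha, hc]; abel
  | smul r a ha => simp only [smul_mul_assoc, map_smul, ha, smul_add]

lemma euler_ι (x : X) : euler (FreeAlgebra.ι ℝ x) = FreeAlgebra.ι ℝ x := by
  simpa using euler_word [x]

lemma euler_one : euler (1 : FreeAlgebra ℝ X) = 0 := by
  simpa using euler_word ([] : List X)

lemma euler_mem_repeatSpan {a : FreeAlgebra ℝ X} (ha : a ∈ repeatSpan X) :
    euler a ∈ repeatSpan X := by
  have h : repeatSpan X ≤ (repeatSpan X).comap euler := by
    refine Submodule.span_le.2 ?_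
    rintro _ ⟨l, hl, rfl⟩
    change euler (word l) ∈ repeatSpan X
    rw [euler_word]
    exact Submodule.smul_mem _ _ (Submodule.subset_span ⟨l, hl, rfl⟩)
  exact h ha

/-- The properties of group-like elements that are used, modulo words with a repeated letter:
the adjoint action is the conjugation, and `dynkin g = euler g * g⁻¹`. -/
structure IsGroupLike (g : FreeAlgebra ℝ X) : Prop where
  augmentation_eq : augmentation g = 1
  conj : ∀ z, adHom g z * g - g * z ∈ repeatSpan X
  dynkin_mul_self : dynkin g * g - euler g ∈ repeatSpan X

lemma IsGroupLike.one : IsGroupLike (1 : FreeAlgebra ℝ X) :=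
  ⟨by simp, by simp, by simp [euler_one]⟩

/-- Modulo words with a repeated letter, `1 + x` is the exponential of `x`. -/
lemma IsGroupLike.one_add_ι (x : X) : IsGroupLike (1 + FreeAlgebra.ι ℝ x) := by
  refine ⟨by simp, fun z => ?_, ?_⟩
  · have h1 := ι_mul_mul_ι_mem_repeatSpan x z
    have h2 := repeatSpan_mul_left z (ι_mul_mul_ι_mem_repeatSpan x 1)
    convert sub_mem h1 h2 using 1
    rw [map_add, LinearMap.add_apply, adHom_ι, map_one, Module.End.one_apply]
    noncomm_ring
  · have h1 := ι_mul_mul_ι_mem_repeatSpan x 1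
    convert h1 using 1
    rw [map_add, map_add, dynkin_one, euler_one, dynkin_ι, euler_ι]
    noncomm_ring

lemma IsGroupLike.mul {g h : FreeAlgebra ℝ X} (hg : IsGroupLike g) (hh : IsGroupLike h) :
    IsGroupLike (g * h) := by
  refine ⟨by simp [hg.1, hh.1], fun z => ?_, ?_⟩
  · have h1 := repeatSpan_mul_right h (hg.conj (adHom h z))
    have h2 := repeatSpan_mul_left g (hh.conj z)
    convert add_mem h1 h2 using 1
    rw [adHom_mul]
    noncomm_ring
  · have h1 := repeatSpan_mul_right h (hg.conj (dynkin h))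
    have h2 := repeatSpan_mul_left g hh.dynkin_mul_self
    have h3 := repeatSpan_mul_right h hg.dynkin_mul_self
    convert add_mem (add_mem h1 h2) h3 using 1
    rw [dynkin_mul, euler_mul, hh.augmentation_eq, one_smul]
    noncomm_ring

lemma IsGroupLike.pow {g : FreeAlgebra ℝ X} (hg : IsGroupLike g) (n : ℕ) :
    IsGroupLike (g ^ n) := by
  induction n with
  | zero => simpa using IsGroupLike.one
  | succ n ih => rw [pow_succ]; exact ih.mul hg

end Dynkin

/-! ### The linear coefficient of a polynomial in the exponent -/

section Binomial

open Polynomial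

/-- The binomial coefficient `X (X - 1) ⋯ (X - s + 1) / s!` as a polynomial. -/
def binomPoly (s : ℕ) : ℝ[X] := C ((s.factorial : ℝ)⁻¹) * descPochhammer ℝ s

lemma eval_binomPoly (s n : ℕ) : (binomPoly s).eval (n : ℝ) = (n.choose s : ℝ) := by
  rw [binomPoly, eval_mul, eval_C, descPochhammer_eval_eq_descFactorial,
    Nat.descFactorial_eq_factorial_mul_choose]
  push_cast
  field_simp

lemma eval_zero_binomPoly (s : ℕ) : (binomPoly s).eval 0 = if s = 0 then 1 else 0 := by
  have := eval_binomPoly s 0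
  rw [Nat.cast_zero] at this
  rw [this]
  cases s <;> simp

lemma eval_zero_derivative_descPochhammer (s : ℕ) :
    (derivative (descPochhammer ℝ (s + 1))).eval 0 = (-1) ^ s * (s.factorial : ℝ) := by
  induction s with
  | zero => simp
  | succ s ih =>
    rw [descPochhammer_succ_right, derivative_mul, eval_add, eval_mul, eval_mul, ih,
      show (descPochhammer ℝ (s + 1)).eval 0 = 0 from by simp]
    simp [Nat.factorial_succ]
    ring

/-- The coefficients of the logarithm series are the linear coefficients of the binomial
coefficients. -/
lemma eval_zero_derivative_binomPoly (s : ℕ) (hs : s ≠ 0) :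
    (derivative (binomPoly s)).eval 0 = (-1) ^ (s - 1) / (s : ℝ) := by
  obtain ⟨s, rfl⟩ := Nat.exists_eq_succ_of_ne_zero hs
  rw [binomPoly, derivative_C_mul, eval_mul, eval_C, Nat.succ_eq_add_one,
    eval_zero_derivative_descPochhammer, Nat.factorial_succ]
  push_cast
  have := Nat.factorial_ne_zero s
  field_simp

/-- If a quadratic expression in the binomial coefficients `n.choose s` agrees with a linear one
for all `n`, then the linear terms in `n` agree. -/
lemma sum_log_coeff_eq {S : ℕ} {α : ℕ → ℕ → ℝ} {β : ℕ → ℝ} (hα : ∀ t, α 0 t = 0)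
    (h : ∀ n : ℕ, ∑ s ∈ Finset.range (S + 1), ∑ t ∈ Finset.range (S + 1),
      (n.choose s : ℝ) * (n.choose t : ℝ) * α s t =
        ∑ s ∈ Finset.range (S + 1), (n.choose s : ℝ) * β s) :
    ∑ s ∈ Finset.Icc 1 S, (-1 : ℝ) ^ (s - 1) / (s : ℝ) * α s 0 =
      ∑ s ∈ Finset.Icc 1 S, (-1 : ℝ) ^ (s - 1) / (s : ℝ) * β s := by
  let Q₁ : ℝ[X] := ∑ s ∈ Finset.range (S + 1), ∑ t ∈ Finset.range (S + 1),
      binomPoly s * binomPoly t * C (α s t)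
  let Q₂ : ℝ[X] := ∑ s ∈ Finset.range (S + 1), binomPoly s * C (β s)
  -- both sides are polynomials in `n` that agree at all natural numbers
  have hQ : Q₁ = Q₂ := by
    refine Polynomial.eq_of_infinite_eval_eq _ _ ?_
    refine (Set.infinite_range_of_injective (Nat.cast_injective (R := ℝ))).mono ?_
    rintro _ ⟨n, rfl⟩
    simpa [Q₁, Q₂, eval_finsetSum, eval_binomPoly] using h n
  have hd := congrArg (fun Q => (derivative Q).eval 0) hQ
  have hsum : ∀ f : ℕ → ℝ, f 0 = 0 →
      ∑ s ∈ Finset.range (S + 1), f s = ∑ s ∈ Finset.Icc 1 S, f s := by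
    intro f hf
    rw [Finset.sum_range_succ', hf, add_zero, Finset.range_eq_Ico, Finset.sum_Ico_add' f 0 S 1]
    rfl
  have h1 : (derivative Q₁).eval 0 =
      ∑ s ∈ Finset.range (S + 1), (derivative (binomPoly s)).eval 0 * α s 0 := by
    simp only [Q₁, derivative_sum, eval_finsetSum, derivative_mul, derivative_C, mul_zero,
      add_zero, eval_mul, eval_add, eval_C, eval_zero_binomPoly]
    refine Finset.sum_congr rfl fun s _ => ?_
    rw [Finset.sum_eq_single 0]
    · rcases eq_or_ne s 0 with rfl | hs
      · simp [hα]
      · simp [hs]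
    · intro t _ ht
      rcases eq_or_ne s 0 with rfl | hs
      · simp [hα]
      · simp [hs, ht]
    · simp
  have h2 : (derivative Q₂).eval 0 =
      ∑ s ∈ Finset.range (S + 1), (derivative (binomPoly s)).eval 0 * β s := by
    simp [Q₂, eval_finsetSum]
  have h0 : (derivative (binomPoly 0)).eval 0 = 0 := by simp [binomPoly]
  simp only [h1, h2] at hd
  rw [hsum _ (by simp [h0]), hsum _ (by simp [h0])] at hd
  convert hd using 1 <;>
  · refine Finset.sum_congr rfl fun s hs => ?_
    rw [eval_zero_derivative_binomPoly s (by rw [Finset.mem_Icc] at hs; omega)]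

end Binomial

/-! ### The logarithm of `(1 + X₀) ⋯ (1 + X_{k-1})` -/

section Log

variable {k : ℕ}

/-- The product of the `1 + Xᵢ`, in the order of the list. -/
def onePlusProd {X : Type*} (L : List X) : FreeAlgebra ℝ X :=
  (L.map fun i => 1 + FreeAlgebra.ι ℝ i).prod

@[simp] lemma onePlusProd_nil {X : Type*} : onePlusProd ([] : List X) = 1 := rfl

@[simp] lemma onePlusProd_cons {X : Type*} (x : X) (L : List X) :
    onePlusProd (x :: L) = (1 + FreeAlgebra.ι ℝ x) * onePlusProd L := by simp [onePlusProd]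

lemma isGroupLike_onePlusProd {X : Type*} (L : List X) : IsGroupLike (onePlusProd L) := by
  induction L with
  | nil => exact IsGroupLike.one
  | cons x L ih => rw [onePlusProd_cons]; exact (IsGroupLike.one_add_ι x).mul ih

/-- `(1 + X₀) ⋯ (1 + X_{k-1}) - 1`. -/
def reducedProd (k : ℕ) : FreeAlgebra ℝ (Fin k) := onePlusProd (List.finRange k) - 1

/-- The logarithm series of `(1 + X₀) ⋯ (1 + X_{k-1})` up to order `k`. -/
def truncLog (k : ℕ) : FreeAlgebra ℝ (Fin k) :=
  ∑ s ∈ Finset.Icc 1 k, ((-1 : ℝ) ^ (s - 1) / (s : ℝ)) • reducedProd k ^ s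

/-- The span of the words of length at least `s`. -/
def longSpan (X : Type*) (s : ℕ) : Submodule ℝ (FreeAlgebra ℝ X) :=
  Submodule.span ℝ {a | ∃ l : List X, s ≤ l.length ∧ word l = a}

lemma longSpan_mul {X : Type*} {s t : ℕ} {a b : FreeAlgebra ℝ X} (ha : a ∈ longSpan X s)
    (hb : b ∈ longSpan X t) : a * b ∈ longSpan X (s + t) := by
  have := Submodule.mul_mem_mul ha hb
  rw [longSpan, longSpan, Submodule.span_mul_span] at this
  refine Submodule.span_mono ?_ this
  rintro _ ⟨_, ⟨l, hl, rfl⟩, _, ⟨l', hl', rfl⟩, rfl⟩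
  exact ⟨l ++ l', by rw [List.length_append]; omega, word_append _ _⟩

lemma mem_longSpan_zero {X : Type*} (a : FreeAlgebra ℝ X) : a ∈ longSpan X 0 := by
  have h : a ∈ Submodule.span ℝ {a : FreeAlgebra ℝ X | ∃ l : List X, word l = a} := by
    rw [span_words_eq_top]; trivial
  refine Submodule.span_mono ?_ h
  rintro _ ⟨l, rfl⟩
  exact ⟨l, by simp, rfl⟩

lemma onePlusProd_sub_one_mem {X : Type*} (L : List X) : onePlusProd L - 1 ∈ longSpan X 1 := by
  induction L with
  | nil =>
    rw [onePlusProd_nil, sub_self]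
    exact (longSpan X 1).zero_mem
  | cons x L ih =>
    have hx : FreeAlgebra.ι ℝ x ∈ longSpan X 1 := Submodule.subset_span ⟨[x], by simp, by simp⟩
    have h := longSpan_mul hx (mem_longSpan_zero (onePlusProd L))
    rw [onePlusProd_cons, add_mul, one_mul, add_sub_right_comm]
    exact (longSpan X 1).add_mem ih h

lemma reducedProd_pow_mem (s : ℕ) : reducedProd k ^ s ∈ longSpan (Fin k) s := by
  induction s with
  | zero => exact mem_longSpan_zero _
  | succ s ih =>
    rw [pow_succ]
    exact longSpan_mul ih (onePlusProd_sub_one_mem _)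

lemma longSpan_le_repeatSpan {s : ℕ} (hs : k < s) : longSpan (Fin k) s ≤ repeatSpan (Fin k) := by
  refine Submodule.span_mono ?_
  rintro _ ⟨l, hl, rfl⟩
  refine ⟨l, fun h => ?_, rfl⟩
  have := h.length_le_card
  rw [Fintype.card_fin] at this
  omega

/-- The binomial expansion of a power of the product of the `1 + Xᵢ`.  Its terms of order above `k`
contain only words with a repeated letter, so that the number of terms does not depend on `n`. -/
lemma onePlusProd_pow_sub_mem (n : ℕ) :
    onePlusProd (List.finRange k) ^ n -
      ∑ s ∈ Finset.range (k + 1), (n.choose s : ℝ) • reducedProd k ^ s ∈ repeatSpan (Fin k) := by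
  have h1 : onePlusProd (List.finRange k) ^ n =
      ∑ s ∈ Finset.range (n + 1), (n.choose s : ℝ) • reducedProd k ^ s := by
    have : onePlusProd (List.finRange k) = reducedProd k + 1 := by simp [reducedProd]
    rw [this, (Commute.one_right (reducedProd k)).add_pow]
    refine Finset.sum_congr rfl fun s _ => ?_
    rw [one_pow, mul_one, ← nsmul_eq_mul', ← Nat.cast_smul_eq_nsmul ℝ]
  have h2 : onePlusProd (List.finRange k) ^ n =
      ∑ s ∈ Finset.range (k + 1 + n), (n.choose s : ℝ) • reducedProd k ^ s := by
    rw [h1, show k + 1 + n = n + 1 + k by ring, Finset.sum_range_add _ (n + 1) k, left_eq_add]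
    refine Finset.sum_eq_zero fun i _ => ?_
    rw [Nat.choose_eq_zero_of_lt (by omega), Nat.cast_zero, zero_smul]
  rw [h2, Finset.sum_range_add, add_sub_cancel_left]
  refine Submodule.sum_mem _ fun i _ => Submodule.smul_mem _ _ ?_
  exact longSpan_le_repeatSpan (by omega) (reducedProd_pow_mem (k + 1 + i))

/-- The logarithm is a Lie element modulo words with a repeated letter: it satisfies the
Dynkin–Specht–Wever identity.  This is the linear term in `n` of the identity
`dynkin (Pⁿ) Pⁿ = euler (Pⁿ)` (modulo words with a repeated letter) for the product `P` of the
`1 + Xᵢ`. -/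
lemma apply_dynkin_truncLog (ℓ : FreeAlgebra ℝ (Fin k) →ₗ[ℝ] ℝ)
    (hℓ : ∀ a ∈ repeatSpan (Fin k), ℓ a = 0) :
    ℓ (dynkin (truncLog k)) = ℓ (euler (truncLog k)) := by
  have key := sum_log_coeff_eq (S := k)
    (α := fun s t => ℓ (dynkin (reducedProd k ^ s) * reducedProd k ^ t))
    (β := fun s => ℓ (euler (reducedProd k ^ s))) (fun t => by simp) (fun n => ?_)
  · simpa [truncLog, map_sum] using key
  · set P := onePlusProd (List.finRange k) ^ n
    set T := ∑ s ∈ Finset.range (k + 1), (n.choose s : ℝ) • reducedProd k ^ s with hT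
    have hPT : P - T ∈ repeatSpan (Fin k) := onePlusProd_pow_sub_mem n
    have hP : dynkin P * P - euler P ∈ repeatSpan (Fin k) :=
      ((isGroupLike_onePlusProd _).pow n).dynkin_mul_self
    have hmem : dynkin T * T - euler T ∈ repeatSpan (Fin k) := by
      have h1 := repeatSpan_mul_right P (dynkin_mem_repeatSpan hPT)
      have h2 := repeatSpan_mul_left (dynkin T) hPT
      have h3 := euler_mem_repeatSpan hPT
      convert Submodule.add_mem _ (Submodule.sub_mem _ (Submodule.sub_mem _ hP h1) h2) h3 using 1
      rw [map_sub, map_sub]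
      noncomm_ring
    have h0 := hℓ _ hmem
    rw [map_sub, sub_eq_zero] at h0
    have e1 : ℓ (dynkin T * T) = ∑ s ∈ Finset.range (k + 1), ∑ t ∈ Finset.range (k + 1),
        (n.choose s : ℝ) * (n.choose t : ℝ) * ℓ (dynkin (reducedProd k ^ s) * reducedProd k ^ t) := by
      simp only [hT, map_sum, map_smul, Finset.sum_mul_sum, smul_mul_smul_comm, smul_eq_mul]
    have e2 : ℓ (euler T) = ∑ s ∈ Finset.range (k + 1),
        (n.choose s : ℝ) * ℓ (euler (reducedProd k ^ s)) := by
      simp only [hT, map_sum, map_smul, smul_eq_mul]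
    rw [← e1, ← e2, h0]

end Log

/-! ### The word coefficients of the logarithm -/

section Coefficients

lemma listCoeff_nil {X : Type*} (a : FreeAlgebra ℝ X) : listCoeff [] a = augmentation a := by
  have : listCoeff ([] : List X) = augmentation.toLinearMap := by
    classical
    refine linearMap_ext_word fun l => ?_
    cases l with
    | nil => rw [listCoeff_word]; simp
    | cons x l => rw [listCoeff_word]; simp
  exact congrArg (fun f => f a) this

lemma listCoeff_ι_mul {X : Type*} [DecidableEq X] (x y : X) (l : List X) (b : FreeAlgebra ℝ X) :
    listCoeff (y :: l) (FreeAlgebra.ι ℝ x * b) = if x = y then listCoeff l b else 0 := by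
  induction b using word_induction with
  | word l' =>
    rw [← word_cons, listCoeff_word, listCoeff_word]
    by_cases h : x = y <;> simp [h]
  | zero => simp
  | add b c hb hc => rw [mul_add, map_add, map_add, hb, hc]; split_ifs <;> simp
  | smul r b hb => rw [mul_smul_comm, map_smul, map_smul, hb]; split_ifs <;> simp

/-- The coefficient at a word `y l` in `(1 + x₁) ⋯ (1 + xᵣ) b` for `x₁ < ⋯ < xᵣ`: either no letter
is chosen from the product, or the first chosen letter is `y`. -/
lemma listCoeff_onePlusProd_mul {X : Type*} [LinearOrder X] (L : List X)
    (hL : L.Pairwise (· < ·)) (y : X) (l : List X) (b : FreeAlgebra ℝ X) :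
    listCoeff (y :: l) (onePlusProd L * b) = listCoeff (y :: l) b +
      if y ∈ L then listCoeff l (onePlusProd (L.filter (y < ·)) * b) else 0 := by
  induction L with
  | nil => simp
  | cons x L ih =>
    rw [List.pairwise_cons] at hL
    rw [onePlusProd_cons, mul_assoc, add_mul, one_mul, map_add, ih hL.2, listCoeff_ι_mul, add_assoc]
    congr 1
    rcases lt_trichotomy x y with h | h | h
    · simp [h.ne, h.ne', h.not_gt]
    · subst h
      have h1 : x ∉ L := fun hx => lt_irrefl _ (hL.1 x hx)
      have h2 : L.filter (x < ·) = L := List.filter_eq_self.2 fun a ha => by simpa using hL.1 a ha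
      simp [h1, h2]
    · have h1 : y ∉ L := fun hy => lt_asymm h (hL.1 y hy)
      simp [h1, h.ne, h.ne']

variable {k : ℕ}

lemma listCoeff_reducedProd_mul (y : Fin k) (l : List (Fin k)) (b : FreeAlgebra ℝ (Fin k)) :
    listCoeff (y :: l) (reducedProd k * b) =
      listCoeff l (onePlusProd ((List.finRange k).filter (y < ·)) * b) := by
  rw [reducedProd, sub_mul, one_mul, map_sub,
    listCoeff_onePlusProd_mul _ (List.pairwise_lt_finRange k)]
  simp

/-- The first letter of a word is either a factor of its own, or it is joined to the factor that
contains the second letter, which has to be larger. -/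
lemma listCoeff_reducedProd_pow_succ (s : ℕ) (x y : Fin k) (l : List (Fin k)) :
    listCoeff (x :: y :: l) (reducedProd k ^ (s + 1)) =
      listCoeff (y :: l) (reducedProd k ^ s) +
        if x < y then listCoeff (y :: l) (reducedProd k ^ (s + 1)) else 0 := by
  rw [pow_succ', listCoeff_reducedProd_mul, listCoeff_onePlusProd_mul _
    ((List.pairwise_lt_finRange k).sublist List.filter_sublist)]
  congr 1
  simp only [List.mem_filter, List.mem_finRange, true_and, decide_eq_true_eq]
  split_ifs with h
  · rw [listCoeff_reducedProd_mul, List.filter_filter]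
    congr 3
    refine List.filter_congr fun a _ => ?_
    by_cases h' : y < a
    · simp [h', h.trans h']
    · simp [h']
  · rfl

/-- The factor that a step from `a` to `b` contributes to `lam ^ asc * (lam - 1) ^ des`. -/
def stepWeight {X : Type*} [LinearOrder X] (lam : ℝ) (a b : X) : ℝ :=
  if a < b then lam else if b < a then lam - 1 else 1

/-- `lam ^ asc * (lam - 1) ^ des` for the sequence of letters of a list. -/
def chainWeight {X : Type*} [LinearOrder X] (lam : ℝ) : List X → ℝ
  | [] => 1
  | [_] => 1
  | a :: b :: l => stepWeight lam a b * chainWeight lam (b :: l)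

/-- The series `∑ (-z)^s Q^{s+1}` with `Q = (1 + X₀) ⋯ (1 + X_{k-1}) - 1`, i.e. `Q (1 + z Q)⁻¹`, has
the word coefficients `lam ^ asc * (lam - 1) ^ des` with `lam = 1 - z`. -/
lemma sum_listCoeff_pow (z : ℝ) (l : List (Fin k)) (hl : l ≠ []) (hnd : l.Nodup) (S : ℕ)
    (hS : l.length ≤ S) :
    ∑ s ∈ Finset.range S, (-z) ^ s * listCoeff l (reducedProd k ^ (s + 1)) =
      chainWeight (1 - z) l := by
  induction l generalizing S with
  | nil => exact absurd rfl hl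
  | cons x l ih =>
    rcases l with _ | ⟨y, l⟩
    · obtain ⟨S, rfl⟩ : ∃ S', S = S' + 1 := ⟨S - 1, by simp at hS; omega⟩
      have haug : ∀ L : List (Fin k), augmentation (onePlusProd L) = 1 := fun L =>
        (isGroupLike_onePlusProd L).augmentation_eq
      simp only [pow_succ' (reducedProd k), listCoeff_reducedProd_mul, listCoeff_nil, map_mul,
        haug, map_pow, one_mul]
      rw [Finset.sum_range_succ']
      simp [reducedProd, haug, chainWeight]
    · obtain ⟨S, rfl⟩ : ∃ S', S = S' + 1 := ⟨S - 1, by simp at hS; omega⟩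
      have hlen : (y :: l).length ≤ S := by simpa using hS
      have hnd' := (List.nodup_cons.1 hnd)
      have hxy : x ≠ y := fun h => hnd'.1 (by simp [h])
      have e1 := ih (by simp) hnd'.2 S hlen
      have e2 := ih (by simp) hnd'.2 (S + 1) (by omega)
      simp only [listCoeff_reducedProd_pow_succ, mul_add, Finset.sum_add_distrib]
      have e3 : ∑ s ∈ Finset.range (S + 1), (-z) ^ s * listCoeff (y :: l) (reducedProd k ^ s) =
          -z * chainWeight (1 - z) (y :: l) := by
        classical
        rw [Finset.sum_range_succ', ← e1, Finset.mul_sum]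
        have : listCoeff (y :: l) (reducedProd k ^ 0) = 0 := by
          rw [pow_zero, ← word_nil, listCoeff_word]; simp
        rw [this, mul_zero, add_zero]
        refine Finset.sum_congr rfl fun s _ => ?_
        ring
      rw [e3, chainWeight, stepWeight]
      rcases lt_or_gt_of_ne hxy with h | h
      · simp only [h, if_true]
        rw [e2]; ring
      · simp only [h.not_gt, h, if_true, if_false]
        simp

lemma continuous_chainWeight {X : Type*} [LinearOrder X] (l : List X) :
    Continuous fun lam : ℝ => chainWeight lam l := by
  induction l with
  | nil => exact continuous_const
  | cons x l ih =>
    rcases l with _ | ⟨y, l⟩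
    · exact continuous_const
    · refine Continuous.mul ?_ ih
      unfold stepWeight
      split_ifs <;> fun_prop

/-- The coefficient of a word in the logarithm is the Beta integral `∫ lam ^ asc * (lam - 1) ^ des`,
since `log (1 + Q) = ∫₀¹ Q (1 + z Q)⁻¹ dz`. -/
lemma listCoeff_truncLog (l : List (Fin k)) (hl : l ≠ []) (hnd : l.Nodup) :
    listCoeff l (truncLog k) = ∫ lam in (0 : ℝ)..1, chainWeight lam l := by
  have hlen : l.length ≤ k := by simpa using hnd.length_le_card
  have h1 : ∫ lam in (0 : ℝ)..1, chainWeight lam l = ∫ z in (0 : ℝ)..1, chainWeight (1 - z) l := by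
    rw [intervalIntegral.integral_comp_sub_left (fun lam => chainWeight lam l)]
    simp
  rw [h1]
  simp only [← sum_listCoeff_pow _ l hl hnd k hlen]
  rw [intervalIntegral.integral_finsetSum]
  · have h2 : Finset.Icc 1 k = Finset.Ico (0 + 1) (k + 1) := by ext; simp
    rw [truncLog, map_sum, Finset.range_eq_Ico, h2, ← Finset.sum_Ico_add' _ 0 k 1]
    refine Finset.sum_congr rfl fun s _ => ?_
    have h3 : ∫ z in (0 : ℝ)..1, (-z) ^ s = (-1) ^ s / ((s : ℝ) + 1) := by
      have h4 : (fun z : ℝ => (-z) ^ s) = fun z => (-1) ^ s * z ^ s :=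
        funext fun z => neg_pow z s
      rw [h4]
      simp only [intervalIntegral.integral_const_mul, integral_pow]
      simp [div_eq_mul_inv]
    rw [intervalIntegral.integral_mul_const, h3, map_smul, smul_eq_mul]
    simp
  · intro s _
    exact Continuous.intervalIntegrable (by fun_prop) _ _

end Coefficients

/-! ### The Magnus commutator as a multilinear part -/

section Series

open MvPowerSeries

variable {k : ℕ}

/-- The algebra homomorphism `Xᵢ ↦ tᵢ Xᵢ`, which records the letters of a word in the exponent. -/
def gradeHom (k : ℕ) : FreeAlgebra ℝ (Fin k) →ₐ[ℝ] MvPowerSeries (Fin k) (FreeAlgebra ℝ (Fin k)) :=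
  FreeAlgebra.lift ℝ fun i => monomial (Finsupp.single i 1) (FreeAlgebra.ι ℝ i)

lemma gradeHom_word (l : List (Fin k)) :
    gradeHom k (word l) = monomial (Multiset.toFinsupp (l : Multiset (Fin k))) (word l) := by
  induction l with
  | nil => simp [monomial_zero_one]
  | cons x l ih =>
    rw [word_cons, map_mul, ih, gradeHom, FreeAlgebra.lift_ι_apply, monomial_mul_monomial,
      ← Multiset.cons_coe, ← Multiset.singleton_add, map_add, Multiset.toFinsupp_singleton]

/-- The exponent of `t₀ ⋯ t_{k-1}`. -/
def topExp (k : ℕ) : Fin k →₀ ℕ := Finsupp.equivFunOnFinite.symm fun _ => 1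

@[simp] lemma topExp_apply (i : Fin k) : topExp k i = 1 := rfl

lemma toFinsupp_eq_topExp {c : Multiset (Fin k)} :
    Multiset.toFinsupp c = topExp k ↔ c = Finset.univ.val := by
  have h : topExp k = Multiset.toFinsupp (Finset.univ.val : Multiset (Fin k)) := by
    ext i
    rw [Multiset.toFinsupp_apply, topExp_apply,
      Multiset.count_eq_one_of_mem Finset.univ.nodup (Finset.mem_univ i)]
  rw [h, EmbeddingLike.apply_eq_iff_eq]

/-- The multilinear part: the projection to the span of the words in which every letter of `Fin k`
occurs exactly once. -/
def multilinearPart (k : ℕ) : FreeAlgebra ℝ (Fin k) →ₗ[ℝ] FreeAlgebra ℝ (Fin k) where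
  toFun a := coeff (topExp k) (gradeHom k a)
  map_add' a b := by simp
  map_smul' r a := by
    rw [map_smul]
    rfl

lemma multilinearPart_word (l : List (Fin k)) :
    multilinearPart k (word l) = if (l : Multiset (Fin k)) = Finset.univ.val then word l else 0 := by
  change coeff (topExp k) (gradeHom k (word l)) = _
  rw [gradeHom_word, coeff_monomial]
  exact if_congr (by rw [eq_comm, toFinsupp_eq_topExp]) rfl rfl

lemma multilinearPart_of_mem {c : Multiset (Fin k)} {a : FreeAlgebra ℝ (Fin k)}
    (ha : a ∈ wordSpan c) :
    multilinearPart k a = if c = Finset.univ.val then a else 0 := by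
  split_ifs with h
  · refine eqOn_wordSpan (f := multilinearPart k) (g := LinearMap.id) (fun l hl => ?_) ha
    rw [multilinearPart_word, if_pos (hl.trans h)]; rfl
  · refine eqOn_wordSpan (f := multilinearPart k) (g := 0) (fun l hl => ?_) ha
    rw [multilinearPart_word, if_neg (hl ▸ h)]; rfl

lemma multilinearPart_dynkin (a : FreeAlgebra ℝ (Fin k)) :
    multilinearPart k (dynkin a) = dynkin (multilinearPart k a) := by
  have : multilinearPart k ∘ₗ dynkin = dynkin ∘ₗ multilinearPart k := by
    refine linearMap_ext_word fun l => ?_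
    rw [LinearMap.comp_apply, LinearMap.comp_apply, multilinearPart_of_mem (dynkin_word_mem l),
      multilinearPart_word]
    split_ifs <;> simp
  exact congrArg (fun f => f a) this

lemma multilinearPart_euler (a : FreeAlgebra ℝ (Fin k)) :
    multilinearPart k (euler a) = (k : ℝ) • multilinearPart k a := by
  have : multilinearPart k ∘ₗ euler = (k : ℝ) • multilinearPart k := by
    refine linearMap_ext_word fun l => ?_
    rw [LinearMap.comp_apply, LinearMap.smul_apply, euler_word, map_smul, multilinearPart_word]
    split_ifs with h
    · have : l.length = k := by simpa using congrArg Multiset.card h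
      rw [this]
    · simp
  exact congrArg (fun f => f a) this

lemma multilinearPart_eq_sum (a : FreeAlgebra ℝ (Fin k)) :
    multilinearPart k a =
      ∑ σ : Equiv.Perm (Fin k), listCoeff (List.ofFn σ) a • word (List.ofFn σ) := by
  let g : FreeAlgebra ℝ (Fin k) →ₗ[ℝ] FreeAlgebra ℝ (Fin k) :=
    ∑ σ : Equiv.Perm (Fin k), (listCoeff (List.ofFn σ)).smulRight (word (List.ofFn σ))
  have : multilinearPart k = g := by
    refine linearMap_ext_word fun l => ?_
    simp only [g, LinearMap.sum_apply, LinearMap.smulRight_apply, listCoeff_word]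
    rw [multilinearPart_word]
    split_ifs with h
    · have hl := eq_sum_wordCoeff (h ▸ word_mem_wordSpan l)
      simpa only [wordCoeff_eq_listCoeff, listCoeff_word] using hl
    · refine (Finset.sum_eq_zero fun σ _ => ?_).symm
      rw [if_neg, zero_smul]
      rintro rfl
      exact h (coe_ofFn_perm σ)
  simpa [g] using congrArg (fun f => f a) this

/-- Two power series agree up to squares of the variables. -/
def SquarefreeEq (F G : MvPowerSeries (Fin k) (FreeAlgebra ℝ (Fin k))) : Prop :=
  ∀ d ≤ topExp k, coeff d F = coeff d G

lemma SquarefreeEq.mul {F F' G G' : MvPowerSeries (Fin k) (FreeAlgebra ℝ (Fin k))}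
    (hF : SquarefreeEq F F') (hG : SquarefreeEq G G') : SquarefreeEq (F * G) (F' * G') := by
  intro d hd
  rw [coeff_mul, coeff_mul]
  refine Finset.sum_congr rfl fun p hp => ?_
  rw [Finset.HasAntidiagonal.mem_antidiagonal] at hp
  rw [hF p.1 (le_trans (hp ▸ le_self_add) hd), hG p.2 (le_trans (hp ▸ le_add_self) hd)]

lemma SquarefreeEq.pow {F F' : MvPowerSeries (Fin k) (FreeAlgebra ℝ (Fin k))}
    (hF : SquarefreeEq F F') (n : ℕ) : SquarefreeEq (F ^ n) (F' ^ n) := by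
  induction n with
  | zero => intro d _; simp
  | succ n ih => rw [pow_succ, pow_succ]; exact ih.mul hF

lemma SquarefreeEq.sub {F F' G G' : MvPowerSeries (Fin k) (FreeAlgebra ℝ (Fin k))}
    (hF : SquarefreeEq F F') (hG : SquarefreeEq G G') : SquarefreeEq (F - G) (F' - G') := by
  intro d hd
  rw [map_sub, map_sub, hF d hd, hG d hd]

lemma expVar_squarefreeEq (i : Fin k) :
    SquarefreeEq (expVar k i) (gradeHom k (1 + FreeAlgebra.ι ℝ i)) := by
  intro d hd
  have hdi : d i ≤ 1 := hd i
  rw [map_add, map_one, gradeHom, FreeAlgebra.lift_ι_apply, map_add, coeff_one, coeff_monomial]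
  change (if d = Finsupp.single i (d i) then _ else _) = _
  rcases Nat.le_one_iff_eq_zero_or_eq_one.1 hdi with h | h
  · rw [h, Finsupp.single_zero]
    have h1 : d ≠ Finsupp.single i 1 := fun hd => by rw [hd] at h; simp at h
    simp [h1]
  · rw [h]
    have h1 : d ≠ 0 := fun hd => by rw [hd] at h; simp at h
    simp [h1]

lemma prod_expVar_squarefreeEq (L : List (Fin k)) :
    SquarefreeEq (L.map (expVar k)).prod (gradeHom k (onePlusProd L)) := by
  induction L with
  | nil => intro d _; simp
  | cons x L ih =>
    rw [List.map_cons, List.prod_cons, onePlusProd_cons, map_mul]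
    exact (expVar_squarefreeEq x).mul ih

/-- The Magnus commutator is the multilinear part of `log ((1 + X₀) ⋯ (1 + X_{k-1}))`. -/
lemma magnusCommutator_eq (k : ℕ) : magnusCommutator k = multilinearPart k (truncLog k) := by
  have hdeg : (topExp k).degree = k := by
    rw [Finsupp.degree_eq_sum]; simp
  change formalLog (List.ofFn (expVar k)).prod (topExp k) = _
  rw [formalLog, hdeg, truncLog, map_sum]
  refine Finset.sum_congr rfl fun s _ => ?_
  have h := ((prod_expVar_squarefreeEq (List.finRange k)).sub (F' := gradeHom k _)
    (G := 1) (G' := 1) (fun _ _ => rfl)).pow s (topExp k) le_rfl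
  rw [List.ofFn_eq_map, h, map_smul]
  change _ = _ • coeff (topExp k) (gradeHom k (reducedProd k ^ s))
  rw [reducedProd, map_pow (gradeHom k), map_sub (gradeHom k), map_one (gradeHom k)]

/-- The explicit form of the Magnus commutator. -/
lemma magnusCommutator_eq_sum (k : ℕ) (hk : k ≠ 0) :
    magnusCommutator k = ∑ σ : Equiv.Perm (Fin k),
      (∫ lam in (0 : ℝ)..1, chainWeight lam (List.ofFn σ)) • word (List.ofFn σ) := by
  rw [magnusCommutator_eq, multilinearPart_eq_sum]
  refine Finset.sum_congr rfl fun σ _ => ?_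
  rw [listCoeff_truncLog]
  · intro h
    rw [List.ofFn_eq_nil_iff] at h
    exact hk h
  · exact List.nodup_ofFn.2 σ.injective

/-- The Magnus commutator is a Lie polynomial: it satisfies the Dynkin–Specht–Wever identity. -/
lemma dynkin_magnusCommutator (k : ℕ) :
    dynkin (magnusCommutator k) = (k : ℝ) • magnusCommutator k := by
  rw [magnusCommutator_eq, ← multilinearPart_dynkin, ← multilinearPart_euler,
    multilinearPart_eq_sum, multilinearPart_eq_sum]
  refine Finset.sum_congr rfl fun σ _ => ?_
  rw [apply_dynkin_truncLog]
  intro a ha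
  have h : repeatSpan (Fin k) ≤ LinearMap.ker (listCoeff (List.ofFn σ)) := by
    refine Submodule.span_le.2 ?_
    rintro _ ⟨l, hl, rfl⟩
    classical
    change listCoeff _ (word l) = 0
    rw [listCoeff_word, if_neg]
    rintro rfl
    exact hl (List.nodup_ofFn.2 σ.injective)
  exact h ha

end Series

/-! ### Duality for the Lie norm -/

section HahnBanach

variable {E : Type*} [AddCommGroup E] [Module ℝ E] {Γ : Set E}

/-- The `ℓ¹` norm of a finitely supported family. -/
def coeffCost {α : Type*} (θ : α →₀ ℝ) : ℝ := θ.sum fun _ c => |c|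

lemma coeffCost_eq {α : Type*} (θ : α →₀ ℝ) {s : Finset α} (hs : θ.support ⊆ s) :
    coeffCost θ = ∑ i ∈ s, |θ i| :=
  Finsupp.sum_of_support_subset _ hs _ (by simp)

lemma coeffCost_nonneg {α : Type*} (θ : α →₀ ℝ) : 0 ≤ coeffCost θ :=
  Finset.sum_nonneg fun _ _ => abs_nonneg _

lemma coeffCost_add_le {α : Type*} (θ η : α →₀ ℝ) :
    coeffCost (θ + η) ≤ coeffCost θ + coeffCost η := by
  classical
  rw [coeffCost_eq (θ + η) Finsupp.support_add,
    coeffCost_eq θ (s := θ.support ∪ η.support) Finset.subset_union_left,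
    coeffCost_eq η (s := θ.support ∪ η.support) Finset.subset_union_right,
    ← Finset.sum_add_distrib]
  exact Finset.sum_le_sum fun i _ => abs_add_le _ _

lemma coeffCost_smul {α : Type*} (c : ℝ) (θ : α →₀ ℝ) :
    coeffCost (c • θ) = |c| * coeffCost θ := by
  rw [coeffCost_eq (c • θ) Finsupp.support_smul, coeffCost_eq θ subset_rfl, Finset.mul_sum]
  simp [abs_mul]

/-- The set of the costs of the presentations of `x` by elements of `Γ`. -/
def costSet (Γ : Set E) (x : E) : Set ℝ :=
  {r | ∃ θ : Γ →₀ ℝ, θ.sum (fun γ c => c • (γ : E)) = x ∧ coeffCost θ = r}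

lemma bddBelow_costSet (x : E) : BddBelow (costSet Γ x) :=
  ⟨0, by rintro _ ⟨θ, -, rfl⟩; exact coeffCost_nonneg θ⟩

lemma costSet_nonempty {x : E} (hx : x ∈ Submodule.span ℝ Γ) : (costSet Γ x).Nonempty := by
  obtain ⟨θ, hθ⟩ := (Finsupp.mem_span_iff_linearCombination ℝ Γ x).1 hx
  exact ⟨_, θ, hθ, rfl⟩

lemma costSet_smul {c : ℝ} (hc : 0 < c) {x : E} {r : ℝ} (h : r ∈ costSet Γ x) :
    c * r ∈ costSet Γ (c • x) := by
  obtain ⟨θ, hθ, rfl⟩ := h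
  refine ⟨c • θ, ?_, by rw [coeffCost_smul, abs_of_pos hc]⟩
  change Finsupp.linearCombination ℝ _ _ = _
  rw [map_smul]
  exact congrArg (c • ·) hθ

lemma costSet_add {x y : E} {r s : ℝ} (hr : r ∈ costSet Γ x) (hs : s ∈ costSet Γ y) :
    ∃ u ∈ costSet Γ (x + y), u ≤ r + s := by
  obtain ⟨θ, hθ, rfl⟩ := hr
  obtain ⟨η, hη, rfl⟩ := hs
  refine ⟨_, ⟨θ + η, ?_, rfl⟩, coeffCost_add_le _ _⟩
  change Finsupp.linearCombination ℝ _ _ = _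
  rw [map_add]
  exact congrArg₂ (· + ·) hθ hη

/-- If every presentation of `v` by elements of `Γ` costs at least `C`, then some functional that
is bounded by `1` on `Γ` is at least `C` on `v`. -/
lemma exists_functional_of_le_coeffCost {v : E} (hv : v ∈ Submodule.span ℝ Γ) {C : ℝ}
    (hC : ∀ θ : Γ →₀ ℝ, θ.sum (fun γ c => c • (γ : E)) = v → C ≤ coeffCost θ) :
    ∃ φ : E →ₗ[ℝ] ℝ, (∀ γ ∈ Γ, |φ γ| ≤ 1) ∧ C ≤ φ v := by
  rcases le_or_gt C 0 with hC0 | hC0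
  · exact ⟨0, by simp, by simpa using hC0⟩
  have hv0 : v ≠ 0 := by
    rintro rfl
    have := hC 0 (by simp)
    simp [coeffCost] at this
    linarith
  let W := Submodule.span ℝ Γ
  -- the infimum of the costs is a sublinear functional on the span of `Γ`
  let N : W → ℝ := fun x => sInf (costSet Γ (x : E))
  have hNle : ∀ (x : W) {r : ℝ}, r ∈ costSet Γ (x : E) → N x ≤ r := fun x r hr =>
    csInf_le (bddBelow_costSet _) hr
  have hN0 : ∀ x : W, 0 ≤ N x := fun x =>
    le_csInf (costSet_nonempty x.2) (by rintro _ ⟨θ, -, rfl⟩; exact coeffCost_nonneg θ)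
  have hNsmul_le : ∀ c : ℝ, 0 < c → ∀ x : W, N (c • x) ≤ c * N x := by
    intro c hc x
    rw [← div_le_iff₀' hc]
    refine le_csInf (costSet_nonempty x.2) fun r hr => ?_
    rw [div_le_iff₀' hc]
    exact hNle (c • x) (costSet_smul hc hr)
  have hNsmul : ∀ c : ℝ, 0 < c → ∀ x : W, N (c • x) = c * N x := by
    intro c hc x
    refine le_antisymm (hNsmul_le c hc x) ?_
    have := hNsmul_le c⁻¹ (inv_pos.2 hc) (c • x)
    rw [smul_smul, inv_mul_cancel₀ hc.ne', one_smul] at this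
    rwa [← le_div_iff₀' hc, div_eq_inv_mul]
  have hNadd : ∀ x y : W, N (x + y) ≤ N x + N y := by
    intro x y
    rw [← sub_le_iff_le_add]
    refine le_csInf (costSet_nonempty x.2) fun r hr => ?_
    rw [sub_le_comm]
    refine le_csInf (costSet_nonempty y.2) fun s hs => ?_
    obtain ⟨u, hu, hur⟩ := costSet_add hr hs
    have := hNle (x + y) hu
    linarith
  let v' : W := ⟨v, hv⟩
  have hv' : v' ≠ 0 := fun h => hv0 (congrArg Subtype.val h)
  have hCN : C ≤ N v' := le_csInf (costSet_nonempty hv) (by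
    rintro _ ⟨θ, hθ, rfl⟩
    exact hC θ hθ)
  let f : W →ₗ.[ℝ] ℝ := LinearPMap.mkSpanSingleton v' C hv'
  obtain ⟨g, hg, hgN⟩ := exists_extension_of_le_sublinear f N hNsmul hNadd (by
    rintro ⟨x, hx⟩
    obtain ⟨t, rfl⟩ := Submodule.mem_span_singleton.1 hx
    change f ⟨t • v', hx⟩ ≤ N (t • v')
    rw [show f ⟨t • v', hx⟩ = t • C from LinearPMap.mkSpanSingleton'_apply _ _ _ t hx, smul_eq_mul]
    rcases le_or_gt t 0 with ht | ht
    · exact (mul_nonpos_of_nonpos_of_nonneg ht hC0.le).trans (hN0 _)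
    · rw [hNsmul t ht]
      exact mul_le_mul_of_nonneg_left hCN ht.le)
  obtain ⟨φ, hφ⟩ := LinearMap.exists_extend g
  have hφW : ∀ x : W, φ x = g x := fun x => congrArg (fun h => h x) hφ
  refine ⟨φ, fun γ hγ => ?_, ?_⟩
  · let γ' : W := ⟨γ, Submodule.subset_span hγ⟩
    have h1 : N γ' ≤ 1 := hNle γ' ⟨Finsupp.single ⟨γ, hγ⟩ 1, by simp [γ'], by simp [coeffCost]⟩
    have h2 : N (-γ') ≤ 1 :=
      hNle (-γ') ⟨Finsupp.single ⟨γ, hγ⟩ (-1), by rw [Finsupp.sum_single_index] <;> simp [γ'],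
        by rw [coeffCost, Finsupp.sum_single_index] <;> simp⟩
    have h3 := hgN γ'
    have h4 := hgN (-γ')
    rw [map_neg] at h4
    rw [show φ γ = g γ' from hφW γ', abs_le]
    constructor <;> linarith
  · rw [show φ v = g v' from hφW v']
    have h1 := hg ⟨v', Submodule.mem_span_singleton_self v'⟩
    rw [show f ⟨v', Submodule.mem_span_singleton_self v'⟩ = C from
      LinearPMap.mkSpanSingleton'_apply_self _ _ _ _] at h1
    exact h1.ge

end HahnBanach

/-- The Magnus commutator is, up to the factor `k`, its own image under the Dynkin operator, which
sends every word to a multiple of a commutator monomial with the same letters. -/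
lemma magnusCommutator_mem_span (k : ℕ) (hk : k ≠ 0) :
    magnusCommutator k ∈ Submodule.span ℝ (lieMonomials k) := by
  have hk' : (k : ℝ) ≠ 0 := Nat.cast_ne_zero.2 hk
  have h : magnusCommutator k = (k : ℝ)⁻¹ • dynkin (magnusCommutator k) := by
    rw [dynkin_magnusCommutator, smul_smul, inv_mul_cancel₀ hk', one_smul]
  rw [h, magnusCommutator_eq_sum k hk, map_sum]
  refine Submodule.smul_mem _ _ (Submodule.sum_mem _ fun σ _ => ?_)
  rw [map_smul, ← commProd_map_of]
  refine Submodule.smul_mem _ _ ?_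
  obtain ⟨B, d, hB, -, h⟩ := dynkin_commProd ((List.ofFn σ).map FreeMagma.of) (by
    intro h
    rw [List.map_eq_nil_iff, List.ofFn_eq_nil_iff] at h
    exact hk h)
  rw [h]
  refine Submodule.smul_mem _ _ (Submodule.subset_span ⟨B, ?_, rfl⟩)
  rw [hB, content_map_of, coe_ofFn_perm]

/-- Duality for `Θ_k^Lie`: it suffices to bound the Magnus commutator against all functionals that
are bounded by `1` on products of commutator monomials.  The Dynkin operator turns functionals on
Lie polynomials into such functionals. -/
lemma thetaLie_le_of_functional (k : ℕ) (hk : k ≠ 0) {B : ℝ}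
    (h : ∀ Φ : FreeAlgebra ℝ (Fin k) →ₗ[ℝ] ℝ, (∀ M ∈ productMonomials k, |Φ M| ≤ 1) →
      Φ (magnusCommutator k) ≤ k.factorial * B) :
    thetaLie k ≤ ENNReal.ofReal B := by
  have hfac : (k.factorial : ℝ≥0∞) ≠ 0 := Nat.cast_ne_zero.2 k.factorial_ne_zero
  have hk' : (0 : ℝ) < k := by positivity
  rw [thetaLie, ENNReal.inv_mul_le_iff hfac (ENNReal.natCast_ne_top _), ← ENNReal.ofReal_natCast,
    ← ENNReal.ofReal_mul (Nat.cast_nonneg _)]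
  by_contra! hlt
  obtain ⟨C, hC1, hC2⟩ := ENNReal.lt_iff_exists_nnreal_btwn.1 hlt
  obtain ⟨φ, hφ1, hφ2⟩ := exists_functional_of_le_coeffCost (magnusCommutator_mem_span k hk)
    (C := C) (fun θ hθ => by
      have h1 : (C : ℝ≥0∞) ≤ ENNReal.ofReal (coeffCost θ) :=
        hC2.le.trans (iInf₂_le θ hθ)
      rw [← ENNReal.ofReal_coe_nnreal] at h1
      exact (ENNReal.ofReal_le_ofReal_iff (coeffCost_nonneg θ)).1 h1)
  -- `k⁻¹ φ ∘ dynkin` is bounded on products and agrees with `φ` at the Magnus commutator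
  have h1 := h ((k : ℝ)⁻¹ • (φ ∘ₗ dynkin)) (fun M hM => by
    obtain ⟨L, hL, rfl⟩ := mem_productMonomials.1 hM
    obtain ⟨B, d, hB, hd, hD⟩ := dynkin_commProd L (by
      rintro rfl
      have := congrArg Multiset.card hL
      simp at this
      exact hk this.symm)
    have hcard : (content L).card = k := by rw [hL]; simp
    have hB1 := hφ1 (commMonomial B) ⟨B, hB.trans hL, rfl⟩
    rw [LinearMap.smul_apply, LinearMap.comp_apply, hD, map_smul, smul_eq_mul, smul_eq_mul,
      ← mul_assoc, abs_mul, abs_of_nonneg (by positivity)]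
    have hd' : (k : ℝ)⁻¹ * d ≤ 1 := by
      rw [inv_mul_le_iff₀ hk', mul_one]
      exact_mod_cast hd.trans hcard.le
    exact mul_le_one₀ hd' (abs_nonneg _) hB1)
  rw [LinearMap.smul_apply, LinearMap.comp_apply, dynkin_magnusCommutator, map_smul, smul_smul,
    inv_mul_cancel₀ hk'.ne', one_smul] at h1
  have h2 : ENNReal.ofReal (k.factorial * B) < C := hC1
  rw [← ENNReal.ofReal_coe_nnreal] at h2
  have h3 := (ENNReal.ofReal_lt_ofReal_iff'.1 h2).1
  linarith

/-! ### Functionals on the free algebra over the interval -/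

/-- A linear functional on the free algebra over the interval that is bounded by `c` on products of
commutator monomials and depends measurably on the letters of a word. -/
structure IsBoundedFunctional (Ψ : FreeAlgebra ℝ unitInterval →ₗ[ℝ] ℝ) (c : ℝ) : Prop where
  bound : ∀ L : List (FreeMagma unitInterval), |Ψ (commProd L)| ≤ c
  measurable : ∀ n : ℕ, Measurable fun t : Fin n → unitInterval => Ψ (word (List.ofFn t))

section Standardization

variable {X : Type*} [LinearOrder X] {m : ℕ}

/-- The number of letters of `l` below `x`, as an element of `Fin (m + 1)`. -/
def rankIn (m : ℕ) (l : List X) (x : X) : Fin (m + 1) := Fin.ofNat (m + 1) (l.countP (· < x))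

lemma rankIn_perm {l l' : List X} (h : l.Perm l') : rankIn m l = rankIn m l' := by
  funext x
  rw [rankIn, rankIn, h.countP_eq]

lemma countP_lt_length {l : List X} {x : X} (hx : x ∈ l) : l.countP (· < x) < l.length := by
  refine lt_of_le_of_ne List.countP_le_length fun h => ?_
  have := List.countP_eq_length.1 h x hx
  simp at this

lemma countP_lt_countP {l : List X} {x y : X} (hx : x ∈ l) (hxy : x < y) :
    l.countP (· < x) < l.countP (· < y) := by
  induction l with
  | nil => simp at hx
  | cons a l ih =>
    rw [List.countP_cons, List.countP_cons]
    have hmono : l.countP (· < x) ≤ l.countP (· < y) :=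
      List.countP_mono_left fun z _ hz => by
        simp only [decide_eq_true_eq] at hz ⊢
        exact hz.trans hxy
    rcases List.mem_cons.1 hx with rfl | hx
    · simp [hxy]; omega
    · have := ih hx
      by_cases h1 : a < x
      · simp [h1, h1.trans hxy, this]
      · simp only [h1, decide_false]
        split_ifs <;> simp at * <;> omega

lemma rankIn_val {l : List X} (hl : l.length = m + 1) {x : X} (hx : x ∈ l) :
    (rankIn m l x : ℕ) = l.countP (· < x) := by
  rw [rankIn, Fin.val_ofNat, Nat.mod_eq_of_lt (hl ▸ countP_lt_length hx)]

lemma rankIn_lt_rankIn {l : List X} (hl : l.length = m + 1) {x y : X} (hx : x ∈ l) (hy : y ∈ l)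
    (hxy : x < y) : rankIn m l x < rankIn m l y := by
  rw [Fin.lt_def, rankIn_val hl hx, rankIn_val hl hy]
  exact countP_lt_countP hx hxy

lemma rankIn_injOn {l : List X} (hl : l.length = m + 1) {x y : X} (hx : x ∈ l) (hy : y ∈ l)
    (h : rankIn m l x = rankIn m l y) : x = y := by
  rcases lt_trichotomy x y with h' | h' | h'
  · exact absurd h (rankIn_lt_rankIn hl hx hy h').ne
  · exact h'
  · exact absurd h (rankIn_lt_rankIn hl hy hx h').ne'

lemma map_rankIn_eq_univ {l : List X} (hl : l.length = m + 1) (hnd : l.Nodup) :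
    (l : Multiset X).map (rankIn m l) = Finset.univ.val := by
  have hnd' : ((l : Multiset X).map (rankIn m l)).Nodup := by
    refine Multiset.Nodup.map_on (fun x hx y hy h => ?_) (Multiset.coe_nodup.2 hnd)
    exact rankIn_injOn hl hx hy h
  have : (⟨_, hnd'⟩ : Finset (Fin (m + 1))) = Finset.univ := by
    refine Finset.eq_univ_of_card _ ?_
    rw [Finset.card_mk, Multiset.card_map, Multiset.coe_card, hl, Fintype.card_fin]
  exact congrArg Finset.val this

lemma chainWeight_map {Y : Type*} [LinearOrder Y] (lam : ℝ) (r : X → Y) (l : List X)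
    (hr : ∀ x ∈ l, ∀ y ∈ l, x < y → r x < r y) :
    chainWeight lam (l.map r) = chainWeight lam l := by
  induction l with
  | nil => rfl
  | cons a l ih =>
    rcases l with _ | ⟨b, l⟩
    · rfl
    · have h1 := ih fun x hx y hy => hr x (List.mem_cons_of_mem _ hx) y (List.mem_cons_of_mem _ hy)
      simp only [List.map_cons] at h1 ⊢
      rw [chainWeight, chainWeight, h1]
      congr 1
      unfold stepWeight
      rcases lt_trichotomy a b with h | h | h
      · simp [h, hr a (by simp) b (by simp) h]
      · subst h; simp
      · have := hr b (by simp) a (by simp) h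
        simp [h, h.not_gt, this, this.not_gt]

/-- The functional on the free algebra over `X` that sends a word with `m + 1` distinct letters to
the value of `Φ` at its standardization, and all other words to `0`. -/
def standardize (Φ : FreeAlgebra ℝ (Fin (m + 1)) →ₗ[ℝ] ℝ) : FreeAlgebra ℝ X →ₗ[ℝ] ℝ :=
  wordLift fun l => if l.Nodup ∧ l.length = m + 1 then Φ (word (l.map (rankIn m l))) else 0

lemma standardize_word (Φ : FreeAlgebra ℝ (Fin (m + 1)) →ₗ[ℝ] ℝ) (l : List X) :
    standardize Φ (word l) =
      if l.Nodup ∧ l.length = m + 1 then Φ (word (l.map (rankIn m l))) else 0 :=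
  wordLift_word _ _

/-- On a product of commutator monomials with distinct letters, the standardization is a relabelling
of the letters, which gives a product of commutator monomials in `X₀, …, X_m`. -/
lemma abs_standardize_commProd_le {Φ : FreeAlgebra ℝ (Fin (m + 1)) →ₗ[ℝ] ℝ}
    (hΦ : ∀ M ∈ productMonomials (m + 1), |Φ M| ≤ 1) (L : List (FreeMagma X)) :
    |standardize Φ (commProd L)| ≤ 1 := by
  have hmem := commProd_mem_wordSpan L
  obtain ⟨l, hl⟩ : ∃ l : List X, (l : Multiset X) = content L := ⟨_, (content L).coe_toList⟩
  by_cases h : l.Nodup ∧ l.length = m + 1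
  · have h1 : standardize Φ (commProd L) =
        Φ (FreeAlgebra.lift ℝ (fun x => FreeAlgebra.ι ℝ (rankIn m l x)) (commProd L)) := by
      refine eqOn_wordSpan (f := standardize Φ) (g := Φ ∘ₗ (FreeAlgebra.lift ℝ
        (fun x => FreeAlgebra.ι ℝ (rankIn m l x))).toLinearMap) (fun l' hl' => ?_) hmem
      have hp : l'.Perm l := Multiset.coe_eq_coe.1 (hl'.trans hl.symm)
      rw [standardize_word, if_pos ⟨hp.nodup_iff.2 h.1, hp.length_eq.trans h.2⟩, rankIn_perm hp]
      exact congrArg Φ (lift_word _ _).symm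
    rw [h1, lift_commProd]
    refine hΦ _ ⟨_, ?_, rfl⟩
    change content _ = _
    rw [content_map, ← hl, map_rankIn_eq_univ h.2 h.1]
  · have h1 : standardize Φ (commProd L) = 0 := by
      refine eqOn_wordSpan (f := standardize Φ) (g := 0) (fun l' hl' => ?_) hmem
      have hp : l'.Perm l := Multiset.coe_eq_coe.1 (hl'.trans hl.symm)
      rw [standardize_word, if_neg, LinearMap.zero_apply]
      rwa [hp.nodup_iff, hp.length_eq]
    rw [h1, abs_zero]
    exact zero_le_one

/-- The permutation that lists the ranks of the values of an injective tuple. -/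
def rankPerm (t : Fin (m + 1) → X) (ht : Function.Injective t) : Equiv.Perm (Fin (m + 1)) :=
  Equiv.ofBijective (fun i => rankIn m (List.ofFn t) (t i)) (Finite.injective_iff_bijective.1
    fun i j h => ht (rankIn_injOn List.length_ofFn (List.mem_ofFn.2 ⟨i, rfl⟩) (List.mem_ofFn.2 ⟨j, rfl⟩) h))

/-- The rearrangements of a tuple of distinct points run through all permutations. -/
lemma standardize_comp_perm (Φ : FreeAlgebra ℝ (Fin (m + 1)) →ₗ[ℝ] ℝ) (lam : ℝ)
    (t : Fin (m + 1) → X) (ht : Function.Injective t) (ρ : Equiv.Perm (Fin (m + 1))) :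
    chainWeight lam (List.ofFn (t ∘ ρ)) * standardize Φ (word (List.ofFn (t ∘ ρ))) =
      chainWeight lam (List.ofFn ((rankPerm t ht * ρ : Equiv.Perm _))) *
        Φ (word (List.ofFn ((rankPerm t ht * ρ : Equiv.Perm _)))) := by
  have hp := ρ.ofFn_comp_perm t
  have hmap : List.ofFn ((rankPerm t ht * ρ : Equiv.Perm _)) =
      (List.ofFn (t ∘ ρ)).map (rankIn m (List.ofFn t)) := by
    rw [List.map_ofFn]
    rfl
  rw [hmap, chainWeight_map]
  · rw [standardize_word, if_pos, rankIn_perm hp]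
    exact ⟨List.nodup_ofFn.2 (ht.comp ρ.injective), List.length_ofFn⟩
  · intro x hx y hy hxy
    exact rankIn_lt_rankIn List.length_ofFn (hp.subset hx) (hp.subset hy) hxy

end Standardization

lemma countP_ofFn {X : Type*} {n : ℕ} (t : Fin n → X) (p : X → Prop) [DecidablePred p] :
    (List.ofFn t).countP (fun x => p x) = ∑ j, if p (t j) then 1 else 0 := by
  induction n with
  | zero => simp
  | succ n ih =>
    rw [List.ofFn_succ, List.countP_cons, ih, Fin.sum_univ_succ, add_comm]
    simp

lemma measurableSet_injective {n : ℕ} :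
    MeasurableSet {t : Fin n → unitInterval | Function.Injective t} := by
  have : {t : Fin n → unitInterval | Function.Injective t} =
      ⋂ (i : Fin n) (j : Fin n) (_ : i ≠ j), {t | t i ≠ t j} := by
    ext t
    simp only [mem_ofPred_eq, mem_iInter, Function.Injective]
    exact ⟨fun h i j hij e => hij (h e), fun h i j e => by_contra fun hij => h i j hij e⟩
  rw [this]
  refine MeasurableSet.iInter fun i => MeasurableSet.iInter fun j => MeasurableSet.iInter fun _ => ?_
  exact (measurableSet_eq_fun (measurable_pi_apply i) (measurable_pi_apply j)).compl

/-- Tuples with two equal coordinates are negligible. -/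
lemma ae_injective (n : ℕ) : ∀ᵐ t : Fin n → unitInterval, Function.Injective t := by
  have h : ∀ i j : Fin n, i ≠ j → ∀ᵐ t : Fin n → unitInterval, t i ≠ t j := by
    intro i j hij
    obtain ⟨n, rfl⟩ : ∃ n', n = n' + 1 := ⟨n - 1, by have := i.2; omega⟩
    obtain ⟨j, rfl⟩ := Fin.exists_succAbove_eq hij.symm
    have hmp := volume_preserving_piFinSuccAbove (fun _ : Fin (n + 1) => unitInterval) i
    have hs : MeasurableSet {q : unitInterval × (Fin n → unitInterval) | q.1 = q.2 j} :=
      measurableSet_eq_fun measurable_fst ((measurable_pi_apply j).comp measurable_snd)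
    have h0 : volume {q : unitInterval × (Fin n → unitInterval) | q.1 = q.2 j} = 0 := by
      refine (Measure.measure_prod_null hs).2 (Eventually.of_forall fun a => ?_)
      have := Measure.pi_hyperplane (fun _ : Fin n => (volume : Measure unitInterval)) j a
      change volume {r : Fin n → unitInterval | a = r j} = 0
      simp only [eq_comm (a := a)]
      exact this
    have h1 := hmp.measure_preimage hs.nullMeasurableSet
    rw [h0] at h1
    rw [ae_iff]
    simp only [ne_eq, not_not]
    exact h1
  filter_upwards [ae_all_iff.2 fun i => ae_all_iff.2 fun j => ae_all_iff.2 (h i j)] with t ht i j hij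
  exact by_contra fun hne => ht i j hne hij

lemma measurable_stepWeight (lam : ℝ) {α : Type*} [MeasurableSpace α] {f g : α → unitInterval}
    (hf : Measurable f) (hg : Measurable g) :
    Measurable fun x => stepWeight lam (f x) (g x) :=
  Measurable.ite (measurableSet_lt hf hg) measurable_const
    (Measurable.ite (measurableSet_lt hg hf) measurable_const measurable_const)

lemma measurable_chainWeight (lam : ℝ) (n : ℕ) :
    Measurable fun t : Fin n → unitInterval => chainWeight lam (List.ofFn t) := by
  induction n with
  | zero => simp only [List.ofFn_zero]; exact measurable_const
  | succ n ih =>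
    rcases n with _ | n
    · simp only [List.ofFn_succ, List.ofFn_zero, chainWeight]; exact measurable_const
    · have h := ih.comp (measurable_pi_lambda (fun (t : Fin (n + 2) → unitInterval) i => t i.succ)
        fun i => measurable_pi_apply _)
      simp only [List.ofFn_succ, chainWeight, Function.comp_def] at h ⊢
      exact Measurable.mul (measurable_stepWeight lam (f := fun x : Fin (n + 2) → unitInterval => x 0)
        (g := fun x => x (Fin.succ 0)) (measurable_pi_apply _) (measurable_pi_apply _)) h

lemma abs_stepWeight_le_one {X : Type*} [LinearOrder X] (lam : unitInterval) (a b : X) :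
    |stepWeight (lam : ℝ) a b| ≤ 1 := by
  have h0 := lam.2.1
  have h1 := lam.2.2
  unfold stepWeight
  split_ifs
  · rw [abs_le]; constructor <;> linarith
  · rw [abs_le]; constructor <;> linarith
  · simp

lemma abs_chainWeight_le_one {X : Type*} [LinearOrder X] (lam : unitInterval) (l : List X) :
    |chainWeight (lam : ℝ) l| ≤ 1 := by
  induction l with
  | nil => simp [chainWeight]
  | cons a l ih =>
    rcases l with _ | ⟨b, l⟩
    · simp [chainWeight]
    · rw [chainWeight, abs_mul]
      exact mul_le_one₀ (abs_stepWeight_le_one lam a b) (abs_nonneg _) ih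

lemma isBoundedFunctional_standardize {m : ℕ} {Φ : FreeAlgebra ℝ (Fin (m + 1)) →ₗ[ℝ] ℝ}
    (hΦ : ∀ M ∈ productMonomials (m + 1), |Φ M| ≤ 1) :
    IsBoundedFunctional (standardize Φ) 1 := by
  refine ⟨abs_standardize_commProd_le hΦ, fun n => ?_⟩
  rcases eq_or_ne n (m + 1) with rfl | hn
  · have h : (fun t : Fin (m + 1) → unitInterval => standardize Φ (word (List.ofFn t))) =
        fun t => if Function.Injective t then
          (fun v : Fin (m + 1) → ℕ => Φ (word (List.ofFn fun i => Fin.ofNat (m + 1) (v i))))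
            (fun i => ∑ j, if t j < t i then 1 else 0) else 0 := by
      funext t
      rw [standardize_word]
      refine if_congr (by rw [List.nodup_ofFn]; simp only [List.length_ofFn, and_true]) ?_ rfl
      rw [List.map_ofFn]
      congr 3
      funext i
      rw [Function.comp_apply, rankIn, countP_ofFn]
    rw [h]
    refine Measurable.ite measurableSet_injective ?_ measurable_const
    refine (measurable_of_countable
      (fun v : Fin (m + 1) → ℕ => Φ (word (List.ofFn fun i => Fin.ofNat (m + 1) (v i))))).comp
      (measurable_pi_lambda _ fun i => ?_)
    refine Finset.measurable_sum _ fun j _ => ?_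
    exact Measurable.ite (measurableSet_lt (measurable_pi_apply j) (measurable_pi_apply i))
      measurable_const measurable_const
  · have h : (fun t : Fin n → unitInterval => standardize Φ (word (List.ofFn t))) = 0 := by
      funext t
      rw [standardize_word, if_neg (by simp [hn])]
      rfl
    rw [h]
    exact measurable_const

/-- The sum over permutations is an integral over the cube: almost every point of the cube lies in
exactly one of the `(m + 1)!` congruent chambers. -/
lemma sum_perm_eq_integral {m : ℕ} {Φ : FreeAlgebra ℝ (Fin (m + 1)) →ₗ[ℝ] ℝ}
    (hΦ : ∀ M ∈ productMonomials (m + 1), |Φ M| ≤ 1) (lam : unitInterval) :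
    ∑ σ : Equiv.Perm (Fin (m + 1)), chainWeight (lam : ℝ) (List.ofFn σ) * Φ (word (List.ofFn σ)) =
      (m + 1).factorial * ∫ t : Fin (m + 1) → unitInterval,
        chainWeight (lam : ℝ) (List.ofFn t) * standardize Φ (word (List.ofFn t)) := by
  set F : (Fin (m + 1) → unitInterval) → ℝ := fun t =>
    chainWeight (lam : ℝ) (List.ofFn t) * standardize Φ (word (List.ofFn t)) with hF
  set S := ∑ σ : Equiv.Perm (Fin (m + 1)),
    chainWeight (lam : ℝ) (List.ofFn σ) * Φ (word (List.ofFn σ)) with hS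
  have hΨ := isBoundedFunctional_standardize hΦ
  have hFm : Measurable F := (measurable_chainWeight _ _).mul (hΨ.measurable _)
  have hFb : ∀ t, ‖F t‖ ≤ 1 := fun t => by
    rw [Real.norm_eq_abs, abs_mul]
    refine mul_le_one₀ (abs_chainWeight_le_one lam _) (abs_nonneg _) ?_
    rw [← commProd_map_of]
    exact hΨ.bound _
  have hFi : Integrable F := Integrable.of_bound hFm.aestronglyMeasurable 1 (Eventually.of_forall hFb)
  have hmp : ∀ ρ : Equiv.Perm (Fin (m + 1)), MeasurePreserving
      (MeasurableEquiv.arrowCongr' ρ.symm (MeasurableEquiv.refl unitInterval)) := fun ρ =>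
    volume_preserving_arrowCongr' _ _ (MeasurePreserving.id _)
  have hρ : ∀ ρ : Equiv.Perm (Fin (m + 1)), ∫ t, F (t ∘ ρ) = ∫ t, F t := fun ρ =>
    (hmp ρ).integral_comp' F
  have hρi : ∀ ρ : Equiv.Perm (Fin (m + 1)), Integrable fun t => F (t ∘ ρ) := fun ρ =>
    (hmp ρ).integrable_comp_of_integrable hFi
  have hsum : (fun t => ∑ ρ : Equiv.Perm (Fin (m + 1)), F (t ∘ ρ)) =ᵐ[volume] fun _ => S := by
    -- almost every point has distinct coordinates, so its rearrangements enumerate the permutations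
    filter_upwards [ae_injective (m + 1)] with t ht
    simp only [hF, standardize_comp_perm Φ _ t ht]
    exact Equiv.sum_comp (Equiv.mulLeft (rankPerm t ht)) fun σ : Equiv.Perm (Fin (m + 1)) =>
      chainWeight (lam : ℝ) (List.ofFn σ) * Φ (word (List.ofFn σ))
  calc S = ∫ _ : Fin (m + 1) → unitInterval, S := by simp
    _ = ∫ t, ∑ ρ : Equiv.Perm (Fin (m + 1)), F (t ∘ ρ) := (integral_congr_ae hsum).symm
    _ = ∑ ρ : Equiv.Perm (Fin (m + 1)), ∫ t, F (t ∘ ρ) := integral_finsetSum _ fun ρ _ => hρi ρ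
    _ = (m + 1).factorial * ∫ t, F t := by
      simp only [hρ, Finset.sum_const, Finset.card_univ, Fintype.card_perm, Fintype.card_fin,
        nsmul_eq_mul]

/-! ### The extended Lie norm -/

section ExtNorm

variable {n : ℕ}

lemma extNorm_le_of_presentation {f : (Fin n → unitInterval) → ℝ} (m : ℕ)
    (M : Fin m → productMonomials n) (g : Fin m → (Fin n → unitInterval) → ℝ)
    (hg : ∀ j, Integrable (g j)) (hf : f =ᵐ[volume] fun t => ∑ j, substDensity (M j).1 (g j) t) :
    extNorm f ≤ ∑ j, ∫⁻ s, ‖g j s‖ₑ :=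
  iInf_le_of_le m (iInf_le_of_le M (iInf_le_of_le g (iInf_le_of_le hg (iInf_le_of_le hf le_rfl))))

lemma le_extNorm {f : (Fin n → unitInterval) → ℝ} {C : ℝ≥0∞}
    (h : ∀ (m : ℕ) (M : Fin m → productMonomials n) (g : Fin m → (Fin n → unitInterval) → ℝ),
      (∀ j, Integrable (g j)) → (f =ᵐ[volume] fun t => ∑ j, substDensity (M j).1 (g j) t) →
      C ≤ ∑ j, ∫⁻ s, ‖g j s‖ₑ) : C ≤ extNorm f :=
  le_iInf fun m => le_iInf fun M => le_iInf fun g => le_iInf fun hg => le_iInf fun hf =>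
    h m M g hg hf

/-- The monomial `X₀ ⋯ X_{n-1}` as a product of commutator monomials. -/
def idMonomial (n : ℕ) : productMonomials n :=
  ⟨word (List.ofFn (1 : Equiv.Perm (Fin n))), (List.ofFn (1 : Equiv.Perm (Fin n))).map FreeMagma.of,
    (content_map_of _).trans (coe_ofFn_perm _), commProd_map_of _⟩

lemma substDensity_idMonomial (g : (Fin n → unitInterval) → ℝ) (t : Fin n → unitInterval) :
    substDensity (idMonomial n).1 g t = g t := by
  classical
  rw [substDensity, Finset.sum_eq_single 1]
  · rw [wordCoeff_eq_listCoeff, idMonomial, listCoeff_word, if_pos rfl, one_mul]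
    rfl
  · intro σ _ hσ
    rw [wordCoeff_eq_listCoeff, idMonomial, listCoeff_word, if_neg, zero_mul]
    intro h
    exact hσ (Equiv.coe_fn_injective (List.ofFn_injective h)).symm
  · simp

lemma extNorm_le_add {f g : (Fin n → unitInterval) → ℝ} (hfg : Integrable fun t => f t - g t) :
    extNorm f ≤ extNorm g + ∫⁻ t, ‖f t - g t‖ₑ := by
  rw [← tsub_le_iff_right]
  refine le_extNorm fun m M h hh hg => ?_
  rw [tsub_le_iff_right]
  refine (extNorm_le_of_presentation (m + 1) (Fin.cons (idMonomial n) M)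
    (Fin.cons (fun t => f t - g t) h) (fun j => ?_) ?_).trans ?_
  · refine Fin.cases ?_ (fun j => ?_) j
    · exact hfg
    · exact hh j
  · filter_upwards [hg] with t ht
    rw [Fin.sum_univ_succ]
    simp only [Fin.cons_zero, Fin.cons_succ]
    rw [substDensity_idMonomial, ← ht, sub_add_cancel]
  · rw [Fin.sum_univ_succ]
    simp only [Fin.cons_zero, Fin.cons_succ]
    rw [add_comm]

lemma extNorm_zero : extNorm (fun _ : Fin n → unitInterval => (0 : ℝ)) = 0 := by
  refine le_antisymm ?_ zero_le
  refine (extNorm_le_of_presentation 0 Fin.elim0 Fin.elim0 (fun j => j.elim0) ?_).trans ?_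
  · simp only [Finset.univ_eq_empty, Finset.sum_empty]
    exact EventuallyEq.rfl
  · simp

lemma extNorm_le_lintegral {f : (Fin n → unitInterval) → ℝ} (hf : Integrable f) :
    extNorm f ≤ ∫⁻ t, ‖f t‖ₑ := by
  have := extNorm_le_add (f := f) (g := fun _ => 0) (by simpa using hf)
  simpa [extNorm_zero] using this

lemma extNorm_ne_top {f : (Fin n → unitInterval) → ℝ} (hf : Integrable f) : extNorm f ≠ ∞ :=
  ((extNorm_le_lintegral hf).trans_lt hf.2).ne

/-- The extended Lie norm is `1`-Lipschitz with respect to the `L¹` norm. -/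
lemma abs_toReal_extNorm_sub_le {f g : (Fin n → unitInterval) → ℝ} (hf : Integrable f)
    (hg : Integrable g) :
    |(extNorm f).toReal - (extNorm g).toReal| ≤ ∫ t, |f t - g t| := by
  have key : ∀ {f g : (Fin n → unitInterval) → ℝ}, Integrable f → Integrable g →
      (extNorm f).toReal ≤ (extNorm g).toReal + ∫ t, |f t - g t| := by
    intro f g hf hg
    have hfg : Integrable fun t => f t - g t := hf.sub hg
    have h1 := ENNReal.toReal_mono (ENNReal.add_ne_top.2 ⟨extNorm_ne_top hg, hfg.2.ne⟩)
      (extNorm_le_add hfg)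
    rw [ENNReal.toReal_add (extNorm_ne_top hg) hfg.2.ne] at h1
    refine h1.trans_eq ?_
    rw [← integral_norm_eq_lintegral_enorm hfg.1]
    rfl
  have h1 := key hf hg
  have h2 := key hg hf
  have h3 : ∫ t, |g t - f t| = ∫ t, |f t - g t| := by simp only [abs_sub_comm]
  rw [abs_le]
  constructor <;> linarith

lemma toReal_extNorm_le {f : (Fin n → unitInterval) → ℝ} (hf : Integrable f) :
    (extNorm f).toReal ≤ ∫ t, |f t| := by
  have h1 := ENNReal.toReal_mono hf.2.ne (extNorm_le_lintegral hf)
  refine h1.trans_eq ?_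
  rw [← integral_norm_eq_lintegral_enorm hf.1]
  rfl

end ExtNorm

/-! ### Duality with functionals on the free algebra -/

section Functional

variable {Ψ : FreeAlgebra ℝ unitInterval →ₗ[ℝ] ℝ} {c : ℝ}

lemma IsBoundedFunctional.abs_word_le (hΨ : IsBoundedFunctional Ψ c) (l : List unitInterval) :
    |Ψ (word l)| ≤ c := by
  rw [← commProd_map_of]; exact hΨ.bound _

lemma IsBoundedFunctional.nonneg (hΨ : IsBoundedFunctional Ψ c) : 0 ≤ c :=
  (abs_nonneg _).trans (hΨ.bound [])

/-- The substitution of points for the variables of a multilinear polynomial. -/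
lemma sum_wordCoeff_mul {n : ℕ} (M : productMonomials n) (s : Fin n → unitInterval) :
    ∑ σ : Equiv.Perm (Fin n), wordCoeff M.1 σ * Ψ (word (List.ofFn (s ∘ σ))) =
      Ψ (FreeAlgebra.lift ℝ (fun i => FreeAlgebra.ι ℝ (s i)) M.1) := by
  obtain ⟨M, L, hL, hM⟩ := M
  have hmem : M ∈ wordSpan (Finset.univ.val : Multiset (Fin n)) := by
    rw [← hL, ← hM]; exact commProd_mem_wordSpan L
  change _ = Ψ (FreeAlgebra.lift ℝ (fun i => FreeAlgebra.ι ℝ (s i)) M)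
  conv_rhs => rw [eq_sum_wordCoeff hmem]
  rw [map_sum, map_sum]
  refine Finset.sum_congr rfl fun σ _ => ?_
  rw [map_smul, map_smul, smul_eq_mul, lift_word, List.map_ofFn]

lemma IsBoundedFunctional.abs_sum_wordCoeff_le (hΨ : IsBoundedFunctional Ψ c) {n : ℕ}
    (M : productMonomials n) (s : Fin n → unitInterval) :
    |∑ σ : Equiv.Perm (Fin n), wordCoeff M.1 σ * Ψ (word (List.ofFn (s ∘ σ)))| ≤ c := by
  rw [sum_wordCoeff_mul]
  obtain ⟨M, L, hL, rfl⟩ := M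
  change |Ψ (FreeAlgebra.lift ℝ (fun i => FreeAlgebra.ι ℝ (s i)) (commProd L))| ≤ c
  rw [lift_commProd]
  exact hΨ.bound _

/-- The pairing with one term `∫ g(s) M(Z(s₀), …, Z(s_{n-1}))` of a presentation: after the change of
variables `t = s ∘ σ` in every word, the functional is applied to `M` at the points `s`. -/
lemma IsBoundedFunctional.integral_substDensity (hΨ : IsBoundedFunctional Ψ c) {n : ℕ}
    (M : productMonomials n) {g : (Fin n → unitInterval) → ℝ} (hg : Integrable g) :
    (Integrable fun t => substDensity M.1 g t * Ψ (word (List.ofFn t))) ∧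
    ‖∫ t, substDensity M.1 g t * Ψ (word (List.ofFn t))‖ₑ ≤ ENNReal.ofReal c * ∫⁻ s, ‖g s‖ₑ := by
  have hmp : ∀ σ : Equiv.Perm (Fin n), MeasurePreserving
      (MeasurableEquiv.arrowCongr' σ.symm (MeasurableEquiv.refl unitInterval)) := fun σ =>
    volume_preserving_arrowCongr' _ _ (MeasurePreserving.id _)
  have hint : ∀ σ : Equiv.Perm (Fin n),
      Integrable fun s => g s * (wordCoeff M.1 σ * Ψ (word (List.ofFn (s ∘ σ)))) := by
    intro σ
    refine hg.mul_bdd (c := |wordCoeff M.1 σ| * c) ?_ (Eventually.of_forall fun s => ?_)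
    · exact ((((hΨ.measurable n).comp (hmp σ).measurable)).const_mul _).aestronglyMeasurable
    · rw [Real.norm_eq_abs, abs_mul]
      exact mul_le_mul_of_nonneg_left (hΨ.abs_word_le _) (abs_nonneg _)
  have hcomp : ∀ (σ : Equiv.Perm (Fin n)) (t : Fin n → unitInterval),
      (fun s => g s * (wordCoeff M.1 σ * Ψ (word (List.ofFn (s ∘ σ))))) (t ∘ σ.symm) =
        wordCoeff M.1 σ * g (t ∘ σ.symm) * Ψ (word (List.ofFn t)) := by
    intro σ t
    have : (t ∘ σ.symm) ∘ σ = t := by ext; simp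
    simp only [this]
    ring
  have hint' : ∀ σ : Equiv.Perm (Fin n),
      Integrable fun t => wordCoeff M.1 σ * g (t ∘ σ.symm) * Ψ (word (List.ofFn t)) := by
    intro σ
    simp only [← hcomp]
    exact (hmp σ.symm).integrable_comp_of_integrable (hint σ)
  have heq : ∀ σ : Equiv.Perm (Fin n),
      ∫ t, wordCoeff M.1 σ * g (t ∘ σ.symm) * Ψ (word (List.ofFn t)) =
        ∫ s, g s * (wordCoeff M.1 σ * Ψ (word (List.ofFn (s ∘ σ)))) := by
    intro σ
    simp only [← hcomp]
    exact (hmp σ.symm).integral_comp'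
      fun s => g s * (wordCoeff M.1 σ * Ψ (word (List.ofFn (s ∘ σ))))
  have hsum : ∀ t, substDensity M.1 g t * Ψ (word (List.ofFn t)) =
      ∑ σ : Equiv.Perm (Fin n), wordCoeff M.1 σ * g (t ∘ σ.symm) * Ψ (word (List.ofFn t)) :=
    fun t => by rw [substDensity, Finset.sum_mul]
  simp only [hsum]
  refine ⟨integrable_finsetSum _ fun σ _ => hint' σ, ?_⟩
  rw [integral_finsetSum _ fun σ _ => hint' σ]
  simp only [heq]
  rw [← integral_finsetSum _ fun σ _ => hint σ]
  simp only [← Finset.mul_sum]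
  refine (enorm_integral_le_lintegral_enorm _).trans ?_
  rw [← lintegral_const_mul' _ _ ENNReal.ofReal_ne_top]
  refine lintegral_mono fun s => ?_
  rw [enorm_mul, mul_comm]
  gcongr
  rw [Real.enorm_eq_ofReal_abs]
  exact ENNReal.ofReal_le_ofReal (hΨ.abs_sum_wordCoeff_le M s)

/-- A bounded functional defines an element of the dual unit ball (scaled by `c`) of the extended
Lie norm. -/
lemma IsBoundedFunctional.abs_integral_le (hΨ : IsBoundedFunctional Ψ c) {n : ℕ}
    {f : (Fin n → unitInterval) → ℝ} (hf : Integrable f) :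
    |∫ t, f t * Ψ (word (List.ofFn t))| ≤ c * (extNorm f).toReal := by
  have key : ‖∫ t, f t * Ψ (word (List.ofFn t))‖ₑ ≤ ENNReal.ofReal c * extNorm f := by
    rcases eq_or_ne c 0 with rfl | hc
    · have : ∀ t : Fin n → unitInterval, Ψ (word (List.ofFn t)) = 0 := fun t =>
        abs_nonpos_iff.1 (hΨ.abs_word_le _)
      simp [this]
    have hc0 : ENNReal.ofReal c ≠ 0 := by
      rw [ne_eq, ENNReal.ofReal_eq_zero, not_le]
      exact lt_of_le_of_ne hΨ.nonneg hc.symm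
    rw [mul_comm, ← ENNReal.div_le_iff hc0 ENNReal.ofReal_ne_top]
    refine le_extNorm fun m M g hg hfg => ?_
    rw [ENNReal.div_le_iff hc0 ENNReal.ofReal_ne_top, mul_comm]
    have h1 : ∫ t, f t * Ψ (word (List.ofFn t)) =
        ∑ j, ∫ t, substDensity (M j).1 (g j) t * Ψ (word (List.ofFn t)) := by
      rw [← integral_finsetSum _ fun j _ => (hΨ.integral_substDensity (M j) (hg j)).1]
      refine integral_congr_ae ?_
      filter_upwards [hfg] with t ht
      rw [ht, Finset.sum_mul]
    rw [h1, Finset.mul_sum]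
    exact (enorm_sum_le _ _).trans
      (Finset.sum_le_sum fun j _ => (hΨ.integral_substDensity (M j) (hg j)).2)
  have h2 := ENNReal.toReal_mono (ENNReal.mul_ne_top ENNReal.ofReal_ne_top (extNorm_ne_top hf)) key
  rwa [ENNReal.toReal_mul, ENNReal.toReal_ofReal hΨ.nonneg, toReal_enorm, Real.norm_eq_abs] at h2

/-- A bounded functional is measurable in the letters of a word, also after multiplication by a
fixed element. -/
lemma IsBoundedFunctional.measurable_word_mul (hΨ : IsBoundedFunctional Ψ c) (n : ℕ)
    (y : FreeAlgebra ℝ unitInterval) :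
    Measurable fun t : Fin n → unitInterval => Ψ (word (List.ofFn t) * y) := by
  induction y using word_induction with
  | word l =>
    have h : (fun t : Fin n → unitInterval => Ψ (word (List.ofFn t) * word l)) =
        (fun t => Ψ (word (List.ofFn t))) ∘ fun t : Fin n → unitInterval => Fin.append t l.get := by
      funext t
      rw [Function.comp_apply, List.ofFn_fin_append, List.ofFn_get, word_append]
    rw [h]
    refine (hΨ.measurable _).comp (measurable_pi_lambda _ fun i => ?_)
    refine Fin.addCases (fun i => ?_) (fun i => ?_) i
    · simp only [Fin.append_left]; exact measurable_pi_apply i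
    · simp only [Fin.append_right]; exact measurable_const
  | zero => simp
  | add a b ha hb => simp only [mul_add, map_add]; exact ha.add hb
  | smul r a ha => simp only [mul_smul_comm, map_smul, smul_eq_mul]; exact ha.const_mul r

/-- For a fixed `y`, the values of a bounded functional at all `w y`, `w` a word, are bounded. -/
lemma IsBoundedFunctional.exists_abs_word_mul_le (hΨ : IsBoundedFunctional Ψ c)
    (y : FreeAlgebra ℝ unitInterval) :
    ∃ C, 0 ≤ C ∧ ∀ l : List unitInterval, |Ψ (word l * y)| ≤ C := by
  induction y using word_induction with
  | word l => exact ⟨c, hΨ.nonneg, fun l' => by rw [← word_append]; exact hΨ.abs_word_le _⟩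
  | zero => exact ⟨0, le_rfl, by simp⟩
  | add a b ha hb =>
    obtain ⟨C, hC0, hC⟩ := ha
    obtain ⟨D, hD0, hD⟩ := hb
    refine ⟨C + D, add_nonneg hC0 hD0, fun l => ?_⟩
    rw [mul_add, map_add]
    exact (abs_add_le _ _).trans (add_le_add (hC l) (hD l))
  | smul r a ha =>
    obtain ⟨C, hC0, hC⟩ := ha
    refine ⟨|r| * C, by positivity, fun l => ?_⟩
    rw [mul_smul_comm, map_smul, smul_eq_mul, abs_mul]
    exact mul_le_mul_of_nonneg_left (hC l) (abs_nonneg _)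

end Functional

/-! ### Iterated integrals along paths -/

/-- A bounded measurable real function on a probability space is integrable. -/
lemma integrable_of_abs_le {α : Type*} [MeasurableSpace α] {μ : Measure α} [IsFiniteMeasure μ]
    {f : α → ℝ} (hf : Measurable f) {C : ℝ} (hC : ∀ x, |f x| ≤ C) : Integrable f μ :=
  Integrable.of_bound hf.aestronglyMeasurable C (Eventually.of_forall hC)

lemma abs_integral_le_of_abs_le {α : Type*} [MeasurableSpace α] {μ : Measure α}
    [IsProbabilityMeasure μ] {f : α → ℝ} {C : ℝ} (hC : ∀ x, |f x| ≤ C) : |∫ x, f x ∂μ| ≤ C := by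
  have := norm_integral_le_of_norm_le_const (μ := μ) (Eventually.of_forall hC : ∀ᵐ x ∂μ, ‖f x‖ ≤ C)
  simpa using this

lemma measurable_fin_cons {n : ℕ} :
    Measurable fun q : unitInterval × (Fin n → unitInterval) =>
      (Fin.cons q.1 q.2 : Fin (n + 1) → unitInterval) := by
  refine measurable_pi_lambda _ fun i => ?_
  refine Fin.cases ?_ (fun i => ?_) i
  · exact measurable_fst
  · exact (measurable_pi_apply i).comp measurable_snd

lemma measurable_fin_snoc {n : ℕ} :
    Measurable fun q : unitInterval × (Fin n → unitInterval) =>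
      (Fin.snoc q.2 q.1 : Fin (n + 1) → unitInterval) := by
  refine measurable_pi_lambda _ fun i => ?_
  refine Fin.lastCases ?_ (fun i => ?_) i
  · simp only [Fin.snoc_last]; exact measurable_fst
  · simp only [Fin.snoc_castSucc]; exact (measurable_pi_apply i).comp measurable_snd

lemma ofFn_cons {n : ℕ} {X : Type*} (a : X) (t : Fin n → X) :
    List.ofFn (Fin.cons a t : Fin (n + 1) → X) = a :: List.ofFn t := by
  rw [List.ofFn_succ]; simp

lemma ofFn_snoc {n : ℕ} {X : Type*} (t : Fin n → X) (a : X) :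
    List.ofFn (Fin.snoc t a : Fin (n + 1) → X) = List.ofFn t ++ [a] := by
  rw [List.ofFn_succ', List.concat_eq_append]; simp

/-- Fubini for the last coordinate of a cube. -/
lemma integral_snoc {n : ℕ} {F : (Fin (n + 1) → unitInterval) → ℝ} (hF : Measurable F) {C : ℝ}
    (hC : ∀ t, |F t| ≤ C) :
    ∫ t, F t = ∫ a : unitInterval, ∫ t : Fin n → unitInterval, F (Fin.snoc t a) := by
  have hmp := (volume_preserving_piFinSuccAbove (fun _ : Fin (n + 1) => unitInterval)
    (Fin.last n)).symm
  rw [← hmp.integral_comp' F]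
  have hG : Measurable fun q : unitInterval × (Fin n → unitInterval) =>
      F ((MeasurableEquiv.piFinSuccAbove (fun _ : Fin (n + 1) => unitInterval) (Fin.last n)).symm q) :=
    hF.comp (MeasurableEquiv.measurable _)
  rw [Measure.volume_eq_prod, integral_prod _ (integrable_of_abs_le hG fun q => hC _)]
  refine integral_congr_ae (Eventually.of_forall fun a => ?_)
  refine integral_congr_ae (Eventually.of_forall fun t => ?_)
  simp [MeasurableEquiv.piFinSuccAbove_symm_apply, Fin.insertNthEquiv, Fin.insertNth_last']

lemma chainWeight_append_pair {X : Type*} [LinearOrder X] (lam : ℝ) (l : List X) (a b : X) :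
    chainWeight lam (l ++ [a, b]) = chainWeight lam (l ++ [a]) * stepWeight lam a b := by
  induction l with
  | nil => simp [chainWeight]
  | cons x l ih =>
    rcases l with _ | ⟨y, l⟩
    · simp [chainWeight]
    · simp only [List.cons_append, chainWeight] at ih ⊢
      rw [ih, mul_assoc]

section PathIntegral

variable (lam : unitInterval) (Ψ : FreeAlgebra ℝ unitInterval →ₗ[ℝ] ℝ)

/-- The integral of `lam ^ asc * (lam - 1) ^ des` for `(a₁, …, a_k, b)` against
`Ψ (X_{a₁} ⋯ X_{a_k} X_b y)`, over `a₁, …, a_k`, as an iterated integral. -/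
def pathIntegral : ℕ → FreeAlgebra ℝ unitInterval → unitInterval → ℝ
  | 0, y, b => Ψ (FreeAlgebra.ι ℝ b * y)
  | k + 1, y, b => ∫ a, stepWeight (lam : ℝ) a b * pathIntegral k (FreeAlgebra.ι ℝ b * y) a

variable {lam Ψ} {c : ℝ}

lemma measurable_pathIntegral (hΨ : IsBoundedFunctional Ψ c) (k n : ℕ)
    (y : FreeAlgebra ℝ unitInterval) :
    Measurable fun q : unitInterval × (Fin n → unitInterval) =>
      pathIntegral lam Ψ k (word (List.ofFn q.2) * y) q.1 := by
  induction k generalizing n with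
  | zero =>
    have h := (hΨ.measurable_word_mul (n + 1) y).comp measurable_fin_cons
    simp only [Function.comp_def, ofFn_cons, word_cons, mul_assoc] at h
    exact h
  | succ k ih =>
    have h1 : Measurable fun q : (unitInterval × (Fin n → unitInterval)) × unitInterval =>
        stepWeight (lam : ℝ) q.2 q.1.1 *
          pathIntegral lam Ψ k (FreeAlgebra.ι ℝ q.1.1 * (word (List.ofFn q.1.2) * y)) q.2 := by
      refine (measurable_stepWeight _ measurable_snd measurable_fst.fst).mul ?_
      have h2 := (ih (n + 1)).comp (measurable_snd.prodMk
        ((measurable_fin_cons (n := n)).comp measurable_fst) :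
        Measurable fun q : (unitInterval × (Fin n → unitInterval)) × unitInterval =>
          (q.2, (Fin.cons q.1.1 q.1.2 : Fin (n + 1) → unitInterval)))
      simp only [Function.comp_def, ofFn_cons, word_cons, mul_assoc] at h2
      exact h2
    exact h1.stronglyMeasurable.integral_prod_right.measurable

lemma measurable_pathIntegral_right (hΨ : IsBoundedFunctional Ψ c) (k : ℕ)
    (y : FreeAlgebra ℝ unitInterval) : Measurable (pathIntegral lam Ψ k y) := by
  have h := (measurable_pathIntegral (lam := lam) hΨ k 0 y).comp
    (measurable_id.prodMk measurable_const :
      Measurable fun a : unitInterval => (a, (Fin.elim0 : Fin 0 → unitInterval)))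
  simpa [Function.comp_def] using h

lemma abs_pathIntegral_le {y : FreeAlgebra ℝ unitInterval} {C : ℝ}
    (hC : ∀ l : List unitInterval, |Ψ (word l * y)| ≤ C) (k : ℕ) (l : List unitInterval)
    (b : unitInterval) : |pathIntegral lam Ψ k (word l * y) b| ≤ C := by
  induction k generalizing l b with
  | zero =>
    rw [pathIntegral, ← mul_assoc, ← word_cons]
    exact hC _
  | succ k ih =>
    rw [pathIntegral]
    refine abs_integral_le_of_abs_le fun a => ?_
    rw [abs_mul, ← mul_assoc, ← word_cons]
    exact (mul_le_mul (abs_stepWeight_le_one lam a b) (ih _ _) (abs_nonneg _) zero_le_one).trans_eq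
      (one_mul C)

lemma exists_abs_pathIntegral_le (hΨ : IsBoundedFunctional Ψ c) (y : FreeAlgebra ℝ unitInterval) :
    ∃ C, 0 ≤ C ∧ ∀ (k : ℕ) (l : List unitInterval) (b : unitInterval),
      |pathIntegral lam Ψ k (word l * y) b| ≤ C := by
  obtain ⟨C, hC0, hC⟩ := hΨ.exists_abs_word_mul_le y
  exact ⟨C, hC0, fun k l b => abs_pathIntegral_le hC k l b⟩

lemma integrable_pathIntegral (hΨ : IsBoundedFunctional Ψ c) (k : ℕ)
    (y : FreeAlgebra ℝ unitInterval) (b : unitInterval) :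
    Integrable fun a => stepWeight (lam : ℝ) a b * pathIntegral lam Ψ k y a := by
  obtain ⟨C, hC0, hC⟩ := exists_abs_pathIntegral_le (lam := lam) hΨ y
  refine integrable_of_abs_le (C := C) ((measurable_stepWeight _ measurable_id measurable_const).mul
    (measurable_pathIntegral_right hΨ k y)) fun a => ?_
  rw [abs_mul]
  have := hC k [] a
  rw [word_nil, one_mul] at this
  exact (mul_le_mul (abs_stepWeight_le_one lam a b) this (abs_nonneg _) zero_le_one).trans_eq
    (one_mul C)

lemma pathIntegral_add (hΨ : IsBoundedFunctional Ψ c) (k : ℕ) (x y : FreeAlgebra ℝ unitInterval)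
    (b : unitInterval) :
    pathIntegral lam Ψ k (x + y) b = pathIntegral lam Ψ k x b + pathIntegral lam Ψ k y b := by
  induction k generalizing x y b with
  | zero => simp only [pathIntegral, mul_add, map_add]
  | succ k ih =>
    simp only [pathIntegral, mul_add, ih]
    exact integral_add (integrable_pathIntegral hΨ k _ b) (integrable_pathIntegral hΨ k _ b)

lemma pathIntegral_smul (k : ℕ) (r : ℝ) (y : FreeAlgebra ℝ unitInterval) (b : unitInterval) :
    pathIntegral lam Ψ k (r • y) b = r * pathIntegral lam Ψ k y b := by
  induction k generalizing y b with
  | zero => simp only [pathIntegral, mul_smul_comm, map_smul, smul_eq_mul]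
  | succ k ih =>
    simp only [pathIntegral, mul_smul_comm, ih, mul_left_comm _ r, integral_const_mul]

/-- If the path integrals are bounded on products of commutator monomials, then
`z ↦ pathIntegral k (z y)` is a bounded functional for every product `y` of commutator monomials. -/
lemma exists_isBoundedFunctional_pathIntegral (hΨ : IsBoundedFunctional Ψ c) {k : ℕ}
    {a : unitInterval} {C : ℝ}
    (hC : ∀ L : List (FreeMagma unitInterval), |pathIntegral lam Ψ k (commProd L) a| ≤ C)
    (L : List (FreeMagma unitInterval)) :
    ∃ Θ : FreeAlgebra ℝ unitInterval →ₗ[ℝ] ℝ, IsBoundedFunctional Θ C ∧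
      ∀ z, Θ z = pathIntegral lam Ψ k (z * commProd L) a := by
  refine ⟨{ toFun := fun z => pathIntegral lam Ψ k (z * commProd L) a
            map_add' := fun x y => by rw [add_mul, pathIntegral_add hΨ]
            map_smul' := fun r y => by rw [smul_mul_assoc, pathIntegral_smul]; rfl },
    ⟨fun L' => ?_, fun n => ?_⟩, fun z => rfl⟩
  · change |pathIntegral lam Ψ k (commProd L' * commProd L) a| ≤ C
    rw [← commProd_append]
    exact hC _
  · exact (measurable_pathIntegral hΨ k n (commProd L)).comp (measurable_const.prodMk measurable_id)

/-- The density of the block between two consecutive points `a`, `b` of the coarse path. -/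
def blockDensity (lam : unitInterval) (n : ℕ) (a b : unitInterval) (t : Fin n → unitInterval) : ℝ :=
  chainWeight (lam : ℝ) (a :: (List.ofFn t ++ [b]))

lemma abs_blockDensity_le_one (n : ℕ) (a b : unitInterval) (t : Fin n → unitInterval) :
    |blockDensity lam n a b t| ≤ 1 := abs_chainWeight_le_one lam _

lemma measurable_blockDensity (n : ℕ) :
    Measurable fun q : (unitInterval × unitInterval) × (Fin n → unitInterval) =>
      blockDensity lam n q.1.1 q.1.2 q.2 := by
  have h := (measurable_chainWeight (lam : ℝ) (n + 1 + 1)).comp ((measurable_fin_cons (n := n + 1)).comp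
    (measurable_fst.fst.prodMk ((measurable_fin_snoc (n := n)).comp
      (measurable_fst.snd.prodMk measurable_snd)) : Measurable
        fun q : (unitInterval × unitInterval) × (Fin n → unitInterval) =>
          (q.1.1, (Fin.snoc q.2 q.1.2 : Fin (n + 1) → unitInterval))))
  simp only [Function.comp_def, ofFn_cons, ofFn_snoc] at h
  exact h

lemma blockDensity_snoc (n : ℕ) (a b d : unitInterval) (t : Fin n → unitInterval) :
    blockDensity lam (n + 1) a b (Fin.snoc t d) =
      blockDensity lam n a d t * stepWeight (lam : ℝ) d b := by
  rw [blockDensity, blockDensity, ofFn_snoc, List.append_assoc, ← List.cons_append]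
  exact chainWeight_append_pair _ (a :: List.ofFn t) d b

lemma integrable_blockDensity (n : ℕ) (a b : unitInterval) :
    Integrable (blockDensity lam n a b) :=
  integrable_of_abs_le ((measurable_blockDensity n).comp (measurable_const.prodMk measurable_id :
      Measurable fun t : Fin n → unitInterval => ((a, b), t)))
    fun t => abs_blockDensity_le_one n a b t

lemma measurable_block_mul_pathIntegral (hΨ : IsBoundedFunctional Ψ c) (k n : ℕ)
    (y : FreeAlgebra ℝ unitInterval) (b : unitInterval) :
    Measurable fun q : unitInterval × (Fin n → unitInterval) =>
      blockDensity lam n q.1 b q.2 * pathIntegral lam Ψ k (word (List.ofFn q.2) * y) q.1 :=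
  ((measurable_blockDensity n).comp ((measurable_fst.prodMk measurable_const).prodMk
    measurable_snd)).mul (measurable_pathIntegral hΨ k n y)

/-- Separation of the last block of a path integral. -/
lemma pathIntegral_add_block (hΨ : IsBoundedFunctional Ψ c) (k q : ℕ)
    (y : FreeAlgebra ℝ unitInterval) (b : unitInterval) :
    pathIntegral lam Ψ (k + q + 1) y b = ∫ a, ∫ t : Fin q → unitInterval,
      blockDensity lam q a b t *
        pathIntegral lam Ψ k (word (List.ofFn t) * (FreeAlgebra.ι ℝ b * y)) a := by
  induction q generalizing y b with
  | zero =>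
    rw [add_zero, pathIntegral]
    refine integral_congr_ae (Eventually.of_forall fun a => ?_)
    have h : ∀ t : Fin 0 → unitInterval, blockDensity lam 0 a b t *
        pathIntegral lam Ψ k (word (List.ofFn t) * (FreeAlgebra.ι ℝ b * y)) a =
          stepWeight (lam : ℝ) a b * pathIntegral lam Ψ k (FreeAlgebra.ι ℝ b * y) a := by
      intro t
      simp [blockDensity, chainWeight]
    simp only [h]
    simp
  | succ q ih =>
    obtain ⟨C, hC0, hC⟩ := exists_abs_pathIntegral_le (lam := lam) hΨ y
    have hb : ∀ (n : ℕ) (a b : unitInterval) (s : Fin n → unitInterval) (l : List unitInterval),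
        |blockDensity lam n a b s * pathIntegral lam Ψ k (word l * y) a| ≤ C := by
      intro n a b s l
      rw [abs_mul]
      exact (mul_le_mul (abs_blockDensity_le_one n a b s) (hC k l a) (abs_nonneg _)
        zero_le_one).trans_eq (one_mul C)
    -- the joint integrand over `a`, the block `t`, and the last point `d` of the block
    let G : unitInterval → unitInterval → (Fin q → unitInterval) → ℝ := fun a d t =>
      blockDensity lam (q + 1) a b (Fin.snoc t d) * pathIntegral lam Ψ k
        (word (List.ofFn (Fin.snoc t d : Fin (q + 1) → unitInterval)) * (FreeAlgebra.ι ℝ b * y)) a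
    have hGm : Measurable fun p : (unitInterval × unitInterval) × (Fin q → unitInterval) =>
        G p.1.1 p.1.2 p.2 :=
      (measurable_block_mul_pathIntegral hΨ k (q + 1) (FreeAlgebra.ι ℝ b * y) b).comp
        (measurable_fst.fst.prodMk (measurable_fin_snoc.comp
          (measurable_fst.snd.prodMk measurable_snd)))
    have hGb : ∀ a d t, |G a d t| ≤ C := by
      intro a d t
      have := hb (q + 1) a b (Fin.snoc t d)
        (List.ofFn (Fin.snoc t d : Fin (q + 1) → unitInterval) ++ [b])
      rwa [word_append, word_cons, word_nil, mul_one, mul_assoc] at this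
    have hGi : Integrable (Function.uncurry fun a d => ∫ t, G a d t) := by
      refine integrable_of_abs_le (C := C)
        hGm.stronglyMeasurable.integral_prod_right.measurable fun p => ?_
      exact abs_integral_le_of_abs_le fun t => hGb _ _ _
    have hRHS : ∀ a, ∫ t : Fin (q + 1) → unitInterval, blockDensity lam (q + 1) a b t *
        pathIntegral lam Ψ k (word (List.ofFn t) * (FreeAlgebra.ι ℝ b * y)) a =
          ∫ d, ∫ t, G a d t := by
      intro a
      refine integral_snoc (C := C) ((measurable_block_mul_pathIntegral hΨ k (q + 1) _ b).comp
        (measurable_const.prodMk measurable_id)) fun t => ?_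
      have := hb (q + 1) a b t (List.ofFn t ++ [b])
      rwa [word_append, word_cons, word_nil, mul_one, mul_assoc] at this
    simp only [hRHS]
    rw [integral_integral_swap hGi, show k + (q + 1) + 1 = (k + q + 1) + 1 by ring, pathIntegral]
    refine integral_congr_ae (Eventually.of_forall fun d => ?_)
    simp only [ih, ← integral_const_mul]
    refine integral_congr_ae (Eventually.of_forall fun a => ?_)
    refine integral_congr_ae (Eventually.of_forall fun t => ?_)
    simp only [G, blockDensity_snoc, ofFn_snoc, word_append, word_cons, word_nil, mul_one, mul_assoc]
    ring

/-- The integral over the cube as a path integral. -/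
lemma pathIntegral_eq_integral (hΨ : IsBoundedFunctional Ψ c) (k : ℕ)
    (y : FreeAlgebra ℝ unitInterval) (b : unitInterval) :
    pathIntegral lam Ψ k y b = ∫ t : Fin k → unitInterval,
      chainWeight (lam : ℝ) (List.ofFn t ++ [b]) *
        Ψ (word (List.ofFn t) * (FreeAlgebra.ι ℝ b * y)) := by
  induction k generalizing y b with
  | zero => simp [pathIntegral, chainWeight]
  | succ k ih =>
    obtain ⟨C, hC0, hC⟩ := hΨ.exists_abs_word_mul_le (FreeAlgebra.ι ℝ b * y)
    have hm : Measurable fun t : Fin (k + 1) → unitInterval =>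
        chainWeight (lam : ℝ) (List.ofFn t ++ [b]) *
          Ψ (word (List.ofFn t) * (FreeAlgebra.ι ℝ b * y)) := by
      have h1 := (measurable_chainWeight (lam : ℝ) (k + 1 + 1)).comp
        ((measurable_fin_snoc (n := k + 1)).comp (measurable_const.prodMk measurable_id :
          Measurable fun t : Fin (k + 1) → unitInterval => (b, t)))
      simp only [Function.comp_def, ofFn_snoc] at h1
      exact h1.mul (hΨ.measurable_word_mul _ _)
    rw [integral_snoc hm (C := C) fun t => by
      rw [abs_mul]
      exact (mul_le_mul (abs_chainWeight_le_one lam _) (hC _) (abs_nonneg _) zero_le_one).trans_eq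
        (one_mul C), pathIntegral]
    refine integral_congr_ae (Eventually.of_forall fun a => ?_)
    simp only [ih, ← integral_const_mul]
    refine integral_congr_ae (Eventually.of_forall fun t => ?_)
    simp only [ofFn_snoc, List.append_assoc, List.cons_append, List.nil_append,
      chainWeight_append_pair, word_append, word_cons, word_nil, mul_one, mul_assoc]
    ring

lemma integral_chainWeight_mul (hΨ : IsBoundedFunctional Ψ c) (k : ℕ) :
    ∫ t : Fin (k + 1) → unitInterval, chainWeight (lam : ℝ) (List.ofFn t) * Ψ (word (List.ofFn t)) =
      ∫ b, pathIntegral lam Ψ k 1 b := by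
  refine (integral_snoc (C := c) ((measurable_chainWeight _ _).mul (hΨ.measurable _)) fun t => by
    rw [Pi.mul_apply, abs_mul]
    exact (mul_le_mul (abs_chainWeight_le_one lam _) (hΨ.abs_word_le _) (abs_nonneg _)
      zero_le_one).trans_eq (one_mul c)).trans ?_
  refine integral_congr_ae (Eventually.of_forall fun b => ?_)
  simp only [pathIntegral_eq_integral hΨ, Pi.mul_apply, ofFn_snoc, word_append, word_cons, word_nil,
    mul_one]

end PathIntegral

/-! ### The kernel -/

section Kernel

lemma lam_pow_asc_mul_pow_des (lam : ℝ) {n : ℕ} (t : Fin (n + 1) → unitInterval) :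
    lam ^ asc t * (lam - 1) ^ des t = chainWeight lam (List.ofFn t) := by
  induction n with
  | zero => simp [asc, des, chainWeight]
  | succ n ih =>
    have h := ih fun i => t i.succ
    have e1 : asc t = (if t 0 < t 1 then 1 else 0) + asc fun i => t i.succ := by
      simp only [asc, Finset.card_filter, Fin.sum_univ_succ (n := n)]
      rfl
    have e2 : des t = (if t 1 < t 0 then 1 else 0) + des fun i => t i.succ := by
      simp only [des, Finset.card_filter, Fin.sum_univ_succ (n := n)]
      rfl
    rw [e1, e2, List.ofFn_succ, List.ofFn_succ, chainWeight, ← List.ofFn_succ (f := fun i => t i.succ),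
      ← h, stepWeight, pow_add, pow_add]
    rcases lt_trichotomy (t 0) (t 1) with h' | h' | h'
    · simp [h', h'.not_gt]; ring
    · simp [h']
    · simp [h', h'.not_gt]; ring

lemma kernel_eq (n : ℕ) (lam a b : unitInterval) :
    kernel n lam a b = (extNorm (blockDensity lam n a b)).toReal := by
  have : (fun t : Fin n → unitInterval =>
      (lam : ℝ) ^ asc (enclose a t b) * ((lam : ℝ) - 1) ^ des (enclose a t b)) =
        blockDensity lam n a b := by
    funext t
    rw [lam_pow_asc_mul_pow_des, enclose, ofFn_cons, ofFn_snoc, blockDensity]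
  rw [kernel, this]

lemma kernel_nonneg (n : ℕ) (lam a b : unitInterval) : 0 ≤ kernel n lam a b :=
  ENNReal.toReal_nonneg

lemma kernel_le_one (n : ℕ) (lam a b : unitInterval) : kernel n lam a b ≤ 1 := by
  rw [kernel_eq]
  refine (toReal_extNorm_le (integrable_blockDensity n a b)).trans ?_
  refine (le_abs_self _).trans (abs_integral_le_of_abs_le fun t => ?_)
  rw [abs_abs]
  exact abs_blockDensity_le_one n a b t

lemma abs_kernel_le_one (n : ℕ) (lam a b : unitInterval) : |kernel n lam a b| ≤ 1 := by
  rw [abs_of_nonneg (kernel_nonneg n lam a b)]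
  exact kernel_le_one n lam a b

lemma abs_chainWeight_sub_le {X : Type*} [LinearOrder X] (lam mu : unitInterval) (l : List X) :
    |chainWeight (lam : ℝ) l - chainWeight (mu : ℝ) l| ≤ l.length * |(lam : ℝ) - mu| := by
  induction l with
  | nil => simp [chainWeight]
  | cons a l ih =>
    rcases l with _ | ⟨b, l⟩
    · simp [chainWeight]
    · have h1 : |stepWeight (lam : ℝ) a b - stepWeight (mu : ℝ) a b| ≤ |(lam : ℝ) - mu| := by
        unfold stepWeight
        split_ifs
        · exact le_rfl
        · simp
        · simp
      have h2 := abs_stepWeight_le_one lam a b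
      have h3 := abs_chainWeight_le_one mu (b :: l)
      rw [chainWeight, chainWeight, List.length_cons, Nat.cast_add, Nat.cast_one, add_mul, one_mul,
        show ∀ x y z w : ℝ, x * y - z * w = x * (y - w) + (x - z) * w from fun x y z w => by ring]
      refine (abs_add_le _ _).trans (add_le_add ?_ ?_)
      · rw [abs_mul]
        exact (mul_le_mul_of_nonneg_right h2 (abs_nonneg _)).trans (by rw [one_mul]; exact ih)
      · rw [abs_mul]
        exact (mul_le_mul h1 h3 (abs_nonneg _) (abs_nonneg _)).trans_eq (mul_one _)

/-- The kernel is Lipschitz in the parameter, uniformly in the end points. -/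
lemma abs_kernel_sub_le (n : ℕ) (lam mu a b : unitInterval) :
    |kernel n lam a b - kernel n mu a b| ≤ (n + 2) * |(lam : ℝ) - mu| := by
  rw [kernel_eq, kernel_eq]
  refine (abs_toReal_extNorm_sub_le (integrable_blockDensity n a b)
    (integrable_blockDensity n a b)).trans ?_
  refine (le_abs_self _).trans (abs_integral_le_of_abs_le fun t => ?_)
  rw [abs_abs]
  have hlen : ((a :: (List.ofFn t ++ [b])).length : ℝ) = n + 2 := by
    rw [List.length_cons, List.length_append, List.length_ofFn, List.length_singleton]
    push_cast
    ring
  exact (abs_chainWeight_sub_le lam mu _).trans_eq (by rw [hlen])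

lemma eventually_stepWeight_eq (lam : ℝ) {x y : ℕ → unitInterval} {a b : unitInterval}
    (hx : Tendsto x atTop (𝓝 a)) (hy : Tendsto y atTop (𝓝 b)) (hab : a ≠ b) :
    ∀ᶠ N in atTop, stepWeight lam (x N) (y N) = stepWeight lam a b := by
  rcases lt_or_gt_of_ne hab with h | h
  · filter_upwards [hx.eventually_lt hy h] with N hN
    simp [stepWeight, h, hN]
  · filter_upwards [hy.eventually_lt hx h] with N hN
    simp [stepWeight, h, hN, h.not_gt, hN.not_gt]

lemma eventually_chainWeight_eq (lam : ℝ) {y : ℕ → unitInterval} {b : unitInterval}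
    (hy : Tendsto y atTop (𝓝 b)) (l : List unitInterval) (x : unitInterval) (hx : x ≠ b)
    (hl : ∀ z ∈ l, z ≠ b) :
    ∀ᶠ N in atTop, chainWeight lam (x :: (l ++ [y N])) = chainWeight lam (x :: (l ++ [b])) := by
  induction l generalizing x with
  | nil =>
    filter_upwards [eventually_stepWeight_eq lam tendsto_const_nhds hy hx] with N hN
    simp [chainWeight, hN]
  | cons z l ih =>
    filter_upwards [ih z (hl z (by simp)) fun w hw => hl w (by simp [hw])] with N hN
    simp only [List.cons_append, chainWeight] at hN ⊢
    rw [hN]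

/-- The kernel is sequentially continuous along a common approximation of the two end points. On
the diagonal, where the kernel may jump for `n = 0`, this uses that equal points have equal
approximations. -/
lemma tendsto_kernel (n : ℕ) (lam a b : unitInterval) {φ : ℕ → unitInterval → unitInterval}
    (hφ : ∀ x, Tendsto (fun N => φ N x) atTop (𝓝 x)) :
    Tendsto (fun N => kernel n lam (φ N a) (φ N b)) atTop (𝓝 (kernel n lam a b)) := by
  have hae : ∀ᵐ t : Fin n → unitInterval, ∀ᶠ N in atTop,
      blockDensity lam n (φ N a) (φ N b) t = blockDensity lam n a b t := by
    have ha : ∀ᵐ t : Fin n → unitInterval, ∀ i, t i ≠ a :=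
      ae_all_iff.2 fun i => Measure.ae_eval_ne (fun _ => (volume : Measure unitInterval)) i a
    have hb : ∀ᵐ t : Fin n → unitInterval, ∀ i, t i ≠ b :=
      ae_all_iff.2 fun i => Measure.ae_eval_ne (fun _ => (volume : Measure unitInterval)) i b
    filter_upwards [ha, hb] with t hta htb
    rcases n with _ | n
    · rcases eq_or_ne a b with rfl | hab
      · exact Eventually.of_forall fun N => by simp [blockDensity, chainWeight, stepWeight]
      · filter_upwards [eventually_stepWeight_eq (lam : ℝ) (hφ a) (hφ b) hab] with N hN
        simp [blockDensity, chainWeight, hN]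
    · have h1 := eventually_stepWeight_eq (lam : ℝ) (hφ a) (tendsto_const_nhds (x := t 0))
        (hta 0).symm
      have h2 := eventually_chainWeight_eq (lam : ℝ) (hφ b) (List.ofFn fun i => t (Fin.succ i)) (t 0)
        (htb 0) (fun z hz => by
          obtain ⟨i, rfl⟩ := List.mem_ofFn.1 hz
          exact htb _)
      filter_upwards [h1, h2] with N h1 h2
      simp only [blockDensity, List.ofFn_succ (f := t), List.cons_append, chainWeight]
      rw [h1, h2]
  have hlim : Tendsto (fun N => ∫ t : Fin n → unitInterval,
      |blockDensity lam n (φ N a) (φ N b) t - blockDensity lam n a b t|) atTop (𝓝 0) := by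
    have h0 : (0 : ℝ) = ∫ _ : Fin n → unitInterval, (0 : ℝ) := by simp
    rw [h0]
    refine tendsto_integral_of_dominated_convergence (fun _ => 2) (fun N => ?_)
      (integrable_const _) (fun N => Eventually.of_forall fun t => ?_) ?_
    · exact ((integrable_blockDensity n _ _).sub (integrable_blockDensity n a b)).abs.1
    · rw [Real.norm_eq_abs, abs_abs]
      refine (abs_sub _ _).trans ?_
      linarith [abs_blockDensity_le_one (lam := lam) n (φ N a) (φ N b) t,
        abs_blockDensity_le_one (lam := lam) n a b t]
    · filter_upwards [hae] with t ht
      refine tendsto_const_nhds.congr' ?_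
      filter_upwards [ht] with N hN
      rw [hN, sub_self, abs_zero]
  rw [tendsto_iff_dist_tendsto_zero]
  refine squeeze_zero (fun _ => dist_nonneg) (fun N => ?_) hlim
  rw [Real.dist_eq, kernel_eq, kernel_eq]
  exact abs_toReal_extNorm_sub_le (integrable_blockDensity n _ _) (integrable_blockDensity n a b)

/-- A function of two points is measurable if it is the limit of its values along every common
approximation of the two points. -/
lemma measurable_of_tendsto_common_approx {k : unitInterval → unitInterval → ℝ}
    (hk : ∀ φ : ℕ → unitInterval → unitInterval,
      (∀ x, Tendsto (fun N => φ N x) atTop (𝓝 x)) →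
      ∀ a b, Tendsto (fun N => k (φ N a) (φ N b)) atTop (𝓝 (k a b))) :
    Measurable fun x : unitInterval × unitInterval => k x.1 x.2 := by
  -- approximation of the identity by simple functions makes the function of two points simple
  let φ : ℕ → SimpleFunc unitInterval unitInterval := fun N =>
    SimpleFunc.approxOn id measurable_id univ 0 (mem_univ _) N
  have hφ : ∀ x, Tendsto (fun N => φ N x) atTop (𝓝 x) := fun x =>
    SimpleFunc.tendsto_approxOn measurable_id (mem_univ _) (by simp)
  refine measurable_of_tendsto_metrizable (f := fun N (x : unitInterval × unitInterval) =>
    k (φ N x.1) (φ N x.2)) (fun N => ?_) (tendsto_pi_nhds.2 fun x =>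
      hk (fun N => φ N) hφ x.1 x.2)
  exact ((((φ N).comp Prod.fst measurable_fst).pair ((φ N).comp Prod.snd measurable_snd)).map
    fun x => k x.1 x.2).measurable

lemma measurable_kernel (n : ℕ) (lam : unitInterval) {α : Type*} [MeasurableSpace α]
    {f g : α → unitInterval} (hf : Measurable f) (hg : Measurable g) :
    Measurable fun x => kernel n lam (f x) (g x) := by
  have key : ∀ k : unitInterval → unitInterval → ℝ,
      (Measurable fun x : unitInterval × unitInterval => k x.1 x.2) →
      Measurable fun x => k (f x) (g x) := fun k hk => hk.comp (hf.prodMk hg)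
  exact key _ (measurable_of_tendsto_common_approx fun φ hφ a b => tendsto_kernel n lam a b hφ)

/-- `1 Kⁿ` for the integral operator `K` with kernel `kernel q lam`, acting from the right. -/
def iterKernel (q : ℕ) (lam : unitInterval) : ℕ → unitInterval → ℝ
  | 0, _ => 1
  | n + 1, b => ∫ a, iterKernel q lam n a * kernel q lam a b

variable (q : ℕ) (lam : unitInterval)

lemma measurable_iterKernel (n : ℕ) : Measurable (iterKernel q lam n) := by
  induction n with
  | zero => exact measurable_const
  | succ n ih =>
    have h : Measurable fun x : unitInterval × unitInterval =>
        iterKernel q lam n x.2 * kernel q lam x.2 x.1 :=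
      (ih.comp measurable_snd).mul (measurable_kernel q lam measurable_snd measurable_fst)
    exact h.stronglyMeasurable.integral_prod_right.measurable

lemma iterKernel_nonneg (n : ℕ) (b : unitInterval) : 0 ≤ iterKernel q lam n b := by
  induction n generalizing b with
  | zero => exact zero_le_one
  | succ n ih => exact integral_nonneg fun a => mul_nonneg (ih a) (kernel_nonneg q lam a b)

lemma abs_iterKernel_le_one (n : ℕ) (b : unitInterval) : |iterKernel q lam n b| ≤ 1 := by
  induction n generalizing b with
  | zero => simp [iterKernel]
  | succ n ih =>
    refine abs_integral_le_of_abs_le fun a => ?_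
    rw [abs_mul]
    exact mul_le_one₀ (ih a) (abs_nonneg _) (abs_kernel_le_one q lam a b)

lemma integrable_iterKernel_mul_kernel (n : ℕ) (b : unitInterval) :
    Integrable fun a => iterKernel q lam n a * kernel q lam a b := by
  refine integrable_of_abs_le (C := 1) ((measurable_iterKernel q lam n).mul
    (measurable_kernel q lam measurable_id measurable_const)) fun a => ?_
  rw [abs_mul]
  exact mul_le_one₀ (abs_iterKernel_le_one q lam n a) (abs_nonneg _) (abs_kernel_le_one q lam a b)

lemma integrable_iterKernel (n : ℕ) : Integrable (iterKernel q lam n) :=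
  integrable_of_abs_le (measurable_iterKernel q lam n) (abs_iterKernel_le_one q lam n)

variable {q lam}

/-- The block estimate: each block of a path integral is paired with a bounded functional, so that
it contributes at most its extended Lie norm, i.e. the kernel. -/
lemma abs_pathIntegral_le_iterKernel {Ψ : FreeAlgebra ℝ unitInterval →ₗ[ℝ] ℝ} {c : ℝ}
    (hΨ : IsBoundedFunctional Ψ c) (r n : ℕ) (L : List (FreeMagma unitInterval))
    (b : unitInterval) :
    |pathIntegral lam Ψ (r + n * (q + 1)) (commProd L) b| ≤ c * iterKernel q lam n b := by
  induction n generalizing L b with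
  | zero =>
    have h : ∀ l : List unitInterval, |Ψ (word l * commProd L)| ≤ c := fun l => by
      rw [← commProd_map_of, ← commProd_append]
      exact hΨ.bound _
    have := abs_pathIntegral_le (lam := lam) h r [] b
    rw [word_nil, one_mul] at this
    simpa [iterKernel] using this
  | succ n ih =>
    rw [show r + (n + 1) * (q + 1) = (r + n * (q + 1)) + q + 1 by ring,
      pathIntegral_add_block hΨ, iterKernel, ← integral_const_mul, ← Real.norm_eq_abs]
    refine norm_integral_le_of_norm_le ((integrable_iterKernel_mul_kernel q lam n b).const_mul c)
      (Eventually.of_forall fun a => ?_)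
    -- by induction, the rest of the path is a functional of the block bounded by the iterated kernel
    obtain ⟨Θ, hΘ, hΘe⟩ := exists_isBoundedFunctional_pathIntegral (lam := lam) hΨ
      (fun L => ih L a) (FreeMagma.of b :: L)
    have h := hΘ.abs_integral_le (integrable_blockDensity (lam := lam) q a b)
    simp only [hΘe, commProd_cons, commMonomial] at h
    rw [kernel_eq, ← mul_assoc, Real.norm_eq_abs]
    exact h

/-- The estimate of `Θ_k^Lie` by the iterated kernels: the first `r` steps of a path of `r + n (q + 1)`
steps are estimated trivially, the others form `n` blocks. -/
lemma thetaLie_le (r n : ℕ) {B : ℝ} (hB : ∀ lam : unitInterval, ∫ b, iterKernel q lam n b ≤ B) :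
    thetaLie (r + n * (q + 1) + 1) ≤ ENNReal.ofReal B := by
  set m := r + n * (q + 1) with hm
  refine thetaLie_le_of_functional (m + 1) (Nat.succ_ne_zero _) fun Φ hΦ => ?_
  rw [magnusCommutator_eq_sum _ (Nat.succ_ne_zero _), map_sum]
  have hcont : ∀ σ : Equiv.Perm (Fin (m + 1)), Continuous fun lam : ℝ =>
      chainWeight lam (List.ofFn σ) * Φ (word (List.ofFn σ)) := fun σ =>
    (continuous_chainWeight _).mul continuous_const
  have h1 : ∑ σ : Equiv.Perm (Fin (m + 1)), Φ ((∫ lam in (0 : ℝ)..1,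
      chainWeight lam (List.ofFn σ)) • word (List.ofFn σ)) =
      ∫ lam in (0 : ℝ)..1, ∑ σ : Equiv.Perm (Fin (m + 1)),
        chainWeight lam (List.ofFn σ) * Φ (word (List.ofFn σ)) := by
    rw [intervalIntegral.integral_finsetSum fun σ _ => (hcont σ).intervalIntegrable _ _]
    refine Finset.sum_congr rfl fun σ _ => ?_
    rw [map_smul, smul_eq_mul, intervalIntegral.integral_mul_const]
  rw [h1]
  have h2 : ∀ lam ∈ Icc (0 : ℝ) 1, ∑ σ : Equiv.Perm (Fin (m + 1)),
      chainWeight lam (List.ofFn σ) * Φ (word (List.ofFn σ)) ≤ (m + 1).factorial * B := by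
    intro lam hlam
    have hΨ := isBoundedFunctional_standardize hΦ
    rw [sum_perm_eq_integral hΦ ⟨lam, hlam⟩]
    refine mul_le_mul_of_nonneg_left ?_ (Nat.cast_nonneg _)
    rw [integral_chainWeight_mul (lam := ⟨lam, hlam⟩) hΨ]
    refine le_trans ?_ (hB ⟨lam, hlam⟩)
    have hle : ∀ b, |pathIntegral ⟨lam, hlam⟩ (standardize Φ) m 1 b| ≤
        iterKernel q ⟨lam, hlam⟩ n b := fun b => by
      simpa using abs_pathIntegral_le_iterKernel (q := q) (lam := ⟨lam, hlam⟩) hΨ r n [] b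
    refine integral_mono (integrable_of_abs_le (C := 1) (measurable_pathIntegral_right hΨ m 1)
      fun b => (hle b).trans ((le_abs_self _).trans (abs_iterKernel_le_one _ _ _ _)))
      (integrable_iterKernel _ _ _) fun b => (le_abs_self _).trans (hle b)
  have h3 := intervalIntegral.integral_mono_on zero_le_one
    ((continuous_finsetSum _ fun σ _ => hcont σ).intervalIntegrable 0 1)
    (continuous_const.intervalIntegrable (μ := volume) 0 1) h2
  simpa using h3

end Kernel

/-! ### Integral operators with bounded kernels -/

section Operator

lemma integral_norm_le_norm (f : L2) : ∫ s, ‖f s‖ ≤ ‖f‖ := by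
  have hf := Lp.memLp f
  have h1 : eLpNorm f 1 volume ≤ eLpNorm f 2 volume :=
    eLpNorm_le_eLpNorm_of_exponent_le one_le_two hf.1
  rw [integral_norm_eq_lintegral_enorm hf.1, ← eLpNorm_one_eq_lintegral_enorm, Lp.norm_def]
  exact ENNReal.toReal_mono (Lp.eLpNorm_ne_top f) h1

lemma integrable_L2 (f : L2) : Integrable f :=
  (Lp.memLp f).integrable one_le_two

variable {k : unitInterval → unitInterval → ℝ} {C : ℝ}

lemma integrable_mul_kernel (hk : Measurable fun x : unitInterval × unitInterval => k x.1 x.2)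
    (hC : ∀ s t, |k s t| ≤ C) (f : L2) (t : unitInterval) :
    Integrable fun s => f s * (k s t : ℂ) := by
  refine (integrable_L2 f).mul_bdd (c := C) ?_ (Eventually.of_forall fun s => ?_)
  · exact (Complex.measurable_ofReal.comp
      (hk.comp (measurable_id.prodMk measurable_const))).aestronglyMeasurable
  · rw [Complex.norm_real]; exact hC s t

lemma norm_integral_mul_kernel_le (hC : ∀ s t, |k s t| ≤ C) (f : L2) (t : unitInterval) :
    ‖∫ s, f s * (k s t : ℂ)‖ ≤ C * ‖f‖ := by
  have hC0 : 0 ≤ C := (abs_nonneg _).trans (hC 0 0)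
  calc ‖∫ s, f s * (k s t : ℂ)‖ ≤ ∫ s, C * ‖f s‖ := by
        refine norm_integral_le_of_norm_le ((integrable_L2 f).norm.const_mul C)
          (Eventually.of_forall fun s => ?_)
        rw [norm_mul, Complex.norm_real, mul_comm]
        exact mul_le_mul_of_nonneg_right (hC s t) (norm_nonneg _)
    _ = C * ∫ s, ‖f s‖ := integral_const_mul _ _
    _ ≤ C * ‖f‖ := mul_le_mul_of_nonneg_left (integral_norm_le_norm f) hC0

lemma stronglyMeasurable_integral_mul_kernel
    (hk : Measurable fun x : unitInterval × unitInterval => k x.1 x.2) (f : L2) :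
    StronglyMeasurable fun t => ∫ s, f s * (k s t : ℂ) := by
  have h : StronglyMeasurable fun x : unitInterval × unitInterval => f x.2 * (k x.2 x.1 : ℂ) :=
    ((Lp.stronglyMeasurable f).comp_measurable measurable_snd).mul
      (Complex.measurable_ofReal.comp
        (hk.comp (measurable_snd.prodMk measurable_fst))).stronglyMeasurable
  exact h.integral_prod_right

lemma memLp_integral_mul_kernel
    (hk : Measurable fun x : unitInterval × unitInterval => k x.1 x.2)
    (hC : ∀ s t, |k s t| ≤ C) (f : L2) :
    MemLp (fun t => ∫ s, f s * (k s t : ℂ)) 2 volume :=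
  MemLp.of_bound (stronglyMeasurable_integral_mul_kernel hk f).aestronglyMeasurable (C * ‖f‖)
    (Eventually.of_forall (norm_integral_mul_kernel_le hC f))

/-- A bounded measurable kernel defines a bounded integral operator. -/
lemma exists_isIntegralOperator
    (hk : Measurable fun x : unitInterval × unitInterval => k x.1 x.2)
    (hC : ∀ s t, |k s t| ≤ C) : ∃ T : L2 →L[ℂ] L2, IsIntegralOperator k T := by
  have hC0 : 0 ≤ C := (abs_nonneg _).trans (hC 0 0)
  let T₀ : L2 →ₗ[ℂ] L2 :=
    { toFun := fun f => (memLp_integral_mul_kernel hk hC f).toLp _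
      map_add' := fun f g => by
        rw [← MemLp.toLp_add]
        refine MemLp.toLp_congr _ _ (Eventually.of_forall fun t => ?_)
        rw [Pi.add_apply, ← integral_add (integrable_mul_kernel hk hC f t)
          (integrable_mul_kernel hk hC g t)]
        refine integral_congr_ae ?_
        filter_upwards [Lp.coeFn_add f g] with s hs
        rw [hs, Pi.add_apply, add_mul]
      map_smul' := fun c f => by
        rw [RingHom.id_apply, ← MemLp.toLp_const_smul]
        refine MemLp.toLp_congr _ _ (Eventually.of_forall fun t => ?_)
        rw [Pi.smul_apply, smul_eq_mul, ← integral_const_mul]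
        refine integral_congr_ae ?_
        filter_upwards [Lp.coeFn_smul c f] with s hs
        rw [hs, Pi.smul_apply, smul_eq_mul, mul_assoc] }
  refine ⟨T₀.mkContinuous C fun f => ?_, fun f => ?_⟩
  · have h := Lp.norm_le_of_ae_bound (f := T₀ f) (C := C * ‖f‖) (by positivity) (by
      filter_upwards [MemLp.coeFn_toLp (memLp_integral_mul_kernel hk hC f)] with t ht
      change ‖(memLp_integral_mul_kernel hk hC f).toLp _ t‖ ≤ _
      rw [ht]
      exact norm_integral_mul_kernel_le hC f t)
    simpa [measureUnivNNReal] using h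
  · exact MemLp.coeFn_toLp (memLp_integral_mul_kernel hk hC f)

lemma IsIntegralOperator.norm_le {T : L2 →L[ℂ] L2} (hT : IsIntegralOperator k T)
    (hC : ∀ s t, |k s t| ≤ C) : ‖T‖ ≤ C := by
  have hC0 : 0 ≤ C := (abs_nonneg _).trans (hC 0 0)
  refine T.opNorm_le_bound hC0 fun f => ?_
  have h := Lp.norm_le_of_ae_bound (f := T f) (C := C * ‖f‖) (by positivity) (by
    filter_upwards [hT f] with t ht
    rw [ht]
    exact norm_integral_mul_kernel_le hC f t)
  simpa [measureUnivNNReal] using h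

lemma IsIntegralOperator.sub {k' : unitInterval → unitInterval → ℝ} {T T' : L2 →L[ℂ] L2}
    (hk : Measurable fun x : unitInterval × unitInterval => k x.1 x.2)
    (hC : ∀ s t, |k s t| ≤ C)
    (hk' : Measurable fun x : unitInterval × unitInterval => k' x.1 x.2)
    (hC' : ∀ s t, |k' s t| ≤ C)
    (hT : IsIntegralOperator k T) (hT' : IsIntegralOperator k' T') :
    IsIntegralOperator (fun s t => k s t - k' s t) (T - T') := by
  intro f
  filter_upwards [hT f, hT' f, Lp.coeFn_sub (T f) (T' f)] with t h1 h2 h3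
  rw [sub_apply, h3, Pi.sub_apply, h1, h2,
    ← integral_sub (integrable_mul_kernel hk hC f t) (integrable_mul_kernel hk' hC' f t)]
  refine integral_congr_ae (Eventually.of_forall fun s => ?_)
  simp only
  push_cast
  ring

variable {q : ℕ}

/-- The integral operator with kernel `kernel q lam`. -/
def kernelOp (q : ℕ) (lam : unitInterval) : L2 →L[ℂ] L2 :=
  (exists_isIntegralOperator (measurable_kernel q lam measurable_fst measurable_snd)
    (abs_kernel_le_one q lam)).choose

lemma isIntegralOperator_kernelOp (q : ℕ) (lam : unitInterval) :
    IsIntegralOperator (kernel q lam) (kernelOp q lam) :=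
  (exists_isIntegralOperator (measurable_kernel q lam measurable_fst measurable_snd)
    (abs_kernel_le_one q lam)).choose_spec

lemma norm_kernelOp_sub_le (q : ℕ) (lam mu : unitInterval) :
    ‖kernelOp q lam - kernelOp q mu‖ ≤ (q + 2) * |(lam : ℝ) - mu| :=
  (IsIntegralOperator.sub (measurable_kernel q lam measurable_fst measurable_snd)
    (abs_kernel_le_one q lam) (measurable_kernel q mu measurable_fst measurable_snd)
    (abs_kernel_le_one q mu) (isIntegralOperator_kernelOp q lam)
    (isIntegralOperator_kernelOp q mu)).norm_le fun s t => abs_kernel_sub_le q lam mu s t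

lemma continuous_kernelOp (q : ℕ) : Continuous (kernelOp q) := by
  refine continuous_iff_continuousAt.2 fun mu => ?_
  refine tendsto_iff_norm_sub_tendsto_zero.2 ?_
  have h : Tendsto (fun lam : unitInterval => ((q : ℝ) + 2) * |(lam : ℝ) - mu|) (𝓝 mu) (𝓝 0) := by
    have hc : Continuous fun lam : unitInterval => ((q : ℝ) + 2) * |(lam : ℝ) - mu| := by fun_prop
    simpa using hc.tendsto mu
  exact squeeze_zero (fun _ => norm_nonneg _) (fun lam => norm_kernelOp_sub_le q lam mu) h

lemma coeFn_one : (one : unitInterval → ℂ) =ᵐ[volume] fun _ => 1 := Lp.coeFn_const ..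

lemma norm_one_L2 : ‖one‖ = 1 := by
  rw [one, Lp.norm_const 2 volume (1 : ℂ) (by simp)]
  simp

lemma kernelOp_pow_one (q : ℕ) (lam : unitInterval) (n : ℕ) :
    (kernelOp q lam ^ n) one =ᵐ[volume] fun b => (iterKernel q lam n b : ℂ) := by
  induction n with
  | zero => simpa [iterKernel] using coeFn_one
  | succ n ih =>
    rw [pow_succ']
    filter_upwards [isIntegralOperator_kernelOp q lam ((kernelOp q lam ^ n) one)] with b hb
    change kernelOp q lam ((kernelOp q lam ^ n) one) b = _
    rw [hb, iterKernel, ← integral_complex_ofReal]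
    refine integral_congr_ae ?_
    filter_upwards [ih] with a ha
    rw [ha]
    push_cast
    rfl

lemma pairing_kernelOp (q : ℕ) (lam : unitInterval) (n : ℕ) :
    pairing (kernelOp q lam) n = ∫ b, iterKernel q lam n b := by
  have h : inner ℂ one ((kernelOp q lam ^ n) one) = ((∫ b, iterKernel q lam n b : ℝ) : ℂ) := by
    rw [L2.inner_def, ← integral_complex_ofReal]
    refine integral_congr_ae ?_
    filter_upwards [coeFn_one, kernelOp_pow_one q lam n] with b h1 h2
    rw [h1, h2]
    simp
  rw [pairing, h, Complex.ofReal_re]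

lemma pairing_nonneg (q : ℕ) (lam : unitInterval) (n : ℕ) : 0 ≤ pairing (kernelOp q lam) n := by
  rw [pairing_kernelOp]
  exact integral_nonneg (iterKernel_nonneg q lam n)

lemma pairing_le_norm_pow (T : L2 →L[ℂ] L2) (n : ℕ) : pairing T n ≤ ‖T ^ n‖ := by
  refine (Complex.re_le_norm _).trans ((norm_inner_le_norm _ _).trans ?_)
  rw [norm_one_L2, one_mul]
  exact ((T ^ n).le_opNorm one).trans_eq (by rw [norm_one_L2, mul_one])

lemma continuous_pairing (q n : ℕ) : Continuous fun lam => pairing (kernelOp q lam) n := by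
  unfold pairing
  have h : Continuous fun lam => (kernelOp q lam ^ n) one :=
    (ContinuousLinearMap.apply ℂ L2 one).continuous.comp ((continuous_kernelOp q).pow n)
  exact Complex.continuous_re.comp (continuous_const.inner h)

/-- A path of `n + m + 1` steps splits into paths of `n` and `m` steps; the middle step has weight
at most `1`. -/
lemma iterKernel_add_le (q : ℕ) (lam : unitInterval) (n m : ℕ) (b : unitInterval) :
    iterKernel q lam (n + 1 + m) b ≤ (∫ a, iterKernel q lam n a) * iterKernel q lam m b := by
  induction m generalizing b with
  | zero =>
    rw [add_zero, iterKernel, iterKernel, mul_one]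
    refine integral_mono (integrable_iterKernel_mul_kernel q lam n b)
      (integrable_iterKernel q lam n) fun a => ?_
    exact mul_le_of_le_one_right (iterKernel_nonneg q lam n a) (kernel_le_one q lam a b)
  | succ m ih =>
    rw [← add_assoc, iterKernel, iterKernel, ← integral_const_mul]
    refine integral_mono (integrable_iterKernel_mul_kernel q lam _ b)
      ((integrable_iterKernel_mul_kernel q lam m b).const_mul _) fun a => ?_
    simp only [← mul_assoc]
    exact mul_le_mul_of_nonneg_right (ih a) (kernel_nonneg q lam a b)

lemma pairing_add_le (q : ℕ) (lam : unitInterval) (n m : ℕ) :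
    pairing (kernelOp q lam) (n + 1 + m) ≤
      pairing (kernelOp q lam) n * pairing (kernelOp q lam) m := by
  simp only [pairing_kernelOp]
  rw [← integral_const_mul]
  exact integral_mono (integrable_iterKernel q lam _) ((integrable_iterKernel q lam m).const_mul _)
    fun b => iterKernel_add_le q lam n m b

end Operator

/-! ### Growth rates of submultiplicative sequences -/

section Growth

variable {u : ℕ → ℝ}

/-- Fekete's lemma for sequences with values in `[0, ∞)`, the limit `0` being allowed. -/
lemma exists_growth_rate (h0 : ∀ n, 0 ≤ u n) (h : ∀ n m, u (n + 1 + m) ≤ u n * u m) :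
    ∃ L : ℝ, 0 ≤ L ∧ (∀ n, L ^ (n + 1) ≤ u n) ∧ ∀ e > L, ∃ C > 0, ∀ n, u n ≤ C * e ^ n := by
  have hbdd : BddBelow (range fun n => u n ^ (1 / ((n : ℝ) + 1))) :=
    ⟨0, by rintro _ ⟨n, rfl⟩; exact Real.rpow_nonneg (h0 n) _⟩
  have hL0 : 0 ≤ ⨅ n, u n ^ (1 / ((n : ℝ) + 1)) :=
    Real.iInf_nonneg fun n => Real.rpow_nonneg (h0 n) _
  have hroot : ∀ n, (u n ^ (1 / ((n : ℝ) + 1))) ^ (n + 1) = u n := fun n => by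
    rw [← Real.rpow_natCast, ← Real.rpow_mul (h0 n)]
    push_cast
    rw [one_div_mul_cancel (by positivity), Real.rpow_one]
  refine ⟨⨅ n, u n ^ (1 / ((n : ℝ) + 1)), hL0, fun n => ?_, fun e he => ?_⟩
  · exact (pow_le_pow_left₀ hL0 (ciInf_le hbdd n) _).trans_eq (hroot n)
  · -- one good index `N` suffices: `u (N + 1 + m) / e ^ (N + 1 + m) ≤ u m / e ^ m`
    obtain ⟨N, hN⟩ := exists_lt_of_ciInf_lt he
    have he0 : 0 < e := hL0.trans_lt he
    have hN' : u N ≤ e ^ (N + 1) :=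
      (hroot N).symm.trans_le (pow_le_pow_left₀ (Real.rpow_nonneg (h0 N) _) hN.le _)
    refine ⟨1 + ∑ i ∈ Finset.range (N + 1), u i / e ^ i,
      add_pos_of_pos_of_nonneg one_pos (Finset.sum_nonneg fun i _ => div_nonneg (h0 i) (by positivity)),
      fun n => ?_⟩
    induction n using Nat.strong_induction_on with
    | _ n ih =>
      rcases lt_or_ge n (N + 1) with hn | hn
      · rw [← div_le_iff₀ (by positivity)]
        have := Finset.single_le_sum (f := fun i => u i / e ^ i)
          (fun i _ => div_nonneg (h0 i) (by positivity)) (Finset.mem_range.2 hn)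
        linarith
      · obtain ⟨m, rfl⟩ := Nat.exists_eq_add_of_le hn
        calc u (N + 1 + m) ≤ u N * u m := h N m
          _ ≤ e ^ (N + 1) * ((1 + ∑ i ∈ Finset.range (N + 1), u i / e ^ i) * e ^ m) :=
            mul_le_mul hN' (ih m (by omega)) (h0 m) (by positivity)
          _ = _ := by rw [pow_add e (N + 1) m]; ring

lemma tendsto_root_of_growth_rate {L : ℝ} (hL : 0 ≤ L) (h1 : ∀ n, L ^ (n + 1) ≤ u n)
    (h2 : ∀ e > L, ∃ C > 0, ∀ n, u n ≤ C * e ^ n) :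
    Tendsto (fun n : ℕ => u n ^ (1 / (n : ℝ))) atTop (𝓝 L) := by
  have hconst : ∀ C > 0, ∀ e ≥ (0 : ℝ),
      Tendsto (fun n : ℕ => (C * e ^ n) ^ (1 / (n : ℝ))) atTop (𝓝 e) := by
    intro C hC e he
    have h3 : Tendsto (fun n : ℕ => C ^ (1 / (n : ℝ)) * e) atTop (𝓝 (C ^ (0 : ℝ) * e)) :=
      ((Real.continuousAt_const_rpow hC.ne').tendsto.comp
        tendsto_one_div_atTop_nhds_zero_nat).mul_const e
    rw [Real.rpow_zero, one_mul] at h3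
    refine h3.congr' ?_
    filter_upwards [eventually_ne_atTop 0] with n hn
    rw [Real.mul_rpow hC.le (by positivity), one_div, Real.pow_rpow_inv_natCast he hn]
  have hu : ∀ n, 0 ≤ u n := fun n => (pow_nonneg hL _).trans (h1 n)
  refine tendsto_order.2 ⟨fun a ha => ?_, fun a ha => ?_⟩
  · rcases hL.eq_or_lt with rfl | hpos
    · exact Eventually.of_forall fun n => ha.trans_le (Real.rpow_nonneg (hu n) _)
    · -- `u n ≥ L * L ^ n`, and the `n`-th root of the right-hand side tends to `L`
      filter_upwards [(hconst L hpos L hL).eventually (lt_mem_nhds ha)] with n hn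
      refine hn.trans_le (Real.rpow_le_rpow (by positivity) ?_ (by positivity))
      rw [← pow_succ']
      exact h1 n
  · obtain ⟨e, he1, he2⟩ := exists_between ha
    obtain ⟨C, hC, hCe⟩ := h2 e he1
    filter_upwards [(hconst C hC e (hL.trans he1.le)).eventually (gt_mem_nhds he2)] with n hn
    exact (Real.rpow_le_rpow (hu n) (hCe n) (by positivity)).trans_lt hn

/-- The root test for the radius of convergence of `Θ^Lie`. -/
lemma le_lieRadius_of_growth {l : ℝ} (hl : 0 ≤ l)
    (h : ∀ d > l, ∃ C : ℝ, 0 ≤ C ∧ ∀ k, thetaLie (k + 1) ≤ ENNReal.ofReal (C * d ^ k)) :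
    1 / ENNReal.ofReal l ≤ lieRadius := by
  refine ENNReal.le_of_forall_nnreal_lt fun x hx => ?_
  have hxl : (x : ℝ) * l < 1 := by
    rcases hl.eq_or_lt with rfl | hpos
    · simp
    · rw [one_div, ← ENNReal.ofReal_inv_of_pos hpos, ← ENNReal.ofReal_coe_nnreal,
        ENNReal.ofReal_lt_ofReal_iff (by positivity)] at hx
      calc (x : ℝ) * l < l⁻¹ * l := mul_lt_mul_of_pos_right hx hpos
        _ = 1 := inv_mul_cancel₀ hpos.ne'
  obtain ⟨d, hd, hxd⟩ : ∃ d > l, (x : ℝ) * d < 1 := by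
    have hc : ContinuousAt (fun d : ℝ => (x : ℝ) * d) l := by fun_prop
    have h1 : ∀ᶠ d in 𝓝[>] l, (x : ℝ) * d < 1 :=
      (hc.eventually_lt continuousAt_const hxl).filter_mono nhdsWithin_le_nhds
    obtain ⟨d, hd1, hd2⟩ := (h1.and self_mem_nhdsWithin).exists
    exact ⟨d, hd2, hd1⟩
  have hd0 : 0 ≤ d := hl.trans hd.le
  obtain ⟨C, hC, hCd⟩ := h d hd
  refine le_iSup₂_of_le x ?_ le_rfl
  have hs : Summable fun k : ℕ => C * x * ((x : ℝ) * d) ^ k :=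
    (summable_geometric_of_lt_one (by positivity) hxd).mul_left _
  refine lt_of_le_of_lt (ENNReal.tsum_le_tsum fun k => ?_) hs.tsum_ofReal_lt_top
  calc thetaLie (k + 1) * (x : ℝ≥0∞) ^ (k + 1)
      ≤ ENNReal.ofReal (C * d ^ k) * ENNReal.ofReal ((x : ℝ) ^ (k + 1)) := by
        rw [ENNReal.ofReal_pow x.coe_nonneg, ENNReal.ofReal_coe_nnreal]
        gcongr
        exact hCd k
    _ = ENNReal.ofReal (C * x * ((x : ℝ) * d) ^ k) := by
        rw [← ENNReal.ofReal_mul (by positivity)]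
        congr 1
        rw [mul_pow]
        ring

/-- Replacing the exponent `n` by the index `k` with `n = ⌊k / p⌋` turns the growth rate `l ^ p`
into `l`. -/
lemma exists_growth_div {p : ℕ} (hp : 1 ≤ p) {l : ℝ} (hl : 0 ≤ l)
    (h : ∀ e > l ^ p, ∃ C > 0, ∀ n, u n ≤ C * e ^ n) {d : ℝ} (hd : l < d) :
    ∃ C : ℝ, 0 ≤ C ∧ ∀ k, u (k / p) ≤ C * d ^ k := by
  have hd0 : 0 < d := hl.trans_lt hd
  obtain ⟨C, hC, hCe⟩ := h (d ^ p) (pow_lt_pow_left₀ hd hl (by omega))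
  refine ⟨C * max 1 d⁻¹ ^ p, by positivity, fun k => (hCe _).trans ?_⟩
  rw [mul_assoc]
  refine mul_le_mul_of_nonneg_left ?_ hC.le
  calc (d ^ p) ^ (k / p) = d⁻¹ ^ (k % p) * d ^ k := by
        conv_rhs => rw [← Nat.mod_add_div k p]
        rw [Nat.add_mul_mod_self_left, Nat.mod_mod, pow_add, ← mul_assoc, ← mul_pow,
          inv_mul_cancel₀ hd0.ne', one_pow, one_mul, pow_mul]
    _ ≤ max 1 d⁻¹ ^ p * d ^ k := by
        refine mul_le_mul_of_nonneg_right ?_ (by positivity)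
        exact (pow_le_pow_left₀ (by positivity) (le_max_right 1 _) _).trans
          (pow_le_pow_right₀ (le_max_left _ _) (Nat.mod_lt k (by omega)).le)

end Growth

/-! ### Spectral radius of a continuous family -/

section Spectral

variable {X A : Type*} [TopologicalSpace X] [NormedRing A] [NormedAlgebra ℂ A] [CompleteSpace A]

/-- A continuous function with invertible values has a continuous inverse. -/
lemma mem_spectrum_continuousMap (F : C(X, A)) (z : ℂ) :
    z ∈ spectrum ℂ F ↔ ∃ x, z ∈ spectrum ℂ (F x) := by
  simp only [spectrum.mem_iff, ContinuousMap.isUnit_iff_forall_isUnit, not_forall]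
  rfl

/-- The spectral radius is attained in a continuous family over a compact space, and the maximum is
the spectral radius of the family as an element of the Banach algebra `C(X, A)`. -/
lemma exists_isGreatest_spectralRadius [CompactSpace X] [Nonempty X] [Nontrivial A] (F : C(X, A)) :
    IsGreatest (range fun x => spectralRadius ℂ (F x)) (spectralRadius ℂ F) := by
  have hle : ∀ x, spectralRadius ℂ (F x) ≤ spectralRadius ℂ F := fun x =>
    iSup₂_le fun z hz => le_iSup₂ (f := fun z (_ : z ∈ spectrum ℂ F) => (‖z‖₊ : ℝ≥0∞)) z
      ((mem_spectrum_continuousMap F z).2 ⟨x, hz⟩)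
  refine ⟨?_, by rintro _ ⟨x, rfl⟩; exact hle x⟩
  obtain ⟨z, hz, hzr⟩ := spectrum.exists_nnnorm_eq_spectralRadius F
  obtain ⟨x, hx⟩ := (mem_spectrum_continuousMap F z).1 hz
  refine ⟨x, (hle x).antisymm ?_⟩
  rw [← hzr]
  exact le_iSup₂ (f := fun z (_ : z ∈ spectrum ℂ (F x)) => (‖z‖₊ : ℝ≥0∞)) z hx

end Spectral

/-! ### The bounds for the convergence radius -/

section Radius

variable (q : ℕ)

instance nontrivial_L2 : Nontrivial L2 :=
  ⟨one, 0, fun h => by simpa [h] using norm_one_L2⟩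

lemma exists_isGreatest_pairing (n : ℕ) :
    ∃ M, IsGreatest (range fun lam => pairing (kernelOp q lam) n) M :=
  (isCompact_range (continuous_pairing q n)).exists_isGreatest (range_nonempty _)

/-- The maximum of `⟨1 K^n, 1⟩` over `lam`. -/
def maxPairing (n : ℕ) : ℝ := (exists_isGreatest_pairing q n).choose

lemma isGreatest_maxPairing (n : ℕ) :
    IsGreatest (range fun lam => pairing (kernelOp q lam) n) (maxPairing q n) :=
  (exists_isGreatest_pairing q n).choose_spec

lemma pairing_le_maxPairing (lam : unitInterval) (n : ℕ) :
    pairing (kernelOp q lam) n ≤ maxPairing q n :=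
  (isGreatest_maxPairing q n).2 ⟨lam, rfl⟩

lemma maxPairing_nonneg (n : ℕ) : 0 ≤ maxPairing q n :=
  (pairing_nonneg q 0 n).trans (pairing_le_maxPairing q 0 n)

lemma maxPairing_add_le (n m : ℕ) :
    maxPairing q (n + 1 + m) ≤ maxPairing q n * maxPairing q m := by
  obtain ⟨lam, h⟩ := (isGreatest_maxPairing q (n + 1 + m)).1
  rw [← h]
  exact (pairing_add_le q lam n m).trans (mul_le_mul (pairing_le_maxPairing q lam n)
    (pairing_le_maxPairing q lam m) (pairing_nonneg q lam m) (maxPairing_nonneg q n))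

/-- `thetaLie_le` with the division of `k` by the length `q + 1` of a block. -/
lemma thetaLie_le_maxPairing (k : ℕ) :
    thetaLie (k + 1) ≤ ENNReal.ofReal (maxPairing q (k / (q + 1))) := by
  have h := thetaLie_le (q := q) (k % (q + 1)) (k / (q + 1)) (B := maxPairing q (k / (q + 1)))
    fun lam => by rw [← pairing_kernelOp]; exact pairing_le_maxPairing q lam _
  rwa [Nat.mod_add_div'] at h

lemma isGreatest_pairing_rpow {p : ℝ} (hp : 0 ≤ p) (n : ℕ) :
    IsGreatest (range fun lam => pairing (kernelOp q lam) n ^ p) (maxPairing q n ^ p) := by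
  obtain ⟨lam, h⟩ := (isGreatest_maxPairing q n).1
  refine ⟨⟨lam, by simp only at h ⊢; rw [h]⟩, ?_⟩
  rintro _ ⟨mu, rfl⟩
  exact Real.rpow_le_rpow (pairing_nonneg q mu n) (pairing_le_maxPairing q mu n) hp

/-- The operators `kernelOp q lam` as a continuous family over the parameter space. -/
def kernelFamily : C(unitInterval, L2 →L[ℂ] L2) := ⟨kernelOp q, continuous_kernelOp q⟩

/-- The growth rate of the maximal pairings is at most the maximal spectral radius. -/
lemma ofReal_growth_rate_le {L : ℝ}
    (hL : Tendsto (fun n : ℕ => maxPairing q n ^ (1 / (n : ℝ))) atTop (𝓝 L)) :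
    ENNReal.ofReal L ≤ spectralRadius ℂ (kernelFamily q) := by
  have h1 : Tendsto (fun n : ℕ => ENNReal.ofReal (maxPairing q n ^ (1 / (n : ℝ)))) atTop
      (𝓝 (ENNReal.ofReal L)) := (ENNReal.continuous_ofReal.tendsto L).comp hL
  have h2 := spectrum.pow_norm_pow_one_div_tendsto_nhds_spectralRadius (kernelFamily q)
  refine le_of_tendsto_of_tendsto' h1 h2 fun n => ?_
  refine ENNReal.ofReal_le_ofReal (Real.rpow_le_rpow (maxPairing_nonneg q n) ?_ (by positivity))
  obtain ⟨lam, h⟩ := (isGreatest_maxPairing q n).1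
  rw [← h]
  exact (pairing_le_norm_pow _ n).trans ((kernelFamily q ^ n).norm_coe_le_norm lam)

end Radius

end MagnusLie

end

theorem mainTheorem5 (p : ℕ) (hp : 1 ≤ p) :
    ∃ T : unitInterval → (MagnusLie.L2 →L[ℂ] MagnusLie.L2),
      (∀ lam : unitInterval, MagnusLie.IsIntegralOperator (MagnusLie.kernel (p - 1) lam) (T lam)) ∧
      (∃ (m : ℕ → ℝ) (l : ℝ),
        (∀ n : ℕ, 1 ≤ n →
          IsGreatest
            (range fun lam : unitInterval => MagnusLie.pairing (T lam) n ^ (1 / ((n : ℝ) * (p : ℝ))))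
            (m n)) ∧
        Tendsto m atTop (𝓝 l) ∧
        1 / ENNReal.ofReal l ≤ MagnusLie.lieRadius) ∧
      (∃ r : ℝ≥0∞,
        IsGreatest (range fun lam : unitInterval => spectralRadius ℂ (T lam) ^ (1 / (p : ℝ))) r ∧
        1 / r ≤ MagnusLie.lieRadius) := by
  obtain ⟨L, hL0, hL1, hL2⟩ := MagnusLie.exists_growth_rate
    (MagnusLie.maxPairing_nonneg (p - 1)) (MagnusLie.maxPairing_add_le (p - 1))
  have hlim := MagnusLie.tendsto_root_of_growth_rate hL0 hL1 hL2
  have hpL : (L ^ (1 / (p : ℝ))) ^ p = L := by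
    rw [one_div, Real.rpow_inv_natCast_pow hL0 (by omega)]
  have hl0 : 0 ≤ L ^ (1 / (p : ℝ)) := Real.rpow_nonneg hL0 _
  have hradius : 1 / ENNReal.ofReal (L ^ (1 / (p : ℝ))) ≤ MagnusLie.lieRadius := by
    refine MagnusLie.le_lieRadius_of_growth hl0 fun d hd => ?_
    obtain ⟨C, hC, hCd⟩ := MagnusLie.exists_growth_div hp hl0 (by rwa [hpL]) hd
    refine ⟨C, hC, fun k => (MagnusLie.thetaLie_le_maxPairing (p - 1) k).trans ?_⟩
    rw [Nat.sub_add_cancel hp]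
    exact ENNReal.ofReal_le_ofReal (hCd k)
  refine ⟨MagnusLie.kernelOp (p - 1), MagnusLie.isIntegralOperator_kernelOp (p - 1),
    ⟨fun n => MagnusLie.maxPairing (p - 1) n ^ (1 / ((n : ℝ) * (p : ℝ))), L ^ (1 / (p : ℝ)),
      fun n _ => MagnusLie.isGreatest_pairing_rpow (p - 1) (by positivity) n, ?_, hradius⟩, ?_⟩
  · refine ((Real.continuousAt_rpow_const L (1 / (p : ℝ))
      (Or.inr (by positivity))).tendsto.comp hlim).congr fun n => ?_
    rw [Function.comp_apply, ← Real.rpow_mul (MagnusLie.maxPairing_nonneg (p - 1) n),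
      one_div_mul_one_div]
  · obtain ⟨⟨lam, hlam⟩, hmax⟩ := MagnusLie.exists_isGreatest_spectralRadius
      (MagnusLie.kernelFamily (p - 1))
    refine ⟨_, ⟨⟨lam, rfl⟩, ?_⟩, le_trans ?_ hradius⟩
    · rintro _ ⟨mu, rfl⟩
      refine ENNReal.rpow_le_rpow ?_ (by positivity)
      exact (hmax ⟨mu, rfl⟩).trans_eq hlam.symm
    · rw [← ENNReal.ofReal_rpow_of_nonneg hL0 (by positivity)]
      refine ENNReal.div_le_div_left (ENNReal.rpow_le_rpow ?_ (by positivity)) 1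
      exact (MagnusLie.ofReal_growth_rate_le (p - 1) hlim).trans_eq hlam.symm
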